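/- Let $\kappa=\pm1$ and let $M_\kappa$ be the three-dimensional space form $S^3$ ($\kappa=1$) or $H^3$ ($\kappa=-1$), with its canonical orientation. Let $\mathcal G_\kappa$ be the four-dimensional manifold of oriented complete geodesics $[\gamma]$ of $M_\kappa$ ($\gamma$ of unit speed, up to translation of the parameter). The tangent space $T_{[\gamma]}\mathcal G_\kappa$ is identified with the space of Jacobi fields $J$ along $\gamma$ with $J\perp\gamma'$: the velocity of $s\mapsto[\gamma_s]$ corresponds to the component orthogonal to $\gamma'$ of the variation field of $\gamma_s$. Endow $\mathcal G_\kappa$ with the Kähler structure $(g_K,\mathcal J)$, $$g_K(I,J)=\langle I,J\rangle+\kappa\,\langle I',J'\rangle,\qquad \mathcal J(J)=\gamma'\times J,$$ and let $\omega_K=g_K(\mathcal J\,\cdot,\cdot)$. Let $S\subset M_\kappa$ be a compact connected smooth embedded surface that is strictly convex (for each $p\in S$ the complete totally geodesic surface tangent to $S$ at $p$ meets $S$ only at $p$) and quadratically convex (its shape operator is definite at every point). Let $n$ be the inward unit normal field of $S$ and $iu=n(p)\times u$ for $u\in T_pS$. Let $\mathcal M\cong T^1S$ be the hypersurface of oriented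 geodesics $[\gamma_u]$ tangent to $S$ ($u\in T^1S$, $\gamma_u$ the geodesic with initial velocity $u$), and let $\mathcal U$ be the set of oriented geodesics that do not intersect $S$ and, if $\kappa=1$, are not one of the great circles contained in a linear plane $T_pS\subset\mathbb R^4$, $p\in S$. For $u\in T^1S$ and $t\in\mathbb R$ let $u_t$ be the parallel transport of $u$ along $\gamma_{iu}$ from $0$ to $t$, and put $$F(u,t)=[\gamma_{u_t}]\in\mathcal G_\kappa .$$ Then for every $u\in T^1S$ there is exactly one $g_K$-unit vector $N(u)\in T_{[\gamma_u]}\mathcal G_\kappa$ (that is, $g_K(N(u),N(u))=1$) which is $g_K$-orthogonal to $T_{[\gamma_u]}\mathcal M$ and points outwards (towards $\mathcal U$), and $$F(u,t)=\Gamma_{\mathcal J(N(u))}(t)\qquad\text{for all } t\in\mathbb R,$$ where $\Gamma_\xi$ denotes the geodesic of $(\mathcal G_\kappa,g_K)$ with initial velocity $\xi$; that is, $t\mapsto F(u,t)$ is a $g_K$-geodesic with initial velocity $\mathcal J(N(u))$. Moreover $\mathcal J(N(u))$ spans the characteristic line of $\mathcal M$ at $[\gamma_u]$, the kernel of the restriction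 of $\omega_K$ to $T_{[\gamma_u]}\mathcal M$. -/

import Mathlib

open Set Filter Topology
open scoped ContDiff

noncomputable section

namespace GeodesicBilliard

/-! ### The space form `M_κ`, `κ = ±1`, as a quadric in `ℝ⁴` -/

/-- The vector space `ℝ⁴` with coordinates `x 0, x 1, x 2, x 3`. -/
abbrev E4 : Type := Fin 4 → ℝ

/-- The symmetric bilinear form `κ x₀y₀ + x₁y₁ + x₂y₂ + x₃y₃` on `ℝ⁴`. Its restriction to the
tangent spaces of the space form is the Riemannian metric of the space form. -/
def bil (κ : ℝ) (x y : E4) : ℝ := κ * x 0 * y 0 + x 1 * y 1 + x 2 * y 2 + x 3 * y 3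

/-- The space form `M_κ`: the connected component of `e₀` in
`{x | κ x₀² + x₁² + x₂² + x₃² = κ}`, i.e. `S³` for `κ = 1` and the upper sheet of the
hyperboloid (hyperbolic space) for `κ = -1`. -/
def spaceForm (κ : ℝ) : Set E4 := {x | bil κ x x = κ ∧ (κ = -1 → 0 < x 0)}

/-- The cross product `a × b` on the oriented tangent space `T_p M_κ`, determined by
`⟨a × b, c⟩ = det (p, a, b, c)`; thus `e₁ × e₂ = e₃` at `p = e₀`. -/
def cross (κ : ℝ) (p a b : E4) : E4 := fun i =>
  (if i = 0 then κ else 1) * Matrix.det (Matrix.of ![p, a, b, Pi.single i 1])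

/-- `c_κ`: cosine for `κ = 1`, hyperbolic cosine for `κ = -1`. -/
def cK (κ r : ℝ) : ℝ := if κ = 1 then Real.cos r else Real.cosh r

/-- `s_κ`: sine for `κ = 1`, hyperbolic sine for `κ = -1`. -/
def sK (κ r : ℝ) : ℝ := if κ = 1 then Real.sin r else Real.sinh r

/-- The unit tangent bundle `T¹M_κ`: pairs (foot point, unit tangent vector). -/
def unitTangentBundle (κ : ℝ) : Set (E4 × E4) :=
  {q | q.1 ∈ spaceForm κ ∧ bil κ q.1 q.2 = 0 ∧ bil κ q.2 q.2 = 1}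

/-- The unit speed geodesic of `M_κ` with initial point `q.1` and initial velocity `q.2`. -/
def geod (κ : ℝ) (q : E4 × E4) (r : ℝ) : E4 := cK κ r • q.1 + sK κ r • q.2

/-- The velocity of `geod κ q`, see `hasDerivAt_geod`. -/
def geodVel (κ : ℝ) (q : E4 × E4) (r : ℝ) : E4 := (-(κ * sK κ r)) • q.1 + cK κ r • q.2

/-- The covariant derivative in `M_κ` of a vector field `W` along a curve `γ`: the orthogonal
projection of the derivative `W'` in `ℝ⁴` to the tangent space of `M_κ`. Recall that
`⟨γ, γ⟩ = κ` and `1 / κ = κ`. -/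
def covDeriv (κ : ℝ) (γ W : ℝ → E4) (t : ℝ) : E4 :=
  deriv W t - (κ * bil κ (deriv W t) (γ t)) • γ t

/-- Parallel transport of the vector `x` along the geodesic `geod κ q` between `0` and `t`: the
component of `x` along the geodesic goes to the corresponding multiple of its velocity, and the
orthogonal component is constant in `ℝ⁴`. See `covDeriv_parallelTransport`. -/
def parallelTransport (κ : ℝ) (q : E4 × E4) (t : ℝ) (x : E4) : E4 :=
  x + bil κ x q.2 • (geodVel κ q t - q.2)

theorem hasDerivAt_cK {κ : ℝ} (hκ : κ = 1 ∨ κ = -1) (r : ℝ) :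
    HasDerivAt (cK κ) (-(κ * sK κ r)) r := by
  rcases hκ with rfl | rfl
  · have h : cK 1 = Real.cos := by funext x; simp [cK]
    rw [h]; simpa [sK] using Real.hasDerivAt_cos r
  · have h : cK (-1) = Real.cosh := by funext x; simp [cK]; norm_num
    rw [h]
    have h2 : sK (-1) r = Real.sinh r := by simp [sK]; norm_num
    rw [h2]; simpa using Real.hasDerivAt_cosh r

theorem hasDerivAt_sK {κ : ℝ} (hκ : κ = 1 ∨ κ = -1) (r : ℝ) :
    HasDerivAt (sK κ) (cK κ r) r := by
  rcases hκ with rfl | rfl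
  · have h : sK 1 = Real.sin := by funext x; simp [sK]
    rw [h]; simpa [cK] using Real.hasDerivAt_sin r
  · have h : sK (-1) = Real.sinh := by funext x; simp [sK]; norm_num
    rw [h]
    have h2 : cK (-1) r = Real.cosh r := by simp [cK]; norm_num
    rw [h2]; exact Real.hasDerivAt_sinh r

theorem hasDerivAt_geod {κ : ℝ} (hκ : κ = 1 ∨ κ = -1) (q : E4 × E4) (r : ℝ) :
    HasDerivAt (geod κ q) (geodVel κ q r) r :=
  ((hasDerivAt_cK hκ r).smul_const q.1).add ((hasDerivAt_sK hκ r).smul_const q.2)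

theorem hasDerivAt_geodVel {κ : ℝ} (hκ : κ = 1 ∨ κ = -1) (q : E4 × E4) (r : ℝ) :
    HasDerivAt (geodVel κ q) (-κ • geod κ q r) r := by
  have h1 := (((hasDerivAt_sK hκ r).const_mul κ).neg).smul_const q.1
  have h2 := (hasDerivAt_cK hκ r).smul_const q.2
  refine (h1.add h2).congr_deriv ?_
  simp only [geod, smul_add, smul_smul]
  congr 1 <;> congr 1 <;> ring

/-- Along a geodesic, the parallel transport of a vector starts at that vector and has zero
covariant derivative. -/
theorem covDeriv_parallelTransport {κ : ℝ} (hκ : κ = 1 ∨ κ = -1) (q : E4 × E4)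
    (hq : ∀ t, bil κ (geod κ q t) (geod κ q t) = κ) (x : E4) :
    parallelTransport κ q 0 x = x ∧
      ∀ t, covDeriv κ (geod κ q) (fun s => parallelTransport κ q s x) t = 0 := by
  constructor
  · simp [parallelTransport, geodVel, sK, cK]
  · intro t
    have h : HasDerivAt (fun s => parallelTransport κ q s x)
        (bil κ x q.2 • (-κ • geod κ q t)) t := by
      have := (((hasDerivAt_geodVel hκ q t).sub_const q.2).const_smul (bil κ x q.2)).const_add x
      exact this
    have hb : ∀ (a : ℝ) (y z : E4), bil κ (a • y) z = a * bil κ y z := by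
      intro a y z; simp only [bil, Pi.smul_apply, smul_eq_mul]; ring
    have hk : κ * κ = 1 := by rcases hκ with rfl | rfl <;> norm_num
    rw [covDeriv, h.deriv, hb, hb, hq t, smul_smul, ← sub_smul]
    have : bil κ x q.2 * -κ - κ * (bil κ x q.2 * (-κ * κ)) = 0 := by
      linear_combination (bil κ x q.2 * κ) * hk
    rw [this, zero_smul]

/-! ### The space of oriented geodesics -/

/-- Two unit speed geodesics are equivalent if they differ by a translation of the parameter. -/
def geodSetoid (κ : ℝ) : Setoid (unitTangentBundle κ) where
  r q q' := ∃ τ : ℝ, ∀ t, geod κ q' t = geod κ q (t + τ)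
  iseqv :=
    { refl := fun _ => ⟨0, fun t => by rw [add_zero]⟩
      symm := by
        rintro q q' ⟨τ, h⟩
        exact ⟨-τ, fun t => by rw [h, neg_add_cancel_right]⟩
      trans := by
        rintro q q' q'' ⟨τ, h⟩ ⟨τ', h'⟩
        exact ⟨τ' + τ, fun t => by rw [h', h, add_assoc]⟩ }

/-- The space `𝒢_κ` of oriented geodesics of `M_κ`. -/
def OrientedGeodesic (κ : ℝ) : Type := Quotient (geodSetoid κ)

/-- The oriented geodesic `[γ_q]` determined by a unit tangent vector `q`. -/
def toGeodesic {κ : ℝ} (q : unitTangentBundle κ) : OrientedGeodesic κ :=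
  Quotient.mk (geodSetoid κ) q

/-- The Jacobi fields along `γ = geod κ q` orthogonal to `γ'`; they form the tangent space
`T_[γ] 𝒢_κ`. -/
def IsNormalJacobi (κ : ℝ) (q : unitTangentBundle κ) (J : ℝ → E4) : Prop :=
  ContDiff ℝ ∞ J ∧ ∀ r,
    bil κ (geod κ q r) (J r) = 0 ∧ bil κ (geodVel κ q r) (J r) = 0 ∧
      covDeriv κ (geod κ q) (covDeriv κ (geod κ q) J) r + κ • J r = 0

/-- The Jacobi field `d/ds|_{s₀} γ_{φ(s)}` of a variation by unit speed geodesics. -/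
def variationField {κ : ℝ} (φ : ℝ → unitTangentBundle κ) (s₀ r : ℝ) : E4 :=
  deriv (fun s => geod κ (φ s) r) s₀

/-- The component `J^N = J - ⟨J, γ'⟩ γ'` of a vector field along `γ = geod κ q`. -/
def normalPart {κ : ℝ} (q : unitTangentBundle κ) (J : ℝ → E4) (r : ℝ) : E4 :=
  J r - bil κ (J r) (geodVel κ q r) • geodVel κ q r

/-- The curve `c` in `𝒢_κ` is smooth near `t₀`, passes at time `t₀` through `[γ_q]`, and its
velocity there is the element `J` of `T_[γ_q] 𝒢_κ`, a Jacobi field along `γ_q`. -/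
def HasVelocity {κ : ℝ} (c : ℝ → OrientedGeodesic κ) (t₀ : ℝ) (q : unitTangentBundle κ)
    (J : ℝ → E4) : Prop :=
  ∃ φ : ℝ → unitTangentBundle κ,
    (∀ᶠ s in 𝓝 t₀, ContDiffAt ℝ ∞ (fun s' => (φ s' : E4 × E4)) s) ∧
    (∀ᶠ s in 𝓝 t₀, c s = toGeodesic (φ s)) ∧ φ t₀ = q ∧
    J = normalPart q (variationField φ t₀)

/-- The metric `g_K(I, J) = ⟨I, J⟩ + κ ⟨I', J'⟩` on `T_[γ_q] 𝒢_κ` (the right hand side is constant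
along the geodesic). -/
def gK {κ : ℝ} (q : unitTangentBundle κ) (I J : ℝ → E4) : ℝ :=
  bil κ (I 0) (J 0) +
    κ * bil κ (covDeriv κ (geod κ q) I 0) (covDeriv κ (geod κ q) J 0)

/-- The complex structure `𝒥(J) = γ' × J` on `T_[γ_q] 𝒢_κ`. -/
def complexStructure {κ : ℝ} (q : unitTangentBundle κ) (J : ℝ → E4) : ℝ → E4 :=
  fun r => cross κ (geod κ q r) (geodVel κ q r) (J r)

/-- The fundamental form `ω_K(I, J) = g_K(𝒥 I, J)`. -/
def omegaK {κ : ℝ} (q : unitTangentBundle κ) (I J : ℝ → E4) : ℝ :=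
  gK q (complexStructure q I) J

/-! ### Geodesics of the pseudo-Riemannian manifold `(𝒢_κ, g_K)` -/

/-- For a map `φ` into the unit tangent bundle, the derivative at `x` in the direction `h` of
`x ↦ [γ_{φ(x)}]`, as a Jacobi field along `γ_{φ(x)}`. -/
def paramDeriv {κ : ℝ} (φ : (Fin 4 → ℝ) → unitTangentBundle κ) (x h : Fin 4 → ℝ) : ℝ → E4 :=
  normalPart (φ x) (variationField (fun s => φ (x + s • h)) 0)

/-- `x ↦ [γ_{φ(x)}]` is a local parametrization (the inverse of a chart) of the four dimensional
manifold `𝒢_κ` on the open set `Ω`: it is smooth (having a smooth lift `φ` to the unit tangent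
bundle), injective, and has injective differential. -/
def IsLocalParam {κ : ℝ} (Ω : Set (Fin 4 → ℝ)) (φ : (Fin 4 → ℝ) → unitTangentBundle κ) : Prop :=
  IsOpen Ω ∧ ContDiffOn ℝ ∞ (fun x => (φ x : E4 × E4)) Ω ∧
    InjOn (fun x => toGeodesic (φ x)) Ω ∧
    ∀ x ∈ Ω, ∀ h : Fin 4 → ℝ, h ≠ 0 → paramDeriv φ x h ≠ 0

/-- The matrix `(g_ij)` of `g_K` in the coordinates given by `φ`. -/
def metricMatrix {κ : ℝ} (φ : (Fin 4 → ℝ) → unitTangentBundle κ) (x : Fin 4 → ℝ) :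
    Matrix (Fin 4) (Fin 4) ℝ :=
  Matrix.of fun i j =>
    gK (φ x) (paramDeriv φ x (Pi.single i 1)) (paramDeriv φ x (Pi.single j 1))

/-- The partial derivative `∂_m g_ij`. -/
def metricPartial {κ : ℝ} (φ : (Fin 4 → ℝ) → unitTangentBundle κ) (x : Fin 4 → ℝ)
    (m i j : Fin 4) : ℝ :=
  fderiv ℝ (fun y => metricMatrix φ y i j) x (Pi.single m 1)

/-- The Christoffel symbols `Γ^k_ij` of the Levi-Civita connection of `g_K` in the coordinates
given by `φ`. -/
def christoffel {κ : ℝ} (φ : (Fin 4 → ℝ) → unitTangentBundle κ) (x : Fin 4 → ℝ)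
    (k i j : Fin 4) : ℝ :=
  (1 / 2) * ∑ l, (metricMatrix φ x)⁻¹ k l *
    (metricPartial φ x i j l + metricPartial φ x j i l - metricPartial φ x l i j)

/-- The curve `c : ℝ → 𝒢_κ` is a geodesic of `g_K`: around every time it is smooth and satisfies
the geodesic equation in local coordinates. -/
def IsGeodesicGK {κ : ℝ} (c : ℝ → OrientedGeodesic κ) : Prop :=
  ∀ t₀ : ℝ, ∃ (Ω : Set (Fin 4 → ℝ)) (φ : (Fin 4 → ℝ) → unitTangentBundle κ)
    (x : ℝ → Fin 4 → ℝ), IsLocalParam Ω φ ∧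
    ∀ᶠ t in 𝓝 t₀, x t ∈ Ω ∧ ContDiffAt ℝ ∞ x t ∧ c t = toGeodesic (φ (x t)) ∧
      ∀ k, deriv (deriv x) t k +
        ∑ i, ∑ j, christoffel φ (x t) k i j * deriv x t i * deriv x t j = 0

/-! ### Convex surfaces -/

/-- `S` is a compact connected smooth embedded surface of `M_κ`: near each of its points it is the
zero set in `M_κ` of a smooth function with nonzero differential on the tangent space of `M_κ`. -/
def IsCompactSurface (κ : ℝ) (S : Set E4) : Prop :=
  S ⊆ spaceForm κ ∧ IsCompact S ∧ IsConnected S ∧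
    ∀ p ∈ S, ∃ (V : Set E4) (f : E4 → ℝ), IsOpen V ∧ p ∈ V ∧ ContDiffOn ℝ ∞ f V ∧
      (∃ w, bil κ p w = 0 ∧ fderiv ℝ f p w ≠ 0) ∧
      ∀ x ∈ V, x ∈ S ↔ x ∈ spaceForm κ ∧ f x = 0

/-- `σ` is (near `0`) a smooth curve in `S` with `σ(0) = p`. -/
def IsCurveIn (S : Set E4) (p : E4) (σ : ℝ → E4) : Prop :=
  (∀ᶠ s in 𝓝 (0 : ℝ), ContDiffAt ℝ ∞ σ s ∧ σ s ∈ S) ∧ σ 0 = p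

/-- The tangent space `T_pS`: the velocities at `p` of smooth curves in `S`. -/
def tangentPlane (S : Set E4) (p : E4) : Set E4 := {x | ∃ σ, IsCurveIn S p σ ∧ deriv σ 0 = x}

/-- The complete totally geodesic surface of `M_κ` tangent to `S` at `p`: the union of the
geodesics tangent to `S` at `p`. -/
def tangentGeodesicSurface (κ : ℝ) (S : Set E4) (p : E4) : Set E4 :=
  {x | ∃ v ∈ tangentPlane S p, bil κ v v = 1 ∧ ∃ t, x = geod κ (p, v) t}

/-- Strict convexity: each tangent totally geodesic surface meets `S` only at the point of
tangency. -/
def StrictlyConvex (κ : ℝ) (S : Set E4) : Prop :=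
  ∀ p ∈ S, S ∩ tangentGeodesicSurface κ S p = {p}

/-- `ν` is the inward unit normal of the strictly convex surface `S` at `p`: a unit vector of
`T_p M_κ` orthogonal to `T_pS` and pointing to the side of the tangent totally geodesic surface
`{x ∈ M_κ | ⟨ν, x⟩ = 0}` on which `S` lies. -/
def IsInwardNormal (κ : ℝ) (S : Set E4) (p ν : E4) : Prop :=
  bil κ p ν = 0 ∧ bil κ ν ν = 1 ∧ (∀ x ∈ tangentPlane S p, bil κ ν x = 0) ∧
    ∀ x ∈ S, 0 ≤ bil κ ν x

open Classical in
/-- The inward unit normal vector field `n` of `S`. (It exists and is unique for compact connected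
strictly convex surfaces; the value `0` is never used for those.) -/
def inwardNormal (κ : ℝ) (S : Set E4) (p : E4) : E4 :=
  if h : ∃ ν, IsInwardNormal κ S p ν then h.choose else 0

/-- The value `⟨A_p x, x⟩`, `x = σ'(0)`, `p = σ(0)`, of the quadratic form of the shape operator
`A_p x = -∇_x n`, for a curve `σ` in `S`. -/
def shapeForm (κ : ℝ) (S : Set E4) (σ : ℝ → E4) : ℝ :=
  bil κ (-(covDeriv κ σ (fun s => inwardNormal κ S (σ s)) 0)) (deriv σ 0)

/-- Quadratic convexity: the shape operator is definite at every point. -/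
def QuadraticallyConvex (κ : ℝ) (S : Set E4) : Prop :=
  ∀ p ∈ S, (∀ σ, IsCurveIn S p σ → deriv σ 0 ≠ 0 → 0 < shapeForm κ S σ) ∨
    (∀ σ, IsCurveIn S p σ → deriv σ 0 ≠ 0 → shapeForm κ S σ < 0)

/-! ### The outer billiard -/

/-- The unit tangent bundle `T¹S` of the surface. -/
def unitTangentSurface (κ : ℝ) (S : Set E4) : Set (unitTangentBundle κ) :=
  {u | (u : E4 × E4).1 ∈ S ∧ (u : E4 × E4).2 ∈ tangentPlane S (u : E4 × E4).1}

/-- The billiard table `𝒰`: the oriented geodesics not intersecting `S`; for `κ = 1`, those in the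
Gauss image of `S` (great circles contained in some `T_pS ⊆ ℝ⁴`) are also removed. -/
def billiardTable (κ : ℝ) (S : Set E4) : Set (OrientedGeodesic κ) :=
  {ℓ | ∃ q : unitTangentBundle κ, toGeodesic q = ℓ ∧ (∀ t, geod κ q t ∉ S) ∧
    (κ = 1 → ¬ ∃ p ∈ S, ∀ t, geod κ q t ∈ tangentPlane S p)}

/-- The tangent space at `[γ_u]` of the hypersurface `ℳ ≅ T¹S` of geodesics tangent to `S`, as a
set of Jacobi fields along `γ_u`: the velocities of the curves `s ↦ [γ_{w(s)}]` with `w` a smooth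
curve in `T¹S` and `w(0) = u`. -/
def tangentSpaceM {κ : ℝ} (S : Set E4) (u : unitTangentBundle κ) : Set (ℝ → E4) :=
  {K | ∃ w : ℝ → unitTangentBundle κ,
    (∀ᶠ s in 𝓝 (0 : ℝ), ContDiffAt ℝ ∞ (fun s' => (w s' : E4 × E4)) s ∧
      w s ∈ unitTangentSurface κ S) ∧
    w 0 = u ∧ K = normalPart u (variationField w 0)}

/-- `ξ` is the outward unit normal vector at `[γ_u]` of the hypersurface `ℳ` of `(𝒢_κ, g_K)`:
outward means towards the billiard table `𝒰`. -/
def IsOutwardUnitNormal {κ : ℝ} (S : Set E4) (u : unitTangentBundle κ) (ξ : ℝ → E4) : Prop :=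
  IsNormalJacobi κ u ξ ∧ gK u ξ ξ = 1 ∧ (∀ K ∈ tangentSpaceM S u, gK u ξ K = 0) ∧
    ∃ c : ℝ → OrientedGeodesic κ, HasVelocity c 0 u ξ ∧
      ∀ᶠ s in 𝓝[>] (0 : ℝ), c s ∈ billiardTable κ S

/-- The vector `iu = n(p) × u` in `T_pS`, together with its foot point `p`. -/
def rotated {κ : ℝ} (S : Set E4) (u : unitTangentBundle κ) : E4 × E4 :=
  ((u : E4 × E4).1,
    cross κ (u : E4 × E4).1 (inwardNormal κ S (u : E4 × E4).1) (u : E4 × E4).2)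

/-- The vector `u_t`, with its foot point: the parallel transport of `u` along `γ_{iu}` between `0`
and `t`. -/
def transported {κ : ℝ} (S : Set E4) (u : unitTangentBundle κ) (t : ℝ) : E4 × E4 :=
  (geod κ (rotated S u) t, parallelTransport κ (rotated S u) t (u : E4 × E4).2)

open Classical in
/-- The map `F(u, t) = [γ_{u_t}]` defining the outer billiard on `𝒢_κ`. (For `u ∈ T¹S`, `u_t` is
always a unit tangent vector of `M_κ` and the second alternative does not occur.) -/
def billiardF {κ : ℝ} (S : Set E4) (u : unitTangentBundle κ) (t : ℝ) : OrientedGeodesic κ :=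
  if h : transported S u t ∈ unitTangentBundle κ then toGeodesic ⟨transported S u t, h⟩
  else toGeodesic u

end GeodesicBilliard

end
/-!
A normal Jacobi field `J` along `γ_u` is determined by `(J(0), J'(0))`, two vectors of the plane
spanned by `n` and `iu`. A curve in `T¹S` moves the foot point inside `S`, so `⟨J(0), n⟩ = 0` on
`T ℳ`; quadratic convexity makes the `n`-component of `J'(0)` arbitrary, so `T ℳ` is this whole
hyperplane. Its unit normals are therefore `J(0) = ± n`, `J'(0) = 0`, and strict convexity
decides the sign: the geodesic pushed into the body meets `S`, the one pushed out misses it. The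
complex structure turns `J(0) = -n` into `J(0) = iu`, which is the initial velocity of `F(u, ·)`.

In a chart of `𝒢_κ` whose first coordinate is the translation along `γ_{iu}`, a one-parameter
group of isometries of `g_K`, the metric does not depend on that coordinate, and the squared
length of its coordinate field is critical along the axis. Hence `Γᵏ₀₀ = 0` there, and the orbit
`F(u, ·)` is a geodesic.
-/

namespace GeodesicBilliard

/-! ### The form `bil` -/

section Bil

variable {κ : ℝ}

theorem kappa_sq (hκ : κ = 1 ∨ κ = -1) : κ * κ = 1 := by
  rcases hκ with rfl | rfl <;> norm_num

theorem kappa_ne_zero (hκ : κ = 1 ∨ κ = -1) : κ ≠ 0 := by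
  rcases hκ with rfl | rfl <;> norm_num

theorem bil_comm (κ : ℝ) (x y : E4) : bil κ x y = bil κ y x := by
  simp only [bil]; ring

@[simp] theorem bil_add_left (κ : ℝ) (x y z : E4) :
    bil κ (x + y) z = bil κ x z + bil κ y z := by
  simp only [bil, Pi.add_apply]; ring

@[simp] theorem bil_add_right (κ : ℝ) (x y z : E4) :
    bil κ x (y + z) = bil κ x y + bil κ x z := by
  simp only [bil, Pi.add_apply]; ring

@[simp] theorem bil_smul_left (κ a : ℝ) (x y : E4) : bil κ (a • x) y = a * bil κ x y := by
  simp only [bil, Pi.smul_apply, smul_eq_mul]; ring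

@[simp] theorem bil_smul_right (κ a : ℝ) (x y : E4) : bil κ x (a • y) = a * bil κ x y := by
  simp only [bil, Pi.smul_apply, smul_eq_mul]; ring

@[simp] theorem bil_neg_left (κ : ℝ) (x y : E4) : bil κ (-x) y = -bil κ x y := by
  simp only [bil, Pi.neg_apply]; ring

@[simp] theorem bil_neg_right (κ : ℝ) (x y : E4) : bil κ x (-y) = -bil κ x y := by
  simp only [bil, Pi.neg_apply]; ring

@[simp] theorem bil_sub_left (κ : ℝ) (x y z : E4) :
    bil κ (x - y) z = bil κ x z - bil κ y z := by
  simp only [bil, Pi.sub_apply]; ring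

@[simp] theorem bil_sub_right (κ : ℝ) (x y z : E4) :
    bil κ x (y - z) = bil κ x y - bil κ x z := by
  simp only [bil, Pi.sub_apply]; ring

@[simp] theorem bil_zero_left (κ : ℝ) (x : E4) : bil κ 0 x = 0 := by simp [bil]

@[simp] theorem bil_zero_right (κ : ℝ) (x : E4) : bil κ x 0 = 0 := by simp [bil]

theorem hasDerivAt_bil {x y : ℝ → E4} {x' y' : E4} {s : ℝ}
    (hx : HasDerivAt x x' s) (hy : HasDerivAt y y' s) :
    HasDerivAt (fun s => bil κ (x s) (y s)) (bil κ x' (y s) + bil κ (x s) y') s := by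
  have hx := hasDerivAt_pi.1 hx
  have hy := hasDerivAt_pi.1 hy
  refine ((((((hx 0).const_mul κ).mul (hy 0)).add ((hx 1).mul (hy 1))).add
    ((hx 2).mul (hy 2))).add ((hx 3).mul (hy 3))).congr_deriv ?_
  simp only [bil]; ring

theorem contDiff_bil (κ : ℝ) : ContDiff ℝ ∞ fun z : E4 × E4 => bil κ z.1 z.2 := by
  unfold bil
  fun_prop

theorem contDiffAt_bil {F : Type*} [NormedAddCommGroup F] [NormedSpace ℝ F]
    {x y : F → E4} {s : F} (hx : ContDiffAt ℝ ∞ x s) (hy : ContDiffAt ℝ ∞ y s) :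
    ContDiffAt ℝ ∞ (fun s => bil κ (x s) (y s)) s :=
  (contDiff_bil κ).contDiffAt.comp s (hx.prodMk hy)

theorem continuous_bil (κ : ℝ) (x : E4) : Continuous fun y => bil κ x y :=
  (contDiff_bil κ).continuous.comp (Continuous.prodMk_right x)

theorem bil_eq_dotProduct (κ : ℝ) (x y : E4) :
    bil κ x y = x ⬝ᵥ (Matrix.diagonal ![κ, 1, 1, 1]).mulVec y := by
  simp only [bil, dotProduct, Matrix.mulVec_diagonal, Fin.sum_univ_four, Matrix.cons_val]
  ring

theorem sum_mul_sq_le (x y : E4) :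
    (x 1 * y 1 + x 2 * y 2 + x 3 * y 3) ^ 2 ≤
      (x 1 ^ 2 + x 2 ^ 2 + x 3 ^ 2) * (y 1 ^ 2 + y 2 ^ 2 + y 3 ^ 2) := by
  nlinarith [sq_nonneg (x 1 * y 2 - x 2 * y 1), sq_nonneg (x 1 * y 3 - x 3 * y 1),
    sq_nonneg (x 2 * y 3 - x 3 * y 2)]

theorem bil_self_pos (hκ : κ = 1 ∨ κ = -1) {p x : E4} (hp : bil κ p p = κ)
    (hx : bil κ p x = 0) (hx0 : x ≠ 0) : 0 < bil κ x x := by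
  have hsq : 0 < x 0 ^ 2 + (x 1 ^ 2 + x 2 ^ 2 + x 3 ^ 2) := by
    obtain ⟨i, hi⟩ := Function.ne_iff.1 hx0
    have hi' : 0 < x i ^ 2 := sq_pos_of_ne_zero hi
    have hnonneg (j) : 0 ≤ x j ^ 2 := sq_nonneg _
    fin_cases i <;> simp only [Fin.reduceFinMk, Fin.zero_eta, Fin.mk_one] at hi' <;>
      linarith [hnonneg 0, hnonneg 1, hnonneg 2, hnonneg 3]
  simp only [bil] at *
  rcases hκ with rfl | rfl
  · linarith
  · have hcs := sum_mul_sq_le p x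
    rw [show p 1 * x 1 + p 2 * x 2 + p 3 * x 3 = p 0 * x 0 by linarith,
      show p 1 ^ 2 + p 2 ^ 2 + p 3 ^ 2 = p 0 ^ 2 - 1 by linarith] at hcs
    have hp0 : 1 ≤ p 0 ^ 2 := by nlinarith [sq_nonneg (p 1), sq_nonneg (p 2), sq_nonneg (p 3)]
    by_contra hneg
    have hle : (p 0 ^ 2 - 1) * (x 1 ^ 2 + x 2 ^ 2 + x 3 ^ 2) ≤ (p 0 ^ 2 - 1) * x 0 ^ 2 :=
      mul_le_mul_of_nonneg_left (by linarith) (by linarith)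
    nlinarith

theorem bil_self_nonneg (hκ : κ = 1 ∨ κ = -1) {p x : E4} (hp : bil κ p p = κ)
    (hx : bil κ p x = 0) : 0 ≤ bil κ x x := by
  rcases eq_or_ne x 0 with rfl | hx0
  · exact (bil_zero_left κ 0).ge
  · exact (bil_self_pos hκ hp hx hx0).le

theorem exists_orthogonal_ne_zero (κ : ℝ) (p n : E4) :
    ∃ x ≠ 0, bil κ p x = 0 ∧ bil κ n x = 0 := by
  let M : Matrix (Fin 4) (Fin 4) ℝ := Matrix.of ![p, n, 0, 0] * Matrix.diagonal ![κ, 1, 1, 1]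
  have hM : M.det = 0 := by
    rw [Matrix.det_mul, Matrix.det_eq_zero_of_row_eq_zero 3 fun _ => rfl, zero_mul]
  obtain ⟨x, hx0, hx⟩ := Matrix.exists_mulVec_eq_zero_iff.2 hM
  rw [← Matrix.mulVec_mulVec] at hx
  exact ⟨x, hx0, (bil_eq_dotProduct κ p x).trans (congrFun hx 0),
    (bil_eq_dotProduct κ n x).trans (congrFun hx 1)⟩

end Bil

/-! ### Normalization -/

section Normalized

variable {κ : ℝ}

/-- The unit vector positively proportional to a vector `x` with `bil κ x x > 0` (junk if `x` is
not spacelike). -/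
noncomputable def normalized (κ : ℝ) (x : E4) : E4 := (√(bil κ x x))⁻¹ • x

@[simp] theorem bil_normalized_right (κ : ℝ) (y x : E4) :
    bil κ y (normalized κ x) = (√(bil κ x x))⁻¹ * bil κ y x :=
  bil_smul_right ..

theorem bil_normalized_self {x : E4} (hx : 0 < bil κ x x) :
    bil κ (normalized κ x) (normalized κ x) = 1 := by
  rw [bil_normalized_right, normalized, bil_smul_left, ← mul_assoc, ← mul_inv,
    Real.mul_self_sqrt hx.le, inv_mul_cancel₀ hx.ne']

theorem sqrt_smul_normalized {x : E4} (hx : 0 < bil κ x x) :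
    √(bil κ x x) • normalized κ x = x :=
  smul_inv_smul₀ (Real.sqrt_pos.2 hx).ne' x

theorem normalized_eq_self {x : E4} (hx : bil κ x x = 1) : normalized κ x = x := by
  rw [normalized, hx, Real.sqrt_one, inv_one, one_smul]

theorem contDiffAt_normalized {F : Type*} [NormedAddCommGroup F] [NormedSpace ℝ F]
    {x : F → E4} {s : F} (hx : ContDiffAt ℝ ∞ x s) (hpos : 0 < bil κ (x s) (x s)) :
    ContDiffAt ℝ ∞ (fun s => normalized κ (x s)) s :=
  (((contDiffAt_bil hx hx).sqrt hpos.ne').inv (Real.sqrt_pos.2 hpos).ne').smul hx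

theorem hasDerivAt_normalized {x : ℝ → E4} {x' : E4} {s : ℝ} (hx : HasDerivAt x x' s)
    (hunit : bil κ (x s) (x s) = 1) (horth : bil κ (x s) x' = 0) :
    HasDerivAt (fun s => normalized κ (x s)) x' s := by
  have hbil : HasDerivAt (fun s => bil κ (x s) (x s)) 0 s := by
    simpa only [bil_comm κ x', horth, add_zero] using hasDerivAt_bil (κ := κ) hx hx
  have hinv := (hbil.sqrt (by rw [hunit]; exact one_ne_zero)).fun_inv
    (by rw [hunit, Real.sqrt_one]; exact one_ne_zero)
  exact (hinv.fun_smul hx).congr_deriv (by simp [hunit])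

theorem exists_unit_orthogonal (hκ : κ = 1 ∨ κ = -1) {p : E4} (hp : bil κ p p = κ) (n : E4) :
    ∃ v, bil κ p v = 0 ∧ bil κ n v = 0 ∧ bil κ v v = 1 := by
  obtain ⟨x, hx0, hpx, hnx⟩ := exists_orthogonal_ne_zero κ p n
  exact ⟨normalized κ x, by simp [hpx], by simp [hnx],
    bil_normalized_self (bil_self_pos hκ hp hpx hx0)⟩

theorem exists_unit_smul_eq (hκ : κ = 1 ∨ κ = -1) {p n y : E4} (hp : bil κ p p = κ)
    (hpy : bil κ p y = 0) (hny : bil κ n y = 0) :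
    ∃ v, bil κ p v = 0 ∧ bil κ n v = 0 ∧ bil κ v v = 1 ∧ y = √(bil κ y y) • v := by
  rcases eq_or_ne y 0 with rfl | hy0
  · obtain ⟨v, hpv, hnv, hvv⟩ := exists_unit_orthogonal hκ hp n
    exact ⟨v, hpv, hnv, hvv, by simp⟩
  · have hpos := bil_self_pos hκ hp hpy hy0
    exact ⟨normalized κ y, by simp [hpy], by simp [hny], bil_normalized_self hpos,
      (sqrt_smul_normalized hpos).symm⟩

end Normalized

/-! ### The cross product -/

section Cross

variable {κ : ℝ}

theorem cross_eq (κ : ℝ) (p a b : E4) : cross κ p a b =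
    ![-κ * (p 1 * (a 2 * b 3 - a 3 * b 2) - p 2 * (a 1 * b 3 - a 3 * b 1)
        + p 3 * (a 1 * b 2 - a 2 * b 1)),
      p 0 * (a 2 * b 3 - a 3 * b 2) - p 2 * (a 0 * b 3 - a 3 * b 0)
        + p 3 * (a 0 * b 2 - a 2 * b 0),
      -(p 0 * (a 1 * b 3 - a 3 * b 1) - p 1 * (a 0 * b 3 - a 3 * b 0)
        + p 3 * (a 0 * b 1 - a 1 * b 0)),
      p 0 * (a 1 * b 2 - a 2 * b 1) - p 1 * (a 0 * b 2 - a 2 * b 0)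
        + p 2 * (a 0 * b 1 - a 1 * b 0)] := by
  funext i
  fin_cases i <;>
    simp [cross, Matrix.det_succ_row_zero, Fin.sum_univ_succ, Fin.succAbove, Pi.single_apply] <;>
    ring

theorem cross_add_right (κ : ℝ) (p a b c : E4) :
    cross κ p a (b + c) = cross κ p a b + cross κ p a c := by
  simp only [cross_eq]
  funext i
  fin_cases i <;> simp <;> ring

theorem cross_smul_right (κ r : ℝ) (p a b : E4) :
    cross κ p a (r • b) = r • cross κ p a b := by
  simp only [cross_eq]
  funext i
  fin_cases i <;> simp <;> ring

theorem cross_swap (κ : ℝ) (p a b : E4) : cross κ p a b = -cross κ p b a := by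
  simp only [cross_eq]
  funext i
  fin_cases i <;> simp <;> ring

theorem cross_linear_comb (κ c s c' s' : ℝ) (p a b : E4) :
    cross κ (c • p + s • a) (s' • p + c' • a) b = (c * c' - s * s') • cross κ p a b := by
  simp only [cross_eq]
  funext i
  fin_cases i <;> simp <;> ring

theorem bil_cross (hκ : κ = 1 ∨ κ = -1) (p a b c : E4) :
    bil κ c (cross κ p a b) = Matrix.det (Matrix.of ![p, a, b, c]) := by
  rcases hκ with rfl | rfl <;>
    simp [bil, cross_eq, Matrix.det_succ_row_zero, Fin.sum_univ_succ, Fin.succAbove] <;> ring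

theorem bil_cross_self_left (hκ : κ = 1 ∨ κ = -1) (p a b : E4) : bil κ p (cross κ p a b) = 0 := by
  rw [bil_cross hκ]
  exact Matrix.det_zero_of_row_eq (i := 0) (j := 3) (by decide) rfl

theorem bil_cross_self_mid (hκ : κ = 1 ∨ κ = -1) (p a b : E4) : bil κ a (cross κ p a b) = 0 := by
  rw [bil_cross hκ]
  exact Matrix.det_zero_of_row_eq (i := 1) (j := 3) (by decide) rfl

theorem bil_cross_self_right (hκ : κ = 1 ∨ κ = -1) (p a b : E4) :
    bil κ b (cross κ p a b) = 0 := by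
  rw [bil_cross hκ]
  exact Matrix.det_zero_of_row_eq (i := 2) (j := 3) (by decide) rfl

theorem bil_cross_cyclic (hκ : κ = 1 ∨ κ = -1) (p a b c : E4) :
    bil κ c (cross κ p a b) = bil κ a (cross κ p b c) := by
  rcases hκ with rfl | rfl <;> simp [bil, cross_eq] <;> ring

theorem cross_cross (hκ : κ = 1 ∨ κ = -1) (p a b : E4) :
    cross κ p b (cross κ p a b) = κ •
      ((bil κ p p * bil κ b b - bil κ p b ^ 2) • a
        - (bil κ p p * bil κ a b - bil κ p a * bil κ p b) • b
        + (bil κ a b * bil κ p b - bil κ b b * bil κ p a) • p) := by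
  simp only [cross_eq]
  rcases hκ with rfl | rfl <;> funext i <;> fin_cases i <;> simp [bil] <;> ring

theorem cross_cross_of_orthogonal (hκ : κ = 1 ∨ κ = -1) {p a b : E4} (hp : bil κ p p = κ)
    (ha : bil κ p a = 0) (hb : bil κ p b = 0) :
    cross κ p b (cross κ p a b) = bil κ b b • a - bil κ a b • b := by
  rw [cross_cross hκ, hp, ha, hb]
  linear_combination (norm := module) kappa_sq hκ • (bil κ b b • a - bil κ a b • b)

theorem bil_cross_cross (hκ : κ = 1 ∨ κ = -1) {p a b : E4} (hp : bil κ p p = κ)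
    (ha : bil κ p a = 0) (hb : bil κ p b = 0) :
    bil κ (cross κ p a b) (cross κ p a b) = bil κ a a * bil κ b b - bil κ a b ^ 2 := by
  rw [bil_cross_cyclic hκ, cross_cross_of_orthogonal hκ hp ha hb, bil_sub_right, bil_smul_right,
    bil_smul_right]
  ring

end Cross

/-! ### Orthonormal frames -/

/-- `(p, n, v, w)` is an orthogonal basis of `ℝ⁴` for `bil κ` in which `n, v, w` are unit vectors
and `p` lies on the quadric; thus `(n, v, w)` is an orthonormal basis of `T_p M_κ`. -/
structure IsFrame (κ : ℝ) (p n v w : E4) : Prop where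
  pp : bil κ p p = κ
  pn : bil κ p n = 0
  pv : bil κ p v = 0
  pw : bil κ p w = 0
  nn : bil κ n n = 1
  nv : bil κ n v = 0
  nw : bil κ n w = 0
  vv : bil κ v v = 1
  vw : bil κ v w = 0
  ww : bil κ w w = 1

namespace IsFrame

variable {κ : ℝ} {p n v w : E4}

theorem np (h : IsFrame κ p n v w) : bil κ n p = 0 := bil_comm κ n p ▸ h.pn
theorem vp (h : IsFrame κ p n v w) : bil κ v p = 0 := bil_comm κ v p ▸ h.pv
theorem wp (h : IsFrame κ p n v w) : bil κ w p = 0 := bil_comm κ w p ▸ h.pw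
theorem vn (h : IsFrame κ p n v w) : bil κ v n = 0 := bil_comm κ v n ▸ h.nv
theorem wn (h : IsFrame κ p n v w) : bil κ w n = 0 := bil_comm κ w n ▸ h.nw
theorem wv (h : IsFrame κ p n v w) : bil κ w v = 0 := bil_comm κ w v ▸ h.vw

theorem swap (h : IsFrame κ p n v w) : IsFrame κ p v n w :=
  ⟨h.pp, h.pv, h.pn, h.pw, h.vv, h.vn, h.vw, h.nn, h.nw, h.ww⟩

theorem gram (h : IsFrame κ p n v w) :
    Matrix.of ![p, n, v, w] * Matrix.diagonal ![κ, 1, 1, 1] * (Matrix.of ![p, n, v, w]).transpose =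
      Matrix.diagonal ![κ, 1, 1, 1] := by
  ext i j
  have hij : (Matrix.of ![p, n, v, w] * Matrix.diagonal ![κ, 1, 1, 1] *
      (Matrix.of ![p, n, v, w]).transpose) i j = bil κ (![p, n, v, w] i) (![p, n, v, w] j) := by
    rw [bil_eq_dotProduct, Matrix.mul_assoc]
    rfl
  rw [hij]
  fin_cases i <;> fin_cases j <;>
    simp [h.pp, h.pn, h.pv, h.pw, h.nn, h.nv, h.nw, h.vv, h.vw, h.ww,
      h.np, h.vp, h.wp, h.vn, h.wn, h.wv]

theorem eq_zero (h : IsFrame κ p n v w) (hκ : κ = 1 ∨ κ = -1) {x : E4} (hp : bil κ p x = 0)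
    (hn : bil κ n x = 0) (hv : bil κ v x = 0) (hw : bil κ w x = 0) : x = 0 := by
  have hD : (Matrix.diagonal ![κ, 1, 1, 1]).det ≠ 0 := by
    simpa [Fin.prod_univ_succ] using kappa_ne_zero hκ
  have hM : (Matrix.of ![p, n, v, w]).det ≠ 0 := by
    intro hdet
    apply hD
    rw [← h.gram, Matrix.det_mul, Matrix.det_mul, hdet, zero_mul, zero_mul]
  refine Matrix.eq_zero_of_mulVec_eq_zero hD (Matrix.eq_zero_of_mulVec_eq_zero hM ?_)
  funext i
  refine (bil_eq_dotProduct κ (![p, n, v, w] i) x).symm.trans ?_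
  fin_cases i <;> assumption

theorem ext (h : IsFrame κ p n v w) (hκ : κ = 1 ∨ κ = -1) {x y : E4}
    (hp : bil κ p x = bil κ p y) (hn : bil κ n x = bil κ n y) (hv : bil κ v x = bil κ v y)
    (hw : bil κ w x = bil κ w y) : x = y := by
  rw [← sub_eq_zero]
  apply h.eq_zero hκ <;> rw [bil_sub_right, sub_eq_zero] <;> assumption

theorem eq_smul (h : IsFrame κ p n v w) (hκ : κ = 1 ∨ κ = -1) {x : E4} (hp : bil κ p x = 0)
    (hv : bil κ v x = 0) (hw : bil κ w x = 0) : x = bil κ n x • n :=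
  h.ext hκ (by simp [hp, h.pn]) (by simp [h.nn]) (by simp [hv, h.vn]) (by simp [hw, h.wn])

theorem eq_smul_add_smul (h : IsFrame κ p n v w) (hκ : κ = 1 ∨ κ = -1) {x : E4}
    (hp : bil κ p x = 0) (hn : bil κ n x = 0) : x = bil κ v x • v + bil κ w x • w :=
  h.ext hκ (by simp [hp, h.pv, h.pw]) (by simp [hn, h.nv, h.nw]) (by simp [h.vv, h.vw])
    (by simp [h.wv, h.ww])

end IsFrame

section Frames

variable {κ : ℝ} {p n v : E4}

theorem isFrame_cross (hκ : κ = 1 ∨ κ = -1) (pp : bil κ p p = κ) (pn : bil κ p n = 0)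
    (pv : bil κ p v = 0) (nn : bil κ n n = 1) (nv : bil κ n v = 0) (vv : bil κ v v = 1) :
    IsFrame κ p n v (cross κ p n v) where
  pp := pp
  pn := pn
  pv := pv
  pw := bil_cross_self_left hκ p n v
  nn := nn
  nv := nv
  nw := bil_cross_self_mid hκ p n v
  vv := vv
  vw := bil_cross_self_right hκ p n v
  ww := by
    rw [bil_cross_cross hκ pp pn pv, nn, nv, vv]
    norm_num

theorem exists_isFrame (hκ : κ = 1 ∨ κ = -1) (pp : bil κ p p = κ) (pn : bil κ p n = 0)
    (nn : bil κ n n = 1) : ∃ v w, IsFrame κ p n v w := by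
  obtain ⟨v, pv, nv, vv⟩ := exists_unit_orthogonal hκ pp n
  exact ⟨v, cross κ p n v, isFrame_cross hκ pp pn pv nn nv vv⟩

end Frames

/-! ### The space form and its geodesics -/

section SpaceForm

variable {κ : ℝ}

@[simp] theorem cK_one (r : ℝ) : cK 1 r = Real.cos r := if_pos rfl

@[simp] theorem sK_one (r : ℝ) : sK 1 r = Real.sin r := if_pos rfl

@[simp] theorem cK_neg_one (r : ℝ) : cK (-1) r = Real.cosh r := if_neg (by norm_num)

@[simp] theorem sK_neg_one (r : ℝ) : sK (-1) r = Real.sinh r := if_neg (by norm_num)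

@[simp] theorem cK_zero (κ : ℝ) : cK κ 0 = 1 := by simp [cK]

@[simp] theorem sK_zero (κ : ℝ) : sK κ 0 = 0 := by simp [sK]

theorem cK_sq_add (hκ : κ = 1 ∨ κ = -1) (r : ℝ) : cK κ r ^ 2 + κ * sK κ r ^ 2 = 1 := by
  rcases hκ with rfl | rfl
  · rw [cK_one, sK_one]; linarith [Real.sin_sq_add_cos_sq r]
  · rw [cK_neg_one, sK_neg_one]; linarith [Real.cosh_sq r]

theorem contDiff_cK (κ : ℝ) : ContDiff ℝ ∞ (cK κ) := by
  by_cases h : κ = 1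
  · exact (funext fun _ => if_pos h : cK κ = Real.cos) ▸ Real.contDiff_cos
  · exact (funext fun _ => if_neg h : cK κ = Real.cosh) ▸ Real.contDiff_cosh

theorem contDiff_sK (κ : ℝ) : ContDiff ℝ ∞ (sK κ) := by
  by_cases h : κ = 1
  · exact (funext fun _ => if_pos h : sK κ = Real.sin) ▸ Real.contDiff_sin
  · exact (funext fun _ => if_neg h : sK κ = Real.sinh) ▸ Real.contDiff_sinh

theorem exists_cK_sK (hκ : κ = 1 ∨ κ = -1) {α β : ℝ} (h : α ^ 2 + κ * β ^ 2 = 1) (hβ : 0 ≤ β)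
    (hα : κ = -1 → 0 < α) : ∃ t, cK κ t = α ∧ sK κ t = β := by
  rcases hκ with rfl | rfl
  · refine ⟨Real.arccos α, ?_, ?_⟩
    · rw [cK_one, Real.cos_arccos] <;> nlinarith
    · rw [sK_one, Real.sin_arccos, show 1 - α ^ 2 = β ^ 2 by linarith, Real.sqrt_sq hβ]
  · refine ⟨Real.arsinh β, ?_, ?_⟩
    · rw [cK_neg_one, Real.cosh_arsinh, show 1 + β ^ 2 = α ^ 2 by linarith,
        Real.sqrt_sq (hα rfl).le]
    · rw [sK_neg_one, Real.sinh_arsinh]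

@[simp] theorem geod_zero (κ : ℝ) (q : E4 × E4) : geod κ q 0 = q.1 := by simp [geod]

@[simp] theorem geodVel_zero (κ : ℝ) (q : E4 × E4) : geodVel κ q 0 = q.2 := by simp [geodVel]

theorem abs_apply_zero_lt {p v : E4} (hp : p ∈ spaceForm (-1)) (hv : bil (-1) p v = 0)
    (hvv : bil (-1) v v = 1) : |v 0| < p 0 := by
  have hpp := hp.1
  have hcs := sum_mul_sq_le p v
  simp only [bil] at hpp hv hvv
  rw [show p 1 * v 1 + p 2 * v 2 + p 3 * v 3 = p 0 * v 0 by linarith,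
    show p 1 ^ 2 + p 2 ^ 2 + p 3 ^ 2 = p 0 ^ 2 - 1 by linarith,
    show v 1 ^ 2 + v 2 ^ 2 + v 3 ^ 2 = v 0 ^ 2 + 1 by linarith] at hcs
  exact abs_lt_of_sq_lt_sq (by nlinarith) (hp.2 rfl).le

theorem bil_neg_of_mem_spaceForm {p x : E4} (hp : p ∈ spaceForm (-1)) (hx : x ∈ spaceForm (-1)) :
    bil (-1) p x < 0 := by
  have hpp := hp.1
  have hxx := hx.1
  have hp0 := hp.2 rfl
  have hx0 := hx.2 rfl
  have hcs := sum_mul_sq_le p x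
  simp only [bil] at *
  rw [show p 1 ^ 2 + p 2 ^ 2 + p 3 ^ 2 = p 0 ^ 2 - 1 by linarith,
    show x 1 ^ 2 + x 2 ^ 2 + x 3 ^ 2 = x 0 ^ 2 - 1 by linarith] at hcs
  have hp1 : 1 ≤ p 0 ^ 2 := by nlinarith [sq_nonneg (p 1), sq_nonneg (p 2), sq_nonneg (p 3)]
  have hx1 : 1 ≤ x 0 ^ 2 := by nlinarith [sq_nonneg (x 1), sq_nonneg (x 2), sq_nonneg (x 3)]
  have hlt : |p 1 * x 1 + p 2 * x 2 + p 3 * x 3| < p 0 * x 0 :=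
    abs_lt_of_sq_lt_sq (by nlinarith [hp1, hx1]) (by positivity)
  linarith [(abs_lt.1 hlt).2]

theorem geod_mem_spaceForm (hκ : κ = 1 ∨ κ = -1) {p v : E4} (hp : p ∈ spaceForm κ)
    (hv : bil κ p v = 0) (hvv : bil κ v v = 1) (r : ℝ) : geod κ (p, v) r ∈ spaceForm κ := by
  constructor
  · simp only [geod, bil_add_left, bil_add_right, bil_smul_left, bil_smul_right, hp.1, hv, hvv,
      bil_comm κ v p]
    linear_combination κ * cK_sq_add hκ r - sK κ r ^ 2 * kappa_sq hκ
  · rintro rfl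
    have hcosh : |Real.sinh r| < Real.cosh r :=
      abs_lt_of_sq_lt_sq (by linarith [Real.cosh_sq r]) (Real.cosh_pos r).le
    have habs : |Real.sinh r * v 0| < Real.cosh r * p 0 := by
      rw [abs_mul]
      exact mul_lt_mul'' hcosh (abs_apply_zero_lt hp hv hvv) (abs_nonneg _) (abs_nonneg _)
    simp only [geod, cK_neg_one, sK_neg_one, Pi.add_apply, Pi.smul_apply, smul_eq_mul]
    linarith [(abs_lt.1 habs).1]

/-- The orthogonal projection of `ℝ⁴` to the tangent space `T_p M_κ`; recall `1 / κ = κ`. -/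
def tangentProj (κ : ℝ) (p x : E4) : E4 := x - (κ * bil κ p x) • p

theorem bil_tangentProj_self (hκ : κ = 1 ∨ κ = -1) {p : E4} (hp : bil κ p p = κ) (x : E4) :
    bil κ p (tangentProj κ p x) = 0 := by
  rw [tangentProj, bil_sub_right, bil_smul_right, hp]
  linear_combination -bil κ p x * kappa_sq hκ

theorem bil_tangentProj_of_orthogonal {p y : E4} (hy : bil κ y p = 0) (x : E4) :
    bil κ y (tangentProj κ p x) = bil κ y x := by
  rw [tangentProj, bil_sub_right, bil_smul_right, hy, mul_zero, sub_zero]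

theorem smul_add_tangentProj (κ : ℝ) (p x : E4) :
    (κ * bil κ p x) • p + tangentProj κ p x = x :=
  add_sub_cancel _ _

theorem contDiffAt_tangentProj {F : Type*} [NormedAddCommGroup F] [NormedSpace ℝ F]
    {p x : F → E4} {s : F} (hp : ContDiffAt ℝ ∞ p s) (hx : ContDiffAt ℝ ∞ x s) :
    ContDiffAt ℝ ∞ (fun s => tangentProj κ (p s) (x s)) s :=
  hx.sub ((contDiffAt_const.mul (contDiffAt_bil hp hx)).smul hp)

theorem exists_geod_eq (hκ : κ = 1 ∨ κ = -1) {p n x : E4} (hp : p ∈ spaceForm κ)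
    (hx : x ∈ spaceForm κ) (hnp : bil κ n p = 0) (hnx : bil κ n x = 0) :
    ∃ v, bil κ p v = 0 ∧ bil κ n v = 0 ∧ bil κ v v = 1 ∧ ∃ t, x = geod κ (p, v) t := by
  set α := κ * bil κ p x with hα
  set y := tangentProj κ p x
  have hdecomp : α • p + y = x := smul_add_tangentProj κ p x
  have hpy : bil κ p y = 0 := bil_tangentProj_self hκ hp.1 x
  have hny : bil κ n y = 0 := (bil_tangentProj_of_orthogonal hnp x).trans hnx
  have hyy : α ^ 2 + κ * bil κ y y = 1 := by
    have hxx := hx.1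
    rw [← hdecomp] at hxx
    simp only [bil_add_left, bil_add_right, bil_smul_left, bil_smul_right, hp.1, hpy,
      bil_comm κ y p] at hxx
    linear_combination κ * hxx + (1 - α ^ 2) * kappa_sq hκ
  have hα0 : κ = -1 → 0 < α := by
    rintro rfl
    linarith [bil_neg_of_mem_spaceForm hp hx]
  obtain ⟨v, hpv, hnv, hvv, hyv⟩ := exists_unit_smul_eq hκ hp.1 hpy hny
  obtain ⟨t, hct, hst⟩ := exists_cK_sK hκ
    (by rwa [Real.sq_sqrt (bil_self_nonneg hκ hp.1 hpy)]) (Real.sqrt_nonneg (bil κ y y)) hα0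
  exact ⟨v, hpv, hnv, hvv, t, by rw [geod, hct, hst, ← hyv, hdecomp]⟩

end SpaceForm

section Topology

variable {X : Type*} [TopologicalSpace X]

theorem forall_neg_of_forall_ne_zero {A : Set X} (hA : IsPreconnected A) {g : X → ℝ}
    (hg : ContinuousOn g A) (hne : ∀ x ∈ A, g x ≠ 0) {a : X} (ha : a ∈ A) (hga : g a < 0) :
    ∀ x ∈ A, g x < 0 := by
  intro x hx
  by_contra! hgx
  obtain ⟨y, hy, hgy⟩ := hA.intermediate_value ha hx hg ⟨hga.le, hgx⟩
  exact hne y hy hgy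

theorem forall_nonneg_of_forall_nonneg_nhdsWithin {S : Set X} (hS : IsPreconnected S) {g : X → ℝ}
    (hg : Continuous g) {p : X} (hp : p ∈ S) (hgp : g p = 0) (hne : ∀ x ∈ S, g x = 0 → x = p)
    (hnhds : ∀ᶠ x in 𝓝[S \ {p}] p, 0 ≤ g x) : ∀ x ∈ S, 0 ≤ g x := by
  intro x hx
  by_contra! hgx
  obtain ⟨W, hW, hpW, hWg⟩ := mem_nhdsWithin.1 hnhds
  have hcover : S ⊆ {y | g y < 0} ∪ ({y | 0 < g y} ∪ W) := by
    intro y hy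
    rcases lt_trichotomy (g y) 0 with hlt | heq | hgt
    · exact Or.inl hlt
    · exact Or.inr (Or.inr (hne y hy heq ▸ hpW))
    · exact Or.inr (Or.inl hgt)
  obtain ⟨y, hyS, (hyneg : g y < 0), hypos | hyW⟩ := hS _ _ (isOpen_lt hg continuous_const)
    ((isOpen_lt continuous_const hg).union hW) hcover ⟨x, hx, hgx⟩ ⟨p, hp, Or.inr hpW⟩
  · exact lt_asymm hyneg hypos
  · have hyp : y ≠ p := by
      rintro rfl
      exact hyneg.ne hgp
    exact hyneg.not_ge (hWg ⟨hyW, hyS, hyp⟩)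

theorem forall_nonneg_or_forall_nonpos {S : Set X} (hS : IsPreconnected S) {g : X → ℝ}
    (hg : Continuous g) {p : X} (hp : p ∈ S) (hgp : g p = 0) (hne : ∀ x ∈ S, g x = 0 → x = p)
    {A : Set X} (hA : IsPreconnected A) (hAS : A ⊆ S \ {p}) (hAp : A ∈ 𝓝[S \ {p}] p) :
    (∀ x ∈ S, 0 ≤ g x) ∨ ∀ x ∈ S, g x ≤ 0 := by
  have hneA : ∀ x ∈ A, g x ≠ 0 := fun x hx h0 => (hAS hx).2 (hne x (hAS hx).1 h0)
  by_cases hneg : ∃ a ∈ A, g a < 0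
  · obtain ⟨a, ha, hga⟩ := hneg
    have hlt := forall_neg_of_forall_ne_zero hA hg.continuousOn hneA ha hga
    refine Or.inr fun x hx => neg_nonneg.1 ?_
    refine forall_nonneg_of_forall_nonneg_nhdsWithin hS hg.neg hp (by simp [hgp])
      (fun y hy h0 => hne y hy (neg_eq_zero.1 h0)) ?_ x hx
    filter_upwards [hAp] with y hy using neg_nonneg.2 (hlt y hy).le
  · push Not at hneg
    exact Or.inl (forall_nonneg_of_forall_nonneg_nhdsWithin hS hg hp hgp hne
      (mem_of_superset hAp hneg))

end Topology

section NormedSpace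

variable {E : Type*} [NormedAddCommGroup E] [NormedSpace ℝ E]

theorem isPreconnected_ball_diff_singleton (hE : 1 < Module.rank ℝ E) (c : E) {r : ℝ}
    (hr : 0 < r) : IsPreconnected (Metric.ball c r \ {c}) := by
  let e := OpenPartialHomeomorph.univBall c r
  have himage : e '' {0}ᶜ = Metric.ball c r \ {c} := by
    rw [compl_eq_univ_sdiff, ← OpenPartialHomeomorph.univBall_source c r,
      e.injOn.image_sdiff_subset (by simp [e]), e.image_source_eq_target,
      OpenPartialHomeomorph.univBall_target c hr, image_singleton,
      OpenPartialHomeomorph.univBall_apply_zero]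
  rw [← himage]
  exact (isConnected_compl_singleton_of_one_lt_rank hE 0).isPreconnected.image _
    (OpenPartialHomeomorph.continuous_univBall c r).continuousOn

theorem exists_openPartialHomeomorph_of_hasFDerivAt_id [CompleteSpace E] {Φ : E → E} {p : E}
    (hΦ : ∀ᶠ x in 𝓝 p, ContDiffAt ℝ ∞ Φ x)
    (hd : HasFDerivAt Φ (ContinuousLinearMap.id ℝ E) p) {P : E → Prop} (hP : ∀ᶠ x in 𝓝 p, P x) :
    ∃ e : OpenPartialHomeomorph E E, ⇑e = Φ ∧ p ∈ e.source ∧ (∀ x ∈ e.source, P x) ∧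
      ContDiffOn ℝ ∞ e.symm e.target ∧
      HasFDerivAt e.symm (ContinuousLinearMap.id ℝ E) (Φ p) := by
  have hinf : (∞ : WithTop ℕ∞) ≠ 0 := by simp
  have hΦp := hΦ.self_of_nhds
  have hd' : HasFDerivAt Φ ((ContinuousLinearEquiv.refl ℝ E : E ≃L[ℝ] E) : E →L[ℝ] E) p := hd
  let e₀ := hΦp.toOpenPartialHomeomorph Φ hd' hinf
  have hinv : ∀ᶠ x in 𝓝 p, fderiv ℝ Φ x ∈ range ((↑) : (E ≃L[ℝ] E) → E →L[ℝ] E) :=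
    (hΦp.fderiv_right (m := ∞) (by simp)).continuousAt.eventually_mem
      (hd'.fderiv ▸ ContinuousLinearEquiv.nhds _)
  obtain ⟨U, hU, hUo, hpU⟩ := eventually_nhds_iff.1 (hΦ.and (hinv.and hP))
  let e := e₀.restrOpen U hUo
  have heU : ∀ x ∈ e.source, x ∈ U := fun x hx => hx.2
  have hpe : p ∈ e.source := ⟨hΦp.mem_toOpenPartialHomeomorph_source hd' hinf, hpU⟩
  have heΦ : ⇑e = Φ := hΦp.toOpenPartialHomeomorph_coe hd' hinf
  refine ⟨e, heΦ, hpe, fun x hx => (hU x (heU x hx)).2.2, fun y hy => ?_, ?_⟩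
  · obtain ⟨hsmooth, ⟨f', hf'⟩, -⟩ := hU _ (heU _ (e.map_target hy))
    refine (e.contDiffAt_symm (f₀' := f') hy ?_ (heΦ ▸ hsmooth)).contDiffWithinAt
    rw [hf', heΦ]
    exact (hsmooth.differentiableAt hinf).hasFDerivAt
  · have hpt : Φ p ∈ e.target := heΦ ▸ e.map_source hpe
    refine e.hasFDerivAt_symm (f' := ContinuousLinearEquiv.refl ℝ E) hpt ?_
    have hsymm : e.symm (Φ p) = p := heΦ ▸ e.left_inv hpe
    rwa [hsymm, heΦ]

end NormedSpace

/-! ### Local equations of a surface -/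

section LocalEquation

variable {κ : ℝ} {S : Set E4} {ν : E4 → E4} {f : E4 → ℝ} {p : E4}

/-- `bil κ x` as a continuous linear form. -/
noncomputable def bilL (κ : ℝ) (x : E4) : E4 →L[ℝ] ℝ :=
  LinearMap.toContinuousLinearMap
    { toFun := bil κ x, map_add' := bil_add_right κ x, map_smul' := fun a => bil_smul_right κ a x }

@[simp] theorem bilL_apply (κ : ℝ) (x y : E4) : bilL κ x y = bil κ x y := rfl

theorem hasFDerivAt_bil_self (κ : ℝ) (p : E4) :
    HasFDerivAt (fun x => bil κ x x) ((2 : ℝ) • bilL κ p) p := by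
  have hx : ∀ i, HasFDerivAt (fun x : E4 => x i) (ContinuousLinearMap.proj i) p :=
    fun i => (ContinuousLinearMap.proj i : E4 →L[ℝ] ℝ).hasFDerivAt
  refine ((((((hx 0).const_mul κ).mul (hx 0)).add ((hx 1).mul (hx 1))).add
    ((hx 2).mul (hx 2))).add ((hx 3).mul (hx 3))).congr_fderiv ?_
  ext1 w
  simp only [add_apply, smul_apply,
    ContinuousLinearMap.proj_apply, smul_eq_mul, bilL_apply, bil]
  ring

/-- The gradient of `f` with respect to `bil κ`; recall `1 / κ = κ`. -/
noncomputable def bilGradient (κ : ℝ) (f : E4 → ℝ) (x : E4) : E4 :=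
  fun i => (if i = 0 then κ else 1) * fderiv ℝ f x (Pi.single i 1)

theorem bil_bilGradient (hκ : κ = 1 ∨ κ = -1) (f : E4 → ℝ) (x w : E4) :
    bil κ (bilGradient κ f x) w = fderiv ℝ f x w := by
  have hw : fderiv ℝ f x w = ∑ i, w i * fderiv ℝ f x (Pi.single i 1) := by
    conv_lhs => rw [pi_eq_sum_univ' w]
    simp only [map_sum, map_smul, smul_eq_mul]
  rw [hw]
  simp only [bil, bilGradient, Fin.sum_univ_four, Fin.isValue, ↓reduceIte, one_ne_zero,
    Fin.reduceEq]
  linear_combination (w 0 * fderiv ℝ f x (Pi.single 0 1)) * kappa_sq hκ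

theorem contDiffAt_bilGradient (κ : ℝ) {f : E4 → ℝ} {x : E4} (hf : ContDiffAt ℝ ∞ f x) :
    ContDiffAt ℝ ∞ (bilGradient κ f) x :=
  contDiffAt_pi.2 fun _ => contDiffAt_const.mul
    ((hf.fderiv_right (m := ∞) (by simp)).clm_apply contDiffAt_const)

/-- `f` is a smooth local equation of the surface `S` of `M_κ` near `p`, and the field `ν` restricts
to the unit normal field of the level sets of `f` in `M_κ`, on the side on which `f` increases. -/
structure IsLocalEquation (κ : ℝ) (S : Set E4) (ν : E4 → E4) (f : E4 → ℝ) (p : E4) : Prop where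
  mem_iff : ∀ᶠ x in 𝓝 p, x ∈ S ↔ x ∈ spaceForm κ ∧ f x = 0
  smooth : ∀ᶠ x in 𝓝 p, ContDiffAt ℝ ∞ f x
  smooth_normal : ∀ᶠ x in 𝓝 p, ContDiffAt ℝ ∞ ν x
  orthogonal : ∀ᶠ x in 𝓝 p, x ∈ spaceForm κ → bil κ x (ν x) = 0
  unit : ∀ᶠ x in 𝓝 p, x ∈ spaceForm κ → bil κ (ν x) (ν x) = 1
  fderiv_eq : ∀ᶠ x in 𝓝 p, x ∈ spaceForm κ →
    ∃ l > 0, ∀ w, bil κ x w = 0 → fderiv ℝ f x w = l * bil κ (ν x) w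

namespace IsLocalEquation

theorem neg (h : IsLocalEquation κ S ν f p) : IsLocalEquation κ S (-ν) (-f) p where
  mem_iff := by
    filter_upwards [h.mem_iff] with x hx
    rw [hx, Pi.neg_apply, neg_eq_zero]
  smooth := h.smooth.mono fun _ => ContDiffAt.neg
  smooth_normal := h.smooth_normal.mono fun _ => ContDiffAt.neg
  orthogonal := h.orthogonal.mono fun x hx hxM => by simp [hx hxM]
  unit := h.unit.mono fun x hx hxM => by simp [hx hxM]
  fderiv_eq := by
    filter_upwards [h.fderiv_eq] with x hx hxM
    obtain ⟨l, hl, hlw⟩ := hx hxM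
    exact ⟨l, hl, fun w hw => by simp [fderiv_neg, hlw w hw]⟩

theorem eventually (h : IsLocalEquation κ S ν f p) : ∀ᶠ x in 𝓝 p, IsLocalEquation κ S ν f x := by
  filter_upwards [h.mem_iff.eventually_nhds, h.smooth.eventually_nhds,
    h.smooth_normal.eventually_nhds, h.orthogonal.eventually_nhds, h.unit.eventually_nhds,
    h.fderiv_eq.eventually_nhds] with x hmem hf hν horth hunit hdf
  exact ⟨hmem, hf, hν, horth, hunit, hdf⟩

end IsLocalEquation

theorem IsCompactSurface.exists_isLocalEquation (hκ : κ = 1 ∨ κ = -1) (hS : IsCompactSurface κ S)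
    (hp : p ∈ S) : ∃ ν f, IsLocalEquation κ S ν f p := by
  obtain ⟨hSM, -, -, hlocal⟩ := hS
  obtain ⟨V, f, hV, hpV, hf, ⟨w, hpw, hw⟩, hmem⟩ := hlocal p hp
  have hV : ∀ᶠ x in 𝓝 p, x ∈ V ∧ ContDiffAt ℝ ∞ f x := by
    filter_upwards [hV.mem_nhds hpV] with x hx using ⟨hx, hf.contDiffAt (hV.mem_nhds hx)⟩
  let G : E4 → E4 := fun x => tangentProj κ x (bilGradient κ f x)
  have hGsmooth : ∀ x, ContDiffAt ℝ ∞ f x → ContDiffAt ℝ ∞ G x := fun x hx =>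
    contDiffAt_tangentProj contDiffAt_id (contDiffAt_bilGradient κ hx)
  have hGw : ∀ x w, bil κ x w = 0 → bil κ (G x) w = fderiv ℝ f x w := fun x w hxw => by
    rw [bil_comm, bil_tangentProj_of_orthogonal (by rwa [bil_comm]), bil_comm,
      bil_bilGradient hκ]
  have hxG : ∀ x ∈ spaceForm κ, bil κ x (G x) = 0 := fun x hx => bil_tangentProj_self hκ hx.1 _
  have hGp : 0 < bil κ (G p) (G p) := by
    refine bil_self_pos hκ (hSM hp).1 (hxG p (hSM hp)) fun h0 => hw ?_
    rw [← hGw p w hpw, h0, bil_zero_left]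
  have hGpos : ∀ᶠ x in 𝓝 p, 0 < bil κ (G x) (G x) := by
    have hG := hGsmooth p hV.self_of_nhds.2
    exact (contDiffAt_bil hG hG).continuousAt.eventually (lt_mem_nhds hGp)
  refine ⟨fun x => normalized κ (G x), f, hV.mono fun x hx => hmem x hx.1,
    hV.mono fun x hx => hx.2, ?_, ?_, ?_, ?_⟩
  · filter_upwards [hV, hGpos] with x hx hpos using contDiffAt_normalized (hGsmooth x hx.2) hpos
  · exact Eventually.of_forall fun x hx => by simp [hxG x hx]
  · filter_upwards [hGpos] with x hpos _ using bil_normalized_self hpos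
  · filter_upwards [hGpos] with x hpos _
    refine ⟨_, Real.sqrt_pos.2 hpos, fun w hw => ?_⟩
    rw [← bil_smul_left, sqrt_smul_normalized hpos, hGw x w hw]

theorem exists_straightening (hκ : κ = 1 ∨ κ = -1) {n : E4} (hp : bil κ p p = κ)
    (hnp : bil κ n p = 0) (hnn : bil κ n n = 1) {h₁ h₂ : E4 → ℝ}
    (hsmooth : ∀ᶠ x in 𝓝 p, ContDiffAt ℝ ∞ h₁ x ∧ ContDiffAt ℝ ∞ h₂ x)
    (hd₁ : HasFDerivAt h₁ (bilL κ p) p) (hd₂ : HasFDerivAt h₂ (bilL κ n) p)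
    (hp₁ : h₁ p = 0) (hp₂ : h₂ p = 0) {P : E4 → Prop} (hP : ∀ᶠ x in 𝓝 p, P x) :
    ∃ e : OpenPartialHomeomorph E4 E4, p ∈ e.source ∧ e p = 0 ∧
      ContDiffOn ℝ ∞ e.symm e.target ∧ HasFDerivAt e.symm (ContinuousLinearMap.id ℝ E4) 0 ∧
      ∀ x ∈ e.source, P x ∧ bil κ p (e x) = h₁ x ∧ bil κ n (e x) = h₂ x := by
  let Φ : E4 → E4 := fun x =>
    x - p + (κ * (h₁ x - (bil κ p x - κ))) • p + (h₂ x - bil κ n x) • n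
  have hΦp : Φ p = 0 := by simp [Φ, hp₁, hp₂, hp, hnp]
  have hΦ : ∀ᶠ x in 𝓝 p, ContDiffAt ℝ ∞ Φ x := by
    filter_upwards [hsmooth] with x ⟨hx₁, hx₂⟩
    have hlin : ∀ a, ContDiffAt ℝ ∞ (bil κ a) x := fun a => (bilL κ a).contDiff.contDiffAt
    exact ((contDiffAt_id.sub contDiffAt_const).add
      ((contDiffAt_const.mul (hx₁.sub ((hlin p).sub contDiffAt_const))).smul
        contDiffAt_const)).add ((hx₂.sub (hlin n)).smul contDiffAt_const)
  have hd : HasFDerivAt Φ (ContinuousLinearMap.id ℝ E4) p := by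
    have hlin : ∀ a, HasFDerivAt (bil κ a) (bilL κ a) p := fun a => (bilL κ a).hasFDerivAt
    refine ((((hasFDerivAt_id p).sub_const p).add
      (((hd₁.sub ((hlin p).sub_const κ)).const_mul κ).smul_const p)).add
        ((hd₂.sub (hlin n)).smul_const n)).congr_fderiv ?_
    ext1 w
    simp
  obtain ⟨e, he, hpe, heP, hsymm, hd_symm⟩ :=
    exists_openPartialHomeomorph_of_hasFDerivAt_id hΦ hd hP
  refine ⟨e, hpe, he ▸ hΦp, hsymm, hΦp ▸ hd_symm, fun x hx => ⟨heP x hx, ?_, ?_⟩⟩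
  · simp only [he, Φ, bil_add_right, bil_sub_right, bil_smul_right, hp, bil_comm κ p n, hnp]
    linear_combination (h₁ x - bil κ p x + κ) * kappa_sq hκ
  · simp only [he, Φ, bil_add_right, bil_sub_right, bil_smul_right, hnp, hnn]
    ring

namespace IsLocalEquation

theorem fderiv_eq_add (h : IsLocalEquation κ S ν f p) (hκ : κ = 1 ∨ κ = -1)
    (hp : p ∈ spaceForm κ) :
    ∃ l > 0, ∀ w, fderiv ℝ f p w = l * bil κ (ν p) w + κ * fderiv ℝ f p p * bil κ p w := by
  obtain ⟨l, hl, hlw⟩ := h.fderiv_eq.self_of_nhds hp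
  refine ⟨l, hl, fun w => ?_⟩
  have hnp : bil κ (ν p) p = 0 := (bil_comm _ _ _).trans (h.orthogonal.self_of_nhds hp)
  conv_lhs => rw [← smul_add_tangentProj κ p w]
  rw [map_add, map_smul, smul_eq_mul, hlw _ (bil_tangentProj_self hκ hp.1 w),
    bil_tangentProj_of_orthogonal hnp]
  ring

theorem exists_chart (h : IsLocalEquation κ S ν f p) (hκ : κ = 1 ∨ κ = -1)
    (hS : S ⊆ spaceForm κ) (hp : p ∈ S) :
    ∃ e : OpenPartialHomeomorph E4 E4, p ∈ e.source ∧ e p = 0 ∧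
      ContDiffOn ℝ ∞ e.symm e.target ∧ HasFDerivAt e.symm (ContinuousLinearMap.id ℝ E4) 0 ∧
      ∀ x ∈ e.source, x ∈ S ↔ bil κ p (e x) = 0 ∧ bil κ (ν p) (e x) = 0 := by
  have hpM := hS hp
  obtain ⟨l, hl, hdf⟩ := h.fderiv_eq_add hκ hpM
  set c := κ * fderiv ℝ f p p
  let h₁ : E4 → ℝ := fun x => 2⁻¹ * (bil κ x x - κ)
  let h₂ : E4 → ℝ := fun x => l⁻¹ * (f x - c * h₁ x)
  have hsmooth₁ : ∀ x, ContDiffAt ℝ ∞ h₁ x := fun x =>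
    contDiffAt_const.mul ((contDiffAt_bil contDiffAt_id contDiffAt_id).sub contDiffAt_const)
  have hsmooth : ∀ᶠ x in 𝓝 p, ContDiffAt ℝ ∞ h₁ x ∧ ContDiffAt ℝ ∞ h₂ x :=
    h.smooth.mono fun x hx =>
      ⟨hsmooth₁ x, contDiffAt_const.mul (hx.sub (contDiffAt_const.mul (hsmooth₁ x)))⟩
  have hd₁ : HasFDerivAt h₁ (bilL κ p) p := by
    refine (((hasFDerivAt_bil_self κ p).sub_const κ).const_mul 2⁻¹).congr_fderiv ?_
    rw [inv_smul_smul₀ two_ne_zero]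
  have hd₂ : HasFDerivAt h₂ (bilL κ (ν p)) p := by
    have hdf' := (h.smooth.self_of_nhds.differentiableAt (by simp)).hasFDerivAt
    refine ((hdf'.sub (hd₁.const_mul c)).const_mul l⁻¹).congr_fderiv ?_
    ext1 w
    simp [hdf w, hl.ne']
  have hp₁ : h₁ p = 0 := by simp [h₁, hpM.1]
  have hp₂ : h₂ p = 0 := by simp [h₂, hp₁, (h.mem_iff.self_of_nhds.1 hp).2]
  have hsheet : ∀ᶠ x : E4 in 𝓝 p, κ = -1 → 0 < x 0 := by
    rw [eventually_imp_distrib_left]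
    exact fun hm => (continuous_apply 0).continuousAt.eventually (lt_mem_nhds (hpM.2 hm))
  obtain ⟨e, hpe, he0, hsymm, hd_symm, he⟩ := exists_straightening hκ hpM.1
    ((bil_comm _ _ _).trans (h.orthogonal.self_of_nhds hpM)) (h.unit.self_of_nhds hpM)
    hsmooth hd₁ hd₂ hp₁ hp₂ (h.mem_iff.and hsheet)
  refine ⟨e, hpe, he0, hsymm, hd_symm, fun x hx => ?_⟩
  obtain ⟨⟨hmem, hxsheet⟩, hex₁, hex₂⟩ := he x hx
  have hM : x ∈ spaceForm κ ↔ h₁ x = 0 := by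
    simp only [spaceForm, mem_ofPred_eq, h₁, mul_eq_zero, sub_eq_zero, inv_eq_zero,
      OfNat.ofNat_ne_zero, false_or, and_iff_left hxsheet]
  rw [hmem, hM, hex₁, hex₂]
  refine and_congr_right fun h0 => ?_
  simp [h₂, h0, hl.ne']

end IsLocalEquation

end LocalEquation

/-! ### Tangent planes and inward normals -/

theorem IsCurveIn.hasDerivAt {S : Set E4} {p : E4} {σ : ℝ → E4} (hσ : IsCurveIn S p σ) :
    HasDerivAt σ (deriv σ 0) 0 :=
  (hσ.1.self_of_nhds.1.differentiableAt (by simp)).hasDerivAt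

theorem IsCurveIn.tendsto {S : Set E4} {p : E4} {σ : ℝ → E4} (hσ : IsCurveIn S p σ) :
    Tendsto σ (𝓝 0) (𝓝 p) :=
  hσ.2 ▸ hσ.hasDerivAt.continuousAt.tendsto

section TangentPlane

variable {κ : ℝ} {S : Set E4} {ν : E4 → E4} {f : E4 → ℝ} {p : E4}

theorem bil_deriv_eq_zero {σ : ℝ → E4} {w : E4} {s : ℝ} (hσ : ∀ᶠ t in 𝓝 s, σ t ∈ spaceForm κ)
    (hd : HasDerivAt σ w s) : bil κ (σ s) w = 0 := by
  have hconst : HasDerivAt (fun t => bil κ (σ t) (σ t)) 0 s :=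
    (hasDerivAt_const s κ).congr_of_eventuallyEq (hσ.mono fun t ht => ht.1)
  have hzero := (hasDerivAt_bil (κ := κ) hd hd).unique hconst
  rw [bil_comm κ w] at hzero
  linarith

namespace IsLocalEquation

theorem exists_curve (h : IsLocalEquation κ S ν f p) (hκ : κ = 1 ∨ κ = -1)
    (hS : S ⊆ spaceForm κ) (hp : p ∈ S) {w : E4} (hpw : bil κ p w = 0)
    (hνw : bil κ (ν p) w = 0) : ∃ σ, IsCurveIn S p σ ∧ HasDerivAt σ w 0 := by
  obtain ⟨e, hpe, hep, hsymm, hd, he⟩ := h.exists_chart hκ hS hp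
  have hline : HasDerivAt (fun s : ℝ => s • w) w 0 := by
    simpa using (hasDerivAt_id (0 : ℝ)).smul_const w
  have htarget : ∀ᶠ s : ℝ in 𝓝 0, s • w ∈ e.target := by
    refine hline.continuousAt.eventually_mem ?_
    rw [zero_smul, ← hep]
    exact e.open_target.mem_nhds (e.map_source hpe)
  refine ⟨fun s => e.symm (s • w), ⟨?_, ?_⟩, ?_⟩
  · filter_upwards [htarget] with s hs
    refine ⟨(hsymm.contDiffAt (e.open_target.mem_nhds hs)).comp s (by fun_prop), ?_⟩
    rw [he _ (e.map_target hs), e.right_inv hs, bil_smul_right, bil_smul_right, hpw, hνw, mul_zero]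
    exact ⟨rfl, rfl⟩
  · simp only [zero_smul, ← hep, e.left_inv hpe]
  · exact HasFDerivAt.comp_hasDerivAt (f' := w) (0 : ℝ) (by rwa [zero_smul]) hline

theorem mem_tangentPlane_iff (h : IsLocalEquation κ S ν f p) (hκ : κ = 1 ∨ κ = -1)
    (hS : S ⊆ spaceForm κ) (hp : p ∈ S) {w : E4} :
    w ∈ tangentPlane S p ↔ bil κ p w = 0 ∧ bil κ (ν p) w = 0 := by
  constructor
  · rintro ⟨σ, hσ, rfl⟩
    have hpσ : bil κ p (deriv σ 0) = 0 :=
      hσ.2 ▸ bil_deriv_eq_zero (hσ.1.mono fun s hs => hS hs.2) hσ.hasDerivAt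
    obtain ⟨l, hl, hdf⟩ := h.fderiv_eq.self_of_nhds (hS hp)
    have hfσ : HasDerivAt (f ∘ σ) (fderiv ℝ f p (deriv σ 0)) 0 := by
      refine HasFDerivAt.comp_hasDerivAt (0 : ℝ) ?_ hσ.hasDerivAt
      rw [hσ.2]
      exact (h.smooth.self_of_nhds.differentiableAt (by simp)).hasFDerivAt
    have hconst : HasDerivAt (f ∘ σ) 0 0 := by
      refine (hasDerivAt_const (0 : ℝ) (0 : ℝ)).congr_of_eventuallyEq ?_
      filter_upwards [hσ.1, hσ.tendsto.eventually h.mem_iff] with s hs hmem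
        using (hmem.1 hs.2).2
    have hzero := hfσ.unique hconst
    rw [hdf _ hpσ] at hzero
    exact ⟨hpσ, (mul_eq_zero.1 hzero).resolve_left hl.ne'⟩
  · rintro ⟨hpw, hνw⟩
    obtain ⟨σ, hσ, hd⟩ := h.exists_curve hκ hS hp hpw hνw
    exact ⟨σ, hσ, hd.deriv⟩

theorem exists_mem_ne (h : IsLocalEquation κ S ν f p) (hκ : κ = 1 ∨ κ = -1)
    (hS : S ⊆ spaceForm κ) (hp : p ∈ S) : ∃ x ∈ S, x ≠ p := by
  obtain ⟨v, hpv, hνv, hvv⟩ := exists_unit_orthogonal hκ (hS hp).1 (ν p)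
  obtain ⟨σ, hσ, hd⟩ := h.exists_curve hκ hS hp hpv hνv
  have hv : v ≠ 0 := by
    rintro rfl
    simp at hvv
  obtain ⟨s, hsp, hsS⟩ := ((hd.eventually_ne (c := p) hv).and
    (hσ.1.filter_mono nhdsWithin_le_nhds)).exists
  exact ⟨σ s, hsS.2, hsp⟩

theorem exists_param (h : IsLocalEquation κ S ν f p) (hκ : κ = 1 ∨ κ = -1)
    (hS : S ⊆ spaceForm κ) (hp : p ∈ S) :
    ∃ (ψ : ℝ × ℝ → E4) (r : ℝ), 0 < r ∧ ψ 0 = p ∧ ContinuousOn ψ (Metric.ball 0 r) ∧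
      InjOn ψ (Metric.ball 0 r) ∧ MapsTo ψ (Metric.ball 0 r) S ∧
      ψ '' Metric.ball 0 r ∈ 𝓝[S] p := by
  obtain ⟨e, hpe, hep, -, -, he⟩ := h.exists_chart hκ hS hp
  obtain ⟨v, w, F⟩ := exists_isFrame hκ (hS hp).1 (h.orthogonal.self_of_nhds (hS hp))
    (h.unit.self_of_nhds (hS hp))
  let L : ℝ × ℝ → E4 := fun a => a.1 • v + a.2 • w
  have hL0 : L 0 = 0 := by simp [L]
  have hLc : Continuous L := by fun_prop
  have hL : Function.Injective L := by
    refine Function.LeftInverse.injective (g := fun x => (bil κ v x, bil κ w x)) fun a => ?_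
    simp [L, F.vv, F.vw, F.wv, F.ww]
  have hLtarget : ∀ᶠ a in 𝓝 0, L a ∈ e.target := by
    refine hLc.continuousAt.eventually_mem ?_
    rw [hL0, ← hep]
    exact e.open_target.mem_nhds (e.map_source hpe)
  obtain ⟨r, hr, hball⟩ := Metric.eventually_nhds_iff_ball.1 hLtarget
  refine ⟨e.symm ∘ L, r, hr, ?_, e.continuousOn_symm.comp hLc.continuousOn hball,
    e.symm.injOn.comp hL.injOn hball, fun a ha => ?_, ?_⟩
  · rw [Function.comp_apply, hL0, ← hep, e.left_inv hpe]
  · rw [Function.comp_apply, he _ (e.map_target (hball a ha)), e.right_inv (hball a ha)]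
    simp [L, F.pv, F.pw, F.nv, F.nw]
  · let b : E4 → ℝ × ℝ := fun x => (bil κ v (e x), bil κ w (e x))
    have hb : ContinuousAt b p :=
      ((continuous_bil κ v).continuousAt.comp (e.continuousAt hpe)).prodMk
        ((continuous_bil κ w).continuousAt.comp (e.continuousAt hpe))
    have hbp : b p = 0 := by simp [b, hep]
    have hbr : ∀ᶠ x in 𝓝 p, b x ∈ Metric.ball 0 r :=
      hb.eventually_mem (by rw [hbp]; exact Metric.ball_mem_nhds 0 hr)
    filter_upwards [mem_nhdsWithin_of_mem_nhds (e.open_source.mem_nhds hpe),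
      mem_nhdsWithin_of_mem_nhds hbr, self_mem_nhdsWithin] with x hx hxr hxS
    obtain ⟨hpx, hνx⟩ := (he x hx).1 hxS
    refine ⟨b x, hxr, ?_⟩
    rw [Function.comp_apply, show L (b x) = e x from (F.eq_smul_add_smul hκ hpx hνx).symm,
      e.left_inv hx]

theorem exists_isPreconnected_mem_nhdsWithin (h : IsLocalEquation κ S ν f p)
    (hκ : κ = 1 ∨ κ = -1) (hS : S ⊆ spaceForm κ) (hp : p ∈ S) :
    ∃ A ⊆ S \ {p}, IsPreconnected A ∧ A ∈ 𝓝[S \ {p}] p := by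
  obtain ⟨ψ, r, hr, rfl, hψ, hinj, hψS, hnhds⟩ := h.exists_param hκ hS hp
  have himage : ψ '' (Metric.ball 0 r \ {0}) = ψ '' Metric.ball 0 r \ {ψ 0} := by
    rw [hinj.image_sdiff_subset (by simpa using hr), image_singleton]
  refine ⟨_, himage ▸ sdiff_subset_sdiff_left hψS.image_subset,
    (isPreconnected_ball_diff_singleton ?_ 0 hr).image ψ (hψ.mono sdiff_subset), ?_⟩
  · simp [one_add_one_eq_two]
  · rw [himage, sdiff_eq, sdiff_eq]
    exact inter_mem (nhdsWithin_mono _ inter_subset_left hnhds)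
      (mem_of_superset self_mem_nhdsWithin inter_subset_right)

end IsLocalEquation

end TangentPlane

section InwardNormal

variable {κ : ℝ} {S : Set E4} {ν : E4 → E4} {f : E4 → ℝ} {p : E4}

theorem StrictlyConvex.eq_of_bil_eq_zero (hconv : StrictlyConvex κ S) (hκ : κ = 1 ∨ κ = -1)
    (hS : S ⊆ spaceForm κ) (hp : p ∈ S) {n : E4} (hnp : bil κ n p = 0)
    (hplane : ∀ w, bil κ p w = 0 → bil κ n w = 0 → w ∈ tangentPlane S p) {x : E4} (hx : x ∈ S)
    (hnx : bil κ n x = 0) : x = p := by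
  obtain ⟨v, hpv, hnv, hvv, hxv⟩ := exists_geod_eq hκ (hS hp) (hS hx) hnp hnx
  exact (hconv p hp).subset ⟨hx, v, hplane v hpv hnv, hvv, hxv⟩

namespace IsLocalEquation

theorem eq_of_bil_eq_zero (h : IsLocalEquation κ S ν f p) (hκ : κ = 1 ∨ κ = -1)
    (hS : S ⊆ spaceForm κ) (hconv : StrictlyConvex κ S) (hp : p ∈ S) {x : E4} (hx : x ∈ S)
    (hνx : bil κ (ν p) x = 0) : x = p :=
  hconv.eq_of_bil_eq_zero hκ hS hp ((bil_comm _ _ _).trans (h.orthogonal.self_of_nhds (hS hp)))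
    (fun _ hpw hνw => (h.mem_tangentPlane_iff hκ hS hp).2 ⟨hpw, hνw⟩) hx hνx

theorem forall_bil_nonneg_or_forall_bil_nonpos (h : IsLocalEquation κ S ν f p)
    (hκ : κ = 1 ∨ κ = -1) (hS : IsCompactSurface κ S) (hconv : StrictlyConvex κ S) (hp : p ∈ S) :
    (∀ x ∈ S, 0 ≤ bil κ (ν p) x) ∨ ∀ x ∈ S, bil κ (ν p) x ≤ 0 := by
  obtain ⟨A, hAS, hA, hAp⟩ := h.exists_isPreconnected_mem_nhdsWithin hκ hS.1 hp
  exact forall_nonneg_or_forall_nonpos hS.2.2.1.isPreconnected (continuous_bil κ (ν p)) hp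
    ((bil_comm _ _ _).trans (h.orthogonal.self_of_nhds (hS.1 hp)))
    (fun x hx => h.eq_of_bil_eq_zero hκ hS.1 hconv hp hx) hA hAS hAp

theorem isInwardNormal (h : IsLocalEquation κ S ν f p) (hκ : κ = 1 ∨ κ = -1)
    (hS : S ⊆ spaceForm κ) (hp : p ∈ S) (hnonneg : ∀ x ∈ S, 0 ≤ bil κ (ν p) x) :
    IsInwardNormal κ S p (ν p) :=
  ⟨h.orthogonal.self_of_nhds (hS hp), h.unit.self_of_nhds (hS hp),
    fun _ hx => ((h.mem_tangentPlane_iff hκ hS hp).1 hx).2, hnonneg⟩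

theorem eq_of_isInwardNormal (h : IsLocalEquation κ S ν f p) (hκ : κ = 1 ∨ κ = -1)
    (hS : S ⊆ spaceForm κ) (hconv : StrictlyConvex κ S) (hp : p ∈ S) {m : E4}
    (hν : IsInwardNormal κ S p (ν p)) (hm : IsInwardNormal κ S p m) : m = ν p := by
  obtain ⟨hpm, hmm, hmT, hmS⟩ := hm
  obtain ⟨v, w, F⟩ := exists_isFrame hκ (hS hp).1 hν.1 hν.2.1
  have hT : ∀ {x}, bil κ p x = 0 → bil κ (ν p) x = 0 → bil κ x m = 0 := fun hpx hνx => by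
    rw [bil_comm]
    exact hmT _ ((h.mem_tangentPlane_iff hκ hS hp).2 ⟨hpx, hνx⟩)
  have hsmul : m = bil κ (ν p) m • ν p := F.eq_smul hκ hpm (hT F.pv F.nv) (hT F.pw F.nw)
  set a := bil κ (ν p) m
  have ha : a * a = 1 := by
    rw [hsmul, bil_smul_left, bil_smul_right, hν.2.1, mul_one] at hmm
    exact hmm
  rcases mul_self_eq_one_iff.1 ha with ha | ha
  · rw [hsmul, ha, one_smul]
  · obtain ⟨x, hx, hxp⟩ := h.exists_mem_ne hκ hS hp
    refine absurd (h.eq_of_bil_eq_zero hκ hS hconv hp hx (le_antisymm ?_ (hν.2.2.2 x hx))) hxp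
    have := hmS x hx
    rw [hsmul, ha, bil_smul_left] at this
    linarith

theorem inwardNormal_eq (h : IsLocalEquation κ S ν f p) (hκ : κ = 1 ∨ κ = -1)
    (hS : S ⊆ spaceForm κ) (hconv : StrictlyConvex κ S) (hp : p ∈ S)
    (hν : IsInwardNormal κ S p (ν p)) : inwardNormal κ S p = ν p := by
  have hex : ∃ m, IsInwardNormal κ S p m := ⟨_, hν⟩
  rw [inwardNormal, dif_pos hex]
  exact h.eq_of_isInwardNormal hκ hS hconv hp hν hex.choose_spec

/- The sign of `⟨ν x, y⟩` at the single point `y` of `S` decides on which side of the tangent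
totally geodesic surface at `x` the whole of `S` lies. -/
theorem eventually_isInwardNormal (h : IsLocalEquation κ S ν f p) (hκ : κ = 1 ∨ κ = -1)
    (hS : IsCompactSurface κ S) (hconv : StrictlyConvex κ S) {y : E4} (hy : y ∈ S)
    (hνy : 0 < bil κ (ν p) y) : ∀ᶠ x in 𝓝 p, x ∈ S → IsInwardNormal κ S x (ν x) := by
  have hpos : ∀ᶠ x in 𝓝 p, 0 < bil κ (ν x) y :=
    (contDiffAt_bil h.smooth_normal.self_of_nhds contDiffAt_const).continuousAt.eventually
      (lt_mem_nhds hνy)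
  filter_upwards [h.eventually, hpos] with x hx hxy hxS
  refine hx.isInwardNormal hκ hS.1 hxS ?_
  exact (hx.forall_bil_nonneg_or_forall_bil_nonpos hκ hS hconv hxS).resolve_right
    fun hneg => (hneg y hy).not_gt hxy

end IsLocalEquation

theorem IsCompactSurface.exists_isLocalEquation_inwardNormal (hS : IsCompactSurface κ S)
    (hκ : κ = 1 ∨ κ = -1) (hconv : StrictlyConvex κ S) (hp : p ∈ S) :
    ∃ ν f, IsLocalEquation κ S ν f p ∧ ∀ᶠ x in 𝓝 p, x ∈ S →
      inwardNormal κ S x = ν x ∧ IsInwardNormal κ S x (ν x) := by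
  obtain ⟨ν, f, h, y, hy, hνy⟩ :
      ∃ ν f, IsLocalEquation κ S ν f p ∧ ∃ y ∈ S, 0 < bil κ (ν p) y := by
    obtain ⟨ν, f, h⟩ := hS.exists_isLocalEquation hκ hp
    obtain ⟨y, hy, hyp⟩ := h.exists_mem_ne hκ hS.1 hp
    have hνy : bil κ (ν p) y ≠ 0 := fun h0 => hyp (h.eq_of_bil_eq_zero hκ hS.1 hconv hp hy h0)
    rcases hνy.lt_or_gt with hneg | hpos
    · exact ⟨_, _, h.neg, y, hy, by simpa using hneg⟩
    · exact ⟨ν, f, h, y, hy, hpos⟩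
  refine ⟨ν, f, h, ?_⟩
  filter_upwards [h.eventually, h.eventually_isInwardNormal hκ hS hconv hy hνy] with x hx hin hxS
  exact ⟨hx.inwardNormal_eq hκ hS.1 hconv hxS (hin hxS), hin hxS⟩

theorem isInwardNormal_inwardNormal (hκ : κ = 1 ∨ κ = -1) (hS : IsCompactSurface κ S)
    (hconv : StrictlyConvex κ S) (hp : p ∈ S) : IsInwardNormal κ S p (inwardNormal κ S p) := by
  obtain ⟨ν, f, -, hν⟩ := hS.exists_isLocalEquation_inwardNormal hκ hconv hp
  obtain ⟨heq, hin⟩ := hν.self_of_nhds hp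
  rwa [heq]

theorem mem_tangentPlane_iff (hκ : κ = 1 ∨ κ = -1) (hS : IsCompactSurface κ S)
    (hconv : StrictlyConvex κ S) (hp : p ∈ S) {w : E4} :
    w ∈ tangentPlane S p ↔ bil κ p w = 0 ∧ bil κ (inwardNormal κ S p) w = 0 := by
  obtain ⟨ν, f, h, hν⟩ := hS.exists_isLocalEquation_inwardNormal hκ hconv hp
  rw [(hν.self_of_nhds hp).1]
  exact h.mem_tangentPlane_iff hκ hS.1 hp

theorem continuousOn_inwardNormal (hκ : κ = 1 ∨ κ = -1) (hS : IsCompactSurface κ S)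
    (hconv : StrictlyConvex κ S) : ContinuousOn (inwardNormal κ S) S := by
  intro p hp
  obtain ⟨ν, f, h, hν⟩ := hS.exists_isLocalEquation_inwardNormal hκ hconv hp
  refine h.smooth_normal.self_of_nhds.continuousAt.continuousWithinAt.congr_of_eventuallyEq ?_
    (hν.self_of_nhds hp).1
  filter_upwards [mem_nhdsWithin_of_mem_nhds hν, self_mem_nhdsWithin] with x hx hxS
    using (hx hxS).1

theorem bil_inwardNormal_pos (hκ : κ = 1 ∨ κ = -1) (hS : IsCompactSurface κ S)
    (hconv : StrictlyConvex κ S) (hp : p ∈ S) {x : E4} (hx : x ∈ S) (hxp : x ≠ p) :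
    0 < bil κ (inwardNormal κ S p) x := by
  have hin := isInwardNormal_inwardNormal hκ hS hconv hp
  refine (hin.2.2.2 x hx).lt_of_ne' fun h0 => hxp ?_
  exact hconv.eq_of_bil_eq_zero hκ hS.1 hp ((bil_comm _ _ _).trans hin.1)
    (fun w hpw hnw => (mem_tangentPlane_iff hκ hS hconv hp).2 ⟨hpw, hnw⟩) hx h0

end InwardNormal

/-! ### Normal Jacobi fields -/

/-- The solution of `J'' = -κ J` in `ℝ⁴` with `J 0 = A` and `J' 0 = B`. It is a Jacobi field along
`geod κ q` when `A` and `B` are the components of a tangent vector at `q` to the tangent bundle. -/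
noncomputable def jacobi (κ : ℝ) (A B : E4) : ℝ → E4 := geod κ (A, B)

/-- The tangent vectors at the foot point of `q` orthogonal to the direction of `q`: the space in
which a normal Jacobi field along `geod κ q` and its derivative take their initial values. -/
def normalSpace (κ : ℝ) (q : E4 × E4) : Set E4 := {x | bil κ q.1 x = 0 ∧ bil κ q.2 x = 0}

section Jacobi

variable {κ : ℝ} {A B A' B' : E4}

@[simp]
theorem jacobi_zero (κ : ℝ) (A B : E4) : jacobi κ A B 0 = A := geod_zero κ (A, B)

theorem hasDerivAt_jacobi (hκ : κ = 1 ∨ κ = -1) (A B : E4) (r : ℝ) :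
    HasDerivAt (jacobi κ A B) (jacobi κ B (-κ • A) r) r :=
  (hasDerivAt_geod hκ (A, B) r).congr_deriv (by simp only [jacobi, geod, geodVel]; module)

theorem contDiff_jacobi (κ : ℝ) (A B : E4) : ContDiff ℝ ∞ (jacobi κ A B) :=
  ((contDiff_cK κ).smul contDiff_const).add ((contDiff_sK κ).smul contDiff_const)

theorem jacobi_inj (hκ : κ = 1 ∨ κ = -1) : jacobi κ A B = jacobi κ A' B' ↔ A = A' ∧ B = B' := by
  refine ⟨fun h => ⟨by simpa using congr_fun h 0, ?_⟩, fun ⟨hA, hB⟩ => hA ▸ hB ▸ rfl⟩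
  have hd := hasDerivAt_jacobi hκ A B 0
  rw [h] at hd
  simpa using hd.unique (hasDerivAt_jacobi hκ A' B' 0)

theorem eq_jacobi_of_hasDerivAt (hκ : κ = 1 ∨ κ = -1) {J J' : ℝ → E4}
    (hJ : ∀ r, HasDerivAt J (J' r) r) (hJ' : ∀ r, HasDerivAt J' (-κ • J r) r) :
    J = jacobi κ (J 0) (J' 0) := by
  have hA : ∀ r, HasDerivAt (fun r => cK κ r • J r - sK κ r • J' r) 0 r := fun r =>
    (((hasDerivAt_cK hκ r).fun_smul (hJ r)).fun_sub
      ((hasDerivAt_sK hκ r).fun_smul (hJ' r))).congr_deriv (by module)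
  have hB : ∀ r, HasDerivAt (fun r => (κ * sK κ r) • J r + cK κ r • J' r) 0 r := fun r =>
    ((((hasDerivAt_sK hκ r).const_mul κ).fun_smul (hJ r)).fun_add
      ((hasDerivAt_cK hκ r).fun_smul (hJ' r))).congr_deriv (by module)
  funext r
  have hA0 := is_const_of_deriv_eq_zero (fun r => (hA r).differentiableAt)
    (fun r => (hA r).deriv) r 0
  have hB0 := is_const_of_deriv_eq_zero (fun r => (hB r).differentiableAt)
    (fun r => (hB r).deriv) r 0
  simp only [cK_zero, sK_zero, mul_zero, one_smul, zero_smul, sub_zero, zero_add] at hA0 hB0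
  rw [jacobi, geod, ← hA0, ← hB0]
  linear_combination (norm := module) -cK_sq_add hκ r • J r

end Jacobi

section NormalJacobi

variable {κ : ℝ} {u : unitTangentBundle κ} {A B A' B' : E4} {J : ℝ → E4}

theorem bil_geod_jacobi (hA : A ∈ normalSpace κ u) (hB : B ∈ normalSpace κ u) (r : ℝ) :
    bil κ (geod κ u r) (jacobi κ A B r) = 0 := by
  simp [geod, jacobi, hA.1, hA.2, hB.1, hB.2]

theorem bil_geodVel_jacobi (hA : A ∈ normalSpace κ u) (hB : B ∈ normalSpace κ u) (r : ℝ) :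
    bil κ (geodVel κ u r) (jacobi κ A B r) = 0 := by
  simp [geod, geodVel, jacobi, hA.1, hA.2, hB.1, hB.2]

theorem smul_mem_normalSpace {q : E4 × E4} (c : ℝ) (hA : A ∈ normalSpace κ q) :
    c • A ∈ normalSpace κ q := by
  simp [normalSpace, hA.1, hA.2]

theorem covDeriv_jacobi (hκ : κ = 1 ∨ κ = -1) (hA : A ∈ normalSpace κ u)
    (hB : B ∈ normalSpace κ u) : covDeriv κ (geod κ u) (jacobi κ A B) = jacobi κ B (-κ • A) := by
  funext r
  rw [covDeriv, (hasDerivAt_jacobi hκ A B r).deriv, bil_comm,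
    bil_geod_jacobi hB (smul_mem_normalSpace _ hA), mul_zero, zero_smul, sub_zero]

theorem isNormalJacobi_jacobi (hκ : κ = 1 ∨ κ = -1) (hA : A ∈ normalSpace κ u)
    (hB : B ∈ normalSpace κ u) : IsNormalJacobi κ u (jacobi κ A B) := by
  refine ⟨contDiff_jacobi κ A B, fun r =>
    ⟨bil_geod_jacobi hA hB r, bil_geodVel_jacobi hA hB r, ?_⟩⟩
  rw [covDeriv_jacobi hκ hA hB, covDeriv_jacobi hκ hB (smul_mem_normalSpace _ hA)]
  simp only [jacobi, geod]
  module

theorem eq_zero_of_hasDerivAt_bil {X Y : ℝ → E4} {X' Y' : E4} {r : ℝ} (hX : HasDerivAt X X' r)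
    (hY : HasDerivAt Y Y' r) (h : ∀ t, bil κ (X t) (Y t) = 0) :
    bil κ X' (Y r) + bil κ (X r) Y' = 0 := by
  have hd := hasDerivAt_bil (κ := κ) hX hY
  simp only [h] at hd
  exact hd.unique (hasDerivAt_const r 0)

theorem IsNormalJacobi.exists_eq_jacobi (hκ : κ = 1 ∨ κ = -1) (h : IsNormalJacobi κ u J) :
    ∃ A ∈ normalSpace κ u, ∃ B ∈ normalSpace κ u, J = jacobi κ A B := by
  obtain ⟨hsmooth, hJ⟩ := h
  have hd (r : ℝ) : HasDerivAt J (deriv J r) r :=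
    (hsmooth.differentiable (by simp) r).hasDerivAt
  have hdd (r : ℝ) : HasDerivAt (deriv J) (deriv (deriv J) r) r :=
    ((contDiff_infty_iff_deriv.1 hsmooth).2.differentiable (by simp) r).hasDerivAt
  have hγ (r : ℝ) : bil κ (geod κ u r) (deriv J r) = 0 := by
    simpa [(hJ r).2.1] using
      eq_zero_of_hasDerivAt_bil (hasDerivAt_geod hκ u r) (hd r) fun t => (hJ t).1
  have hγ' (r : ℝ) : bil κ (geodVel κ u r) (deriv J r) = 0 := by
    simpa [(hJ r).1] using
      eq_zero_of_hasDerivAt_bil (hasDerivAt_geodVel hκ u r) (hd r) fun t => (hJ t).2.1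
  have hcov : covDeriv κ (geod κ u) J = deriv J := by
    funext r
    rw [covDeriv, bil_comm, hγ, mul_zero, zero_smul, sub_zero]
  have hode (r : ℝ) : deriv (deriv J) r = -κ • J r := by
    have hγ'' : bil κ (geod κ u r) (deriv (deriv J) r) = 0 := by
      simpa [hγ' r] using eq_zero_of_hasDerivAt_bil (hasDerivAt_geod hκ u r) (hdd r) hγ
    have hr := (hJ r).2.2
    rw [hcov, covDeriv, bil_comm, hγ'', mul_zero, zero_smul, sub_zero] at hr
    rw [neg_smul, eq_neg_of_add_eq_zero_left hr]
  refine ⟨J 0, ⟨by simpa using (hJ 0).1, by simpa using (hJ 0).2.1⟩, deriv J 0,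
    ⟨by simpa using hγ 0, by simpa using hγ' 0⟩, ?_⟩
  exact eq_jacobi_of_hasDerivAt hκ hd fun r => (hdd r).congr_deriv (hode r)

theorem gK_jacobi (hκ : κ = 1 ∨ κ = -1) (hB : bil κ u.1.1 B = 0) (hB' : bil κ u.1.1 B' = 0) :
    gK u (jacobi κ A B) (jacobi κ A' B') = bil κ A A' + κ * bil κ B B' := by
  have hcov {X Y : E4} (hY : bil κ u.1.1 Y = 0) :
      covDeriv κ (geod κ u) (jacobi κ X Y) 0 = Y := by
    simp [covDeriv, (hasDerivAt_jacobi hκ X Y 0).deriv, bil_comm κ Y, hY]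
  rw [gK, hcov hB, hcov hB', jacobi_zero, jacobi_zero]

theorem complexStructure_jacobi (hκ : κ = 1 ∨ κ = -1) (u : unitTangentBundle κ) (A B : E4) :
    complexStructure u (jacobi κ A B) =
      jacobi κ (cross κ u.1.1 u.1.2 A) (cross κ u.1.1 u.1.2 B) := by
  funext r
  have hdet : cK κ r * cK κ r - sK κ r * -(κ * sK κ r) = 1 := by
    linear_combination cK_sq_add hκ r
  simp only [complexStructure, jacobi, geod, geodVel, cross_linear_comb, cross_add_right,
    cross_smul_right, hdet, one_smul]

/-! ### Velocities of curves of geodesics -/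

theorem normalPart_jacobi (hκ : κ = 1 ∨ κ = -1) (hA : bil κ u.1.1 A = 0)
    (hB : bil κ u.1.2 B = 0) (hAB : bil κ u.1.1 B + bil κ u.1.2 A = 0) :
    normalPart u (jacobi κ A B) =
      jacobi κ (A - bil κ u.1.2 A • u.1.2) (B + (κ * bil κ u.1.2 A) • u.1.1) := by
  funext r
  have htangential : bil κ (jacobi κ A B r) (geodVel κ u r) = bil κ u.1.2 A := by
    simp only [jacobi, geod, geodVel, bil_add_left, bil_add_right, bil_smul_left,
      bil_smul_right, bil_comm κ A, bil_comm κ B, hA, hB]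
    linear_combination bil κ u.1.2 A * cK_sq_add hκ r - κ * sK κ r ^ 2 * hAB
  rw [normalPart, htangential]
  simp only [jacobi, geod, geodVel]
  module

variable {φ : ℝ → unitTangentBundle κ} {s : ℝ}

theorem variationField_eq_jacobi (hA : HasDerivAt (fun s => (φ s).1.1) A s)
    (hB : HasDerivAt (fun s => (φ s).1.2) B s) : variationField φ s = jacobi κ A B :=
  funext fun r => ((hA.const_smul (cK κ r)).add (hB.const_smul (sK κ r))).deriv

theorem bil_snd_deriv_snd_eq_zero (hB : HasDerivAt (fun s => (φ s).1.2) B s) :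
    bil κ (φ s).1.2 B = 0 := by
  have hd := hasDerivAt_bil (κ := κ) hB hB
  simp only [fun s => (φ s).2.2.2] at hd
  linear_combination (1 / 2) * hd.unique (hasDerivAt_const s 1) - (1 / 2) * bil_comm κ B (φ s).1.2

theorem bil_fst_deriv_snd_add (hA : HasDerivAt (fun s => (φ s).1.1) A s)
    (hB : HasDerivAt (fun s => (φ s).1.2) B s) :
    bil κ (φ s).1.1 B + bil κ (φ s).1.2 A = 0 := by
  have h := eq_zero_of_hasDerivAt_bil (κ := κ) hA hB fun t => (φ t).2.2.1
  rwa [bil_comm κ A, add_comm] at h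

theorem normalPart_variationField (hκ : κ = 1 ∨ κ = -1)
    (hA : HasDerivAt (fun s => (φ s).1.1) A s) (hB : HasDerivAt (fun s => (φ s).1.2) B s) :
    normalPart (φ s) (variationField φ s) =
      jacobi κ (A - bil κ (φ s).1.2 A • (φ s).1.2)
        (B + (κ * bil κ (φ s).1.2 A) • (φ s).1.1) := by
  rw [variationField_eq_jacobi hA hB]
  exact normalPart_jacobi hκ
    (bil_deriv_eq_zero (Eventually.of_forall fun t => (φ t).2.1) hA)
    (bil_snd_deriv_snd_eq_zero hB) (bil_fst_deriv_snd_add hA hB)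

end NormalJacobi

/-! ### The hypersurface of tangent geodesics -/

/-- The orthogonal projection of `x` to the plane of tangent vectors of the space form at `p`
orthogonal to the unit tangent vector `n`. -/
noncomputable def planeProj (κ : ℝ) (p n x : E4) : E4 := tangentProj κ p x - bil κ n x • n

section PlaneProj

variable {κ : ℝ}

theorem bil_planeProj_left (hκ : κ = 1 ∨ κ = -1) {p n : E4} (hp : bil κ p p = κ)
    (hpn : bil κ p n = 0) (x : E4) : bil κ p (planeProj κ p n x) = 0 := by
  rw [planeProj, bil_sub_right, bil_tangentProj_self hκ hp, bil_smul_right, hpn, mul_zero,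
    sub_zero]

theorem bil_planeProj_right {p n : E4} (hpn : bil κ p n = 0) (hnn : bil κ n n = 1) (x : E4) :
    bil κ n (planeProj κ p n x) = 0 := by
  rw [planeProj, bil_sub_right, bil_tangentProj_of_orthogonal ((bil_comm _ _ _).trans hpn),
    bil_smul_right, hnn, mul_one, sub_self]

theorem planeProj_of_orthogonal {p n x : E4} (hpx : bil κ p x = 0) (hnx : bil κ n x = 0) :
    planeProj κ p n x = x := by
  simp [planeProj, tangentProj, hpx, hnx]

theorem contDiffAt_planeProj {p n x : ℝ → E4} {s : ℝ} (hp : ContDiffAt ℝ ∞ p s)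
    (hn : ContDiffAt ℝ ∞ n s) (hx : ContDiffAt ℝ ∞ x s) :
    ContDiffAt ℝ ∞ (fun s => planeProj κ (p s) (n s) (x s)) s :=
  (contDiffAt_tangentProj hp hx).sub ((contDiffAt_bil hn hx).smul hn)

theorem hasDerivAt_planeProj {p n x : ℝ → E4} {p' n' x' : E4} {s : ℝ} (hp : HasDerivAt p p' s)
    (hn : HasDerivAt n n' s) (hx : HasDerivAt x x' s) (hpx : bil κ (p s) (x s) = 0)
    (hnx : bil κ (n s) (x s) = 0) :
    HasDerivAt (fun s => planeProj κ (p s) (n s) (x s))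
      (planeProj κ (p s) (n s) x' - (κ * bil κ p' (x s)) • p s - bil κ n' (x s) • n s) s := by
  refine ((hx.fun_sub (((hasDerivAt_bil (κ := κ) hp hx).const_mul κ).fun_smul hp)).fun_sub
    ((hasDerivAt_bil (κ := κ) hn hx).fun_smul hn)).congr_deriv ?_
  simp only [planeProj, tangentProj, hpx, hnx]
  module

end PlaneProj

section TangentSpaceM

variable {κ : ℝ} {S : Set E4} {ν : E4 → E4} {f : E4 → ℝ} {p : E4} {u : unitTangentBundle κ}

theorem isFrame_rotated (hκ : κ = 1 ∨ κ = -1) (hS : IsCompactSurface κ S)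
    (hconv : StrictlyConvex κ S) (hu : u ∈ unitTangentSurface κ S) :
    IsFrame κ u.1.1 (inwardNormal κ S u.1.1) u.1.2 (rotated S u).2 := by
  have hn := isInwardNormal_inwardNormal hκ hS hconv hu.1
  exact isFrame_cross hκ u.2.1.1 hn.1 u.2.2.1 hn.2.1 (hn.2.2.1 _ hu.2) u.2.2.2

theorem IsLocalEquation.hasDerivAt_comp (h : IsLocalEquation κ S ν f p) {σ : ℝ → E4} {A : E4}
    (hσ : σ 0 = p) (hA : HasDerivAt σ A 0) :
    HasDerivAt (fun s => ν (σ s)) (fderiv ℝ ν p A) 0 := by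
  subst hσ
  exact (h.smooth_normal.self_of_nhds.differentiableAt (by simp)).hasFDerivAt.comp_hasDerivAt 0 hA

theorem IsLocalEquation.bil_fderiv_normal_ne_zero (h : IsLocalEquation κ S ν f p)
    (hκ : κ = 1 ∨ κ = -1) (hS : S ⊆ spaceForm κ) (hquad : QuadraticallyConvex κ S) (hp : p ∈ S)
    (hν : ∀ᶠ x in 𝓝 p, x ∈ S → inwardNormal κ S x = ν x) {v : E4} (hpv : bil κ p v = 0)
    (hνv : bil κ (ν p) v = 0) (hv : v ≠ 0) : bil κ (fderiv ℝ ν p v) v ≠ 0 := by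
  obtain ⟨σ, hσ, hd⟩ := h.exists_curve hκ hS hp hpv hνv
  have hnormal : HasDerivAt (fun s => inwardNormal κ S (σ s)) (fderiv ℝ ν p v) 0 := by
    refine (h.hasDerivAt_comp hσ.2 hd).congr_of_eventuallyEq ?_
    filter_upwards [hσ.1, hσ.tendsto.eventually hν] with s hs hνs using hνs hs.2
  have hshape : shapeForm κ S σ ≠ 0 := by
    have hd0 : deriv σ 0 ≠ 0 := hd.deriv ▸ hv
    exact (hquad p hp).elim (fun hq => (hq σ hσ hd0).ne') fun hq => (hq σ hσ hd0).ne
  simpa [shapeForm, covDeriv, hnormal.deriv, hd.deriv, hσ.2, hpv] using hshape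

theorem IsLocalEquation.exists_unit_field (h : IsLocalEquation κ S ν f p) (hκ : κ = 1 ∨ κ = -1)
    (hS : S ⊆ spaceForm κ) {σ : ℝ → E4} (hσ : IsCurveIn S p σ) {A v w : E4}
    (hA : HasDerivAt σ A 0) (hpv : bil κ p v = 0) (hνv : bil κ (ν p) v = 0)
    (hvv : bil κ v v = 1) (hpw : bil κ p w = 0) (hνw : bil κ (ν p) w = 0)
    (hvw : bil κ v w = 0) :
    ∃ x : ℝ → E4, x 0 = v ∧
      HasDerivAt x (w - (κ * bil κ A v) • p - bil κ (fderiv ℝ ν p A) v • ν p) 0 ∧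
      ∀ᶠ s in 𝓝 0, ContDiffAt ℝ ∞ x s ∧ bil κ (x s) (x s) = 1 ∧ x s ∈ tangentPlane S (σ s) := by
  let y : ℝ → E4 := fun s => planeProj κ (σ s) (ν (σ s)) (v + s • w)
  have hline : HasDerivAt (fun s : ℝ => v + s • w) w 0 := by
    simpa using ((hasDerivAt_id (0 : ℝ)).smul_const w).const_add v
  have hy0 : y 0 = v := by simp [y, hσ.2, planeProj_of_orthogonal hpv hνv]
  have hy : HasDerivAt y (w - (κ * bil κ A v) • p - bil κ (fderiv ℝ ν p A) v • ν p) 0 := by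
    refine (hasDerivAt_planeProj (κ := κ) hA (h.hasDerivAt_comp hσ.2 hA) hline
      (by simpa [hσ.2]) (by simpa [hσ.2])).congr_deriv ?_
    simp only [hσ.2, planeProj_of_orthogonal hpw hνw, zero_smul, add_zero]
  have hysmooth : ∀ᶠ s in 𝓝 0, ContDiffAt ℝ ∞ y s := by
    filter_upwards [hσ.1, hσ.tendsto.eventually h.smooth_normal] with s hs hνs
    exact contDiffAt_planeProj hs.1 (hνs.comp s hs.1) (by fun_prop)
  have hypos : ∀ᶠ s in 𝓝 0, 0 < bil κ (y s) (y s) := by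
    refine (contDiffAt_bil hysmooth.self_of_nhds hysmooth.self_of_nhds).continuousAt.eventually
      (lt_mem_nhds ?_)
    simp only [hy0, hvv, one_pos]
  refine ⟨fun s => normalized κ (y s), by simp only [hy0, normalized_eq_self hvv],
    hasDerivAt_normalized hy (hy0 ▸ hvv) ?_, ?_⟩
  · simp [hy0, hvw, bil_comm κ v p, hpv, bil_comm κ v (ν p), hνv]
  · filter_upwards [hσ.1, hysmooth, hypos, hσ.tendsto.eventually h.eventually]
      with s hs hsmooth hpos heq
    have hσM := hS hs.2
    have hσν := heq.orthogonal.self_of_nhds hσM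
    exact ⟨contDiffAt_normalized hsmooth hpos, bil_normalized_self hpos,
      (heq.mem_tangentPlane_iff hκ hS hs.2).2
        ⟨by rw [bil_normalized_right, bil_planeProj_left hκ hσM.1 hσν, mul_zero],
          by rw [bil_normalized_right, bil_planeProj_right hσν (heq.unit.self_of_nhds hσM),
            mul_zero]⟩⟩

theorem exists_eventually_coe_eq (u : unitTangentBundle κ) {z : ℝ → E4 × E4} {s : ℝ}
    (hz : ∀ᶠ t in 𝓝 s, z t ∈ unitTangentBundle κ) :
    ∃ φ : ℝ → unitTangentBundle κ, ∀ᶠ t in 𝓝 s, (φ t : E4 × E4) = z t := by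
  classical
  refine ⟨fun t => if ht : z t ∈ unitTangentBundle κ then ⟨z t, ht⟩ else u, ?_⟩
  filter_upwards [hz] with t ht
  rw [dif_pos ht]

theorem IsLocalEquation.exists_curve_unitTangentSurface (h : IsLocalEquation κ S ν f u.1.1)
    (hκ : κ = 1 ∨ κ = -1) (hS : S ⊆ spaceForm κ) (hu : u ∈ unitTangentSurface κ S) {A w : E4}
    (hpA : bil κ u.1.1 A = 0) (hνA : bil κ (ν u.1.1) A = 0) (hpw : bil κ u.1.1 w = 0)
    (hνw : bil κ (ν u.1.1) w = 0) (hvw : bil κ u.1.2 w = 0) :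
    ∃ φ : ℝ → unitTangentBundle κ, φ 0 = u ∧ HasDerivAt (fun s => (φ s).1.1) A 0 ∧
      HasDerivAt (fun s => (φ s).1.2)
        (w - (κ * bil κ A u.1.2) • u.1.1 - bil κ (fderiv ℝ ν u.1.1 A) u.1.2 • ν u.1.1) 0 ∧
      ∀ᶠ s in 𝓝 0, ContDiffAt ℝ ∞ (fun s' => (φ s' : E4 × E4)) s ∧
        φ s ∈ unitTangentSurface κ S := by
  obtain ⟨hpv, hνv⟩ := (h.mem_tangentPlane_iff hκ hS hu.1).1 hu.2
  obtain ⟨σ, hσ, hσd⟩ := h.exists_curve hκ hS hu.1 hpA hνA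
  obtain ⟨x, hx0, hxd, hx⟩ :=
    h.exists_unit_field hκ hS hσ hσd hpv hνv u.2.2.2 hpw hνw hvw
  obtain ⟨φ, hφ⟩ := exists_eventually_coe_eq u (z := fun s => (σ s, x s)) <| by
    filter_upwards [hσ.1, hx, hσ.tendsto.eventually h.eventually] with s hs hxs heq
    exact ⟨hS hs.2, ((heq.mem_tangentPlane_iff hκ hS hs.2).1 hxs.2.2).1, hxs.2.1⟩
  refine ⟨φ, Subtype.ext (by rw [hφ.self_of_nhds, hσ.2, hx0]),
    hσd.congr_of_eventuallyEq (hφ.mono fun s hs => congrArg Prod.fst hs),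
    hxd.congr_of_eventuallyEq (hφ.mono fun s hs => congrArg Prod.snd hs), ?_⟩
  filter_upwards [hσ.1, hx, hφ.eventually_nhds] with s hs hxs hφs
  refine ⟨(hs.1.prodMk hxs.1).congr_of_eventuallyEq hφs, ?_⟩
  simp only [unitTangentSurface, mem_ofPred_eq, hφs.self_of_nhds]
  exact ⟨hs.2, hxs.2.2⟩

theorem isNormalJacobi_of_mem_tangentSpaceM (hκ : κ = 1 ∨ κ = -1) (hS : IsCompactSurface κ S)
    (hconv : StrictlyConvex κ S) (hu : u ∈ unitTangentSurface κ S) {K : ℝ → E4}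
    (hK : K ∈ tangentSpaceM S u) :
    IsNormalJacobi κ u K ∧ bil κ (inwardNormal κ S u.1.1) (K 0) = 0 := by
  obtain ⟨φ, hφ, rfl, rfl⟩ := hK
  have hsmooth := hφ.self_of_nhds.1
  have hA := (hsmooth.fst.differentiableAt (by simp)).hasDerivAt
  have hB := (hsmooth.snd.differentiableAt (by simp)).hasDerivAt
  have hAS : deriv (fun s => (φ s).1.1) 0 ∈ tangentPlane S (φ 0).1.1 :=
    ⟨_, ⟨hφ.mono fun s hs => ⟨hs.1.fst, hs.2.1⟩, rfl⟩, rfl⟩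
  obtain ⟨hpA, hnA⟩ := (mem_tangentPlane_iff hκ hS hconv hu.1).1 hAS
  have hvB := bil_snd_deriv_snd_eq_zero hB
  have hpB := bil_fst_deriv_snd_add hA hB
  have F := isFrame_rotated hκ hS hconv hu
  rw [normalPart_variationField hκ hA hB]
  refine ⟨isNormalJacobi_jacobi hκ ⟨?_, ?_⟩ ⟨?_, ?_⟩, ?_⟩
  · simp [hpA, F.pv]
  · simp [F.vv]
  · simp only [bil_add_right, bil_smul_right, F.pp]
    linear_combination hpB + bil κ (φ 0).1.2 (deriv (fun s => (φ s).1.1) 0) * kappa_sq hκ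
  · simp [hvB, F.vp]
  · simp [hnA, F.nv]

theorem jacobi_mem_tangentSpaceM (hκ : κ = 1 ∨ κ = -1) (hS : IsCompactSurface κ S)
    (hconv : StrictlyConvex κ S) (hquad : QuadraticallyConvex κ S)
    (hu : u ∈ unitTangentSurface κ S) {A B : E4} (hA : A ∈ normalSpace κ u)
    (hB : B ∈ normalSpace κ u) (hnA : bil κ (inwardNormal κ S u.1.1) A = 0) :
    jacobi κ A B ∈ tangentSpaceM S u := by
  obtain ⟨ν, f, h, hν⟩ := hS.exists_isLocalEquation_inwardNormal hκ hconv hu.1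
  have F := isFrame_rotated hκ hS hconv hu
  rw [(hν.self_of_nhds hu.1).1] at F hnA
  set w := (rotated S u).2
  have hII : bil κ (fderiv ℝ ν u.1.1 u.1.2) u.1.2 ≠ 0 := by
    refine h.bil_fderiv_normal_ne_zero hκ hS.1 hquad hu.1 (hν.mono fun x hx hxS => (hx hxS).1)
      F.pv F.nv fun hv => ?_
    simpa [hv] using F.vv
  -- Adding a multiple of `u` to the velocity `A` of the foot point does not change the normal
  -- part, and adjusts the normal component of the derivative of the direction.
  obtain ⟨c, hc⟩ :
      ∃ c : ℝ, -bil κ (fderiv ℝ ν u.1.1 (c • u.1.2 + A)) u.1.2 = bil κ (ν u.1.1) B := by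
    refine ⟨-(bil κ (ν u.1.1) B + bil κ (fderiv ℝ ν u.1.1 A) u.1.2) /
      bil κ (fderiv ℝ ν u.1.1 u.1.2) u.1.2, ?_⟩
    rw [map_add, map_smul, bil_add_left, bil_smul_left]
    field_simp
    ring
  obtain ⟨φ, hφ0, hφA, hφB, hφ⟩ := h.exists_curve_unitTangentSurface hκ hS.1 hu
    (A := c • u.1.2 + A) (w := bil κ w B • w) (by simp [F.pv, hA.1]) (by simp [F.nv, hnA])
    (by simp [F.pw]) (by simp [F.nw]) (by simp [F.vw])
  refine ⟨φ, hφ, hφ0, ?_⟩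
  have hvelocity := normalPart_variationField hκ hφA hφB
  rw [hφ0] at hvelocity
  have hBeq : B = bil κ (ν u.1.1) B • ν u.1.1 + bil κ w B • w :=
    F.swap.eq_smul_add_smul hκ hB.1 hB.2
  have hvA : bil κ u.1.2 (c • u.1.2 + A) = c := by simp [F.vv, hA.2]
  rw [hvelocity, bil_comm κ (c • u.1.2 + A), hvA]
  congr 1
  · module
  · linear_combination (norm := module) hBeq - hc • ν u.1.1

theorem mem_tangentSpaceM_iff (hκ : κ = 1 ∨ κ = -1) (hS : IsCompactSurface κ S)
    (hconv : StrictlyConvex κ S) (hquad : QuadraticallyConvex κ S)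
    (hu : u ∈ unitTangentSurface κ S) {K : ℝ → E4} :
    K ∈ tangentSpaceM S u ↔
      IsNormalJacobi κ u K ∧ bil κ (inwardNormal κ S u.1.1) (K 0) = 0 := by
  refine ⟨isNormalJacobi_of_mem_tangentSpaceM hκ hS hconv hu, fun ⟨hK, hnK⟩ => ?_⟩
  obtain ⟨A, hA, B, hB, rfl⟩ := hK.exists_eq_jacobi hκ
  exact jacobi_mem_tangentSpaceM hκ hS hconv hquad hu hA hB (by simpa using hnK)

end TangentSpaceM

/-! ### The outward normal -/

theorem eventually_pos_of_hasDerivAt {g : ℝ → ℝ} {g' : ℝ} (h : HasDerivAt g g' 0) (hg0 : g 0 = 0)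
    (hg' : 0 < g') : ∀ᶠ s in 𝓝[>] (0 : ℝ), 0 < g s := by
  have hslope := (hasDerivWithinAt_iff_tendsto_slope' (s := Ioi (0 : ℝ)) (by simp)).1
    h.hasDerivWithinAt
  filter_upwards [hslope.eventually (lt_mem_nhds hg'), self_mem_nhdsWithin] with s hs hs0
  rw [slope_def_field, hg0, sub_zero, sub_zero] at hs
  exact (div_pos_iff_of_pos_right hs0).1 hs

theorem eventually_lt_nhdsWithin_Ioi {a : ℝ} (ha : 0 < a) : ∀ᶠ s in 𝓝[>] (0 : ℝ), s < a :=
  nhdsWithin_le_nhds (gt_mem_nhds ha)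

theorem exists_forall_mem_Ico {P : ℝ × ℝ → Prop} (hP : ∀ᶠ q in 𝓝 0, P q) :
    ∃ η > 0, ∀ a ∈ Ico 0 η, ∀ b ∈ Ico 0 η, P (a, b) := by
  obtain ⟨η, hη, hball⟩ := Metric.eventually_nhds_iff.1 hP
  refine ⟨η, hη, fun a ha b hb => hball ?_⟩
  rw [Prod.dist_eq, max_lt_iff]
  simpa [abs_of_nonneg ha.1, abs_of_nonneg hb.1] using ⟨ha.2, hb.2⟩

theorem sK_pos {κ r : ℝ} (hκ : κ = 1 ∨ κ = -1) (hr0 : 0 < r) (hr3 : r < 3) : 0 < sK κ r := by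
  rcases hκ with rfl | rfl
  · rw [sK_one]; exact Real.sin_pos_of_pos_of_lt_pi hr0 (hr3.trans Real.pi_gt_three)
  · rw [sK_neg_one]; exact Real.sinh_pos_iff.2 hr0

theorem continuousAt_geod {κ : ℝ} {X : Type*} [TopologicalSpace X] {φ : X → E4 × E4} {r : X → ℝ}
    {a : X} (hφ : ContinuousAt φ a) (hr : ContinuousAt r a) :
    ContinuousAt (fun x => geod κ (φ x) (r x)) a :=
  (((contDiff_cK κ).continuous.continuousAt.comp hr).smul hφ.fst).add
    (((contDiff_sK κ).continuous.continuousAt.comp hr).smul hφ.snd)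

theorem bil_one_le {x y : E4} (hx : bil 1 x x = 1) (hy : bil 1 y y = 1) : bil 1 x y ≤ 1 := by
  simp only [bil] at *
  nlinarith [sq_nonneg (x 0 - y 0), sq_nonneg (x 1 - y 1), sq_nonneg (x 2 - y 2),
    sq_nonneg (x 3 - y 3)]

section Outward

variable {κ : ℝ} {S : Set E4}

namespace IsLocalEquation

variable {ν : E4 → E4} {f : E4 → ℝ} {p : E4}

theorem eventually_comp {X : Type*} [TopologicalSpace X] (h : IsLocalEquation κ S ν f p)
    {x : X → E4} {a : X} (hx : ContinuousAt x a) (hxa : x a = p) :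
    ∀ᶠ q in 𝓝 a, (x q ∈ spaceForm κ → f (x q) = 0 → x q ∈ S) ∧ ContinuousAt f (x q) := by
  subst hxa
  filter_upwards [hx.eventually h.mem_iff, hx.eventually h.smooth] with q hmem hf
  exact ⟨fun hM h0 => hmem.2 ⟨hM, h0⟩, hf.continuousAt⟩

theorem eventually_pos_comp (h : IsLocalEquation κ S ν f p) (hS : S ⊆ spaceForm κ) (hp : p ∈ S)
    {σ : ℝ → E4} {A : E4} (hσ : σ 0 = p) (hA : HasDerivAt σ A 0) (hpA : bil κ p A = 0)
    (hνA : 0 < bil κ (ν p) A) : ∀ᶠ s in 𝓝[>] (0 : ℝ), 0 < f (σ s) := by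
  subst hσ
  obtain ⟨l, hl, hdf⟩ := h.fderiv_eq.self_of_nhds (hS hp)
  have hf := (h.smooth.self_of_nhds.differentiableAt (by simp)).hasFDerivAt.comp_hasDerivAt 0 hA
  refine eventually_pos_of_hasDerivAt hf (h.mem_iff.self_of_nhds.1 hp).2 ?_
  rw [hdf A hpA]
  exact mul_pos hl hνA

theorem exists_forall_ne_zero (h : IsLocalEquation κ S ν f p) (hκ : κ = 1 ∨ κ = -1)
    (hS : S ⊆ spaceForm κ) (hconv : StrictlyConvex κ S) (hp : p ∈ S)
    (hν : IsInwardNormal κ S p (ν p)) {v : E4} (hpv : bil κ p v = 0) (hνv : bil κ (ν p) v = 0)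
    (hvv : bil κ v v = 1) :
    ∃ η > 0, ∀ a ∈ Ico 0 η, ∀ b ∈ Ioo 0 η, f (geod κ (geod κ (p, v) b, -ν p) a) ≠ 0 ∧
      ContinuousAt f (geod κ (geod κ (p, v) b, -ν p) a) := by
  obtain ⟨hpν, hνν, -, hνS⟩ := hν
  have hνp : bil κ (ν p) p = 0 := (bil_comm _ _ _).trans hpν
  let x : ℝ × ℝ → E4 := fun q => geod κ (geod κ (p, v) q.2, -ν p) q.1
  have hνx : ∀ q, bil κ (ν p) (x q) = -sK κ q.1 := by intro q; simp [x, geod, hνp, hνv, hνν]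
  have hvx : ∀ b, bil κ v (x (0, b)) = sK κ b := by
    intro b; simp [x, geod, hvv, (bil_comm _ _ _).trans hpv]
  have hxM : ∀ q, x q ∈ spaceForm κ := fun q =>
    geod_mem_spaceForm hκ (geod_mem_spaceForm hκ (hS hp) hpv hvv q.2)
      (by simp [geod, hpν, (bil_comm _ _ _).trans hνv]) (by simp [hνν]) q.1
  have hxc : ∀ q, ContinuousAt x q := fun q => continuousAt_geod
    ((continuousAt_geod continuousAt_const continuousAt_snd).prodMk continuousAt_const)
    continuousAt_fst
  obtain ⟨η, hη, hbox⟩ :=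
    exists_forall_mem_Ico (h.eventually_comp (hxc 0) (by simp [x] : x 0 = p))
  refine ⟨min η 3, lt_min hη (by norm_num), fun a ha b hb => ?_⟩
  obtain ⟨haη, ha3⟩ := lt_min_iff.1 ha.2
  obtain ⟨hbη, hb3⟩ := lt_min_iff.1 hb.2
  obtain ⟨hmem, hcont⟩ := hbox a ⟨ha.1, haη⟩ b ⟨hb.1.le, hbη⟩
  refine ⟨fun h0 => ?_, hcont⟩
  have hxS := hmem (hxM _) h0
  rcases ha.1.eq_or_lt with rfl | ha0
  · have heq := h.eq_of_bil_eq_zero hκ hS hconv hp hxS (by simp [hνx])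
    have hb0 := sK_pos hκ hb.1 hb3
    rw [← hvx b, heq, bil_comm, hpv] at hb0
    exact hb0.false
  · linarith [hνS _ hxS, hνx (a, b), sK_pos hκ ha0 ha3]

/- By `exists_forall_ne_zero` the sign of `f` is constant on the outer side of the tangent totally
geodesic surface near `p`; it is negative on the curve leaving `p` in the direction `v - ν p`. -/
theorem eventually_neg_geod (h : IsLocalEquation κ S ν f p) (hκ : κ = 1 ∨ κ = -1)
    (hS : S ⊆ spaceForm κ) (hconv : StrictlyConvex κ S) (hp : p ∈ S)
    (hν : IsInwardNormal κ S p (ν p)) {v : E4} (hpv : bil κ p v = 0) (hνv : bil κ (ν p) v = 0)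
    (hvv : bil κ v v = 1) : ∀ᶠ r in 𝓝[>] (0 : ℝ), f (geod κ (p, v) r) < 0 := by
  obtain ⟨η, hη, hbox⟩ := h.exists_forall_ne_zero hκ hS hconv hp hν hpv hνv hvv
  let x : ℝ × ℝ → E4 := fun q => geod κ (geod κ (p, v) q.2, -ν p) q.1
  have hxc : ∀ q, ContinuousAt x q := fun q => continuousAt_geod
    ((continuousAt_geod continuousAt_const continuousAt_snd).prodMk continuousAt_const)
    continuousAt_fst
  have hdiag : HasDerivAt (fun s => x (s, s)) (v - ν p) 0 :=
    (((hasDerivAt_cK hκ 0).fun_smul (hasDerivAt_geod hκ (p, v) 0)).fun_add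
      ((hasDerivAt_sK hκ 0).smul_const (-ν p))).congr_deriv (by simp [sub_eq_add_neg])
  have hneg := h.neg.eventually_pos_comp hS hp (by simp [x]) hdiag (by simp [hpv, hν.1])
    (by simp [hνv, hν.2.1])
  obtain ⟨s, hs, hsη, hs0⟩ :=
    (hneg.and ((eventually_lt_nhdsWithin_Ioi hη).and self_mem_nhdsWithin)).exists
  have hAneg := forall_neg_of_forall_ne_zero
    ((convex_Ico 0 η).prod (convex_Ioo 0 η)).isPreconnected (g := f ∘ x)
    (fun q hq => (ContinuousAt.comp (f := x) (g := f) (hbox q.1 hq.1 q.2 hq.2).2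
      (hxc q)).continuousWithinAt) (fun q hq => (hbox q.1 hq.1 q.2 hq.2).1)
    (a := (s, s)) ⟨⟨le_of_lt hs0, hsη⟩, hs0, hsη⟩ (by simpa using hs)
  filter_upwards [eventually_lt_nhdsWithin_Ioi hη, self_mem_nhdsWithin] with r hr hr0
  simpa [x] using hAneg (0, r) ⟨⟨le_rfl, hη⟩, hr0, hr⟩

/- Slightly displaced inwards, the geodesic starts inside `S`, whereas its point at a small fixed
time stays outside. -/
theorem eventually_exists_geod_mem (h : IsLocalEquation κ S ν f p) (hκ : κ = 1 ∨ κ = -1)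
    (hS : S ⊆ spaceForm κ) (hconv : StrictlyConvex κ S) (hp : p ∈ S)
    (hν : IsInwardNormal κ S p (ν p)) {φ : ℝ → unitTangentBundle κ} (hφp : (φ 0).1.1 = p)
    (hνφ : bil κ (ν p) (φ 0).1.2 = 0) (hφ : ContinuousAt (fun s => (φ s : E4 × E4)) 0) {A : E4}
    (hA : HasDerivAt (fun s => (φ s).1.1) A 0) (hpA : bil κ p A = 0) (hνA : 0 < bil κ (ν p) A) :
    ∀ᶠ s in 𝓝[>] (0 : ℝ), ∃ r, geod κ (φ s) r ∈ S := by
  subst hφp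
  have hφ₂ : ContinuousAt (fun q : ℝ × ℝ => (φ q.1 : E4 × E4)) 0 :=
    ContinuousAt.comp (g := fun s => (φ s : E4 × E4)) hφ continuousAt_fst
  obtain ⟨η, hη, hbox⟩ := exists_forall_mem_Ico (h.eventually_comp
    (continuousAt_geod hφ₂ continuousAt_snd) (by simp))
  obtain ⟨r, hr, hrη, hr0⟩ :=
    ((h.eventually_neg_geod hκ hS hconv hp hν (φ 0).2.2.1 hνφ (φ 0).2.2.2).and
      ((eventually_lt_nhdsWithin_Ioi hη).and self_mem_nhdsWithin)).exists
  replace hr0 : 0 < r := hr0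
  have hout : ∀ᶠ s in 𝓝 (0 : ℝ), f (geod κ (φ s) r) < 0 :=
    (ContinuousAt.comp (f := fun s => geod κ (φ s) r) (g := f)
      (hbox 0 ⟨le_rfl, hη⟩ r ⟨hr0.le, hrη⟩).2 (continuousAt_geod hφ
        continuousAt_const)).eventually (gt_mem_nhds hr)
  filter_upwards [h.eventually_pos_comp hS hp rfl hA hpA hνA, hout.filter_mono nhdsWithin_le_nhds,
    eventually_lt_nhdsWithin_Ioi hη, self_mem_nhdsWithin] with s hin hout hsη hs0
  have hfs : ContinuousOn (fun r => f (geod κ (φ s) r)) (Icc 0 r) := fun b hb =>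
    (ContinuousAt.comp (g := f) (hbox s ⟨le_of_lt hs0, hsη⟩ b ⟨hb.1, hb.2.trans_lt hrη⟩).2
      (hasDerivAt_geod hκ _ _).continuousAt).continuousWithinAt
  obtain ⟨b, hb, hb0⟩ := intermediate_value_Icc' hr0.le hfs ⟨hout.le, by simpa using hin.le⟩
  exact ⟨b, (hbox s ⟨le_of_lt hs0, hsη⟩ b ⟨hb.1, hb.2.trans_lt hrη⟩).1
    (geod_mem_spaceForm hκ (φ s).2.1 (φ s).2.2.1 (φ s).2.2.2 b) hb0⟩

end IsLocalEquation

theorem geod_notMem_of_toGeodesic_mem {q : unitTangentBundle κ}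
    (hq : toGeodesic q ∈ billiardTable κ S) (t : ℝ) : geod κ q t ∉ S := by
  obtain ⟨q', hq', hS, -⟩ := hq
  obtain ⟨τ, hτ⟩ := Quotient.exact hq'
  rw [hτ]
  exact hS _

variable {u : unitTangentBundle κ}

theorem not_eventually_mem_billiardTable (hκ : κ = 1 ∨ κ = -1) (hS : IsCompactSurface κ S)
    (hconv : StrictlyConvex κ S) (hu : u ∈ unitTangentSurface κ S) {c : ℝ → OrientedGeodesic κ}
    (hc : HasVelocity c 0 u (jacobi κ (inwardNormal κ S u.1.1) 0)) :
    ¬ ∀ᶠ s in 𝓝[>] (0 : ℝ), c s ∈ billiardTable κ S := by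
  intro hc𝒰
  obtain ⟨φ, hφ, hcφ, rfl, hJ⟩ := hc
  have F := isFrame_rotated hκ hS hconv hu
  obtain ⟨ν, f, h, hν⟩ := hS.exists_isLocalEquation_inwardNormal hκ hconv hu.1
  obtain ⟨hnν, hin⟩ := hν.self_of_nhds hu.1
  have hA := (hφ.self_of_nhds.fst.differentiableAt (by simp)).hasDerivAt
  have hB := (hφ.self_of_nhds.snd.differentiableAt (by simp)).hasDerivAt
  rw [normalPart_variationField hκ hA hB, jacobi_inj hκ] at hJ
  have hnA : bil κ (inwardNormal κ S (φ 0).1.1) (deriv (fun s => (φ s).1.1) 0) = 1 := by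
    simpa [F.nn, F.nv] using (congrArg (bil κ (inwardNormal κ S (φ 0).1.1)) hJ.1).symm
  obtain ⟨s, ⟨r, hr⟩, hs𝒰, hcs⟩ := ((h.eventually_exists_geod_mem hκ hS.1 hconv hu.1 hin rfl
    (hnν ▸ F.nv) hφ.self_of_nhds.continuousAt hA
    (bil_deriv_eq_zero (Eventually.of_forall fun t => (φ t).2.1) hA)
    (by rw [← hnν, hnA]; exact one_pos)).and
      (hc𝒰.and (hcφ.filter_mono nhdsWithin_le_nhds))).exists
  exact geod_notMem_of_toGeodesic_mem (hcs ▸ hs𝒰) r hr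

/- On the geodesic one has `⟨n, x⟩ = -sin s cos t` and `⟨p, x⟩ = cos s cos t` (for `κ = 1`). On the
side of `S`, where `⟨n, x⟩ ≥ 0`, both are at most `sin s`, while one of them is bounded below on
the compact surface. -/
theorem eventually_forall_geod_notMem (hκ : κ = 1 ∨ κ = -1) (hS : IsCompactSurface κ S)
    (hconv : StrictlyConvex κ S) {p v w : E4} (hp : p ∈ S)
    (F : IsFrame κ p (inwardNormal κ S p) v w) :
    ∀ᶠ s in 𝓝[>] (0 : ℝ), ∀ t, geod κ (geod κ (p, -inwardNormal κ S p) s, v) t ∉ S := by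
  have hin := isInwardNormal_inwardNormal hκ hS hconv hp
  have hn : ∀ s t, bil κ (inwardNormal κ S p)
      (geod κ (geod κ (p, -inwardNormal κ S p) s, v) t) = -(cK κ t * sK κ s) := by
    intro s t; simp [geod, F.np, F.nn, F.nv]
  have hlt_three := eventually_lt_nhdsWithin_Ioi (by norm_num : (0 : ℝ) < 3)
  rcases hκ with rfl | rfl
  · obtain ⟨ε, hε, hεS⟩ := hS.2.1.exists_forall_le' (a := 0)
      (f := fun x => max (bil 1 p x) (bil 1 (inwardNormal 1 S p) x))
      (ContinuousOn.sup (continuous_bil 1 p).continuousOn (continuous_bil 1 _).continuousOn)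
      (fun x hx => by
        rcases eq_or_ne x p with rfl | hxp
        · exact lt_max_of_lt_left (by rw [F.pp]; exact one_pos)
        · exact lt_max_of_lt_right (bil_inwardNormal_pos (Or.inl rfl) hS hconv hp hx hxp))
    have hsin := (Real.continuous_sin.tendsto' 0 0 Real.sin_zero).eventually (gt_mem_nhds hε)
    have hcos := (Real.continuous_cos.tendsto' 0 1 Real.cos_zero).eventually (lt_mem_nhds one_pos)
    filter_upwards [hsin.filter_mono nhdsWithin_le_nhds, hcos.filter_mono nhdsWithin_le_nhds,
      self_mem_nhdsWithin, hlt_three] with s hsε hcs hs0 hs3 t hmem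
    have hs : 0 < Real.sin s := by simpa using sK_pos (Or.inl rfl) hs0 hs3
    have hnx := hin.2.2.2 _ hmem
    have hpx : bil 1 p (geod 1 (geod 1 (p, -inwardNormal 1 S p) s, v) t) =
        Real.cos t * Real.cos s := by
      simp [geod, F.pp, F.pn, F.pv]
    rcases le_max_iff.1 (hεS _ hmem) with h | h <;>
      simp only [hn, hpx, cK_one, sK_one] at h hnx <;> nlinarith [Real.neg_one_le_cos t]
  · filter_upwards [self_mem_nhdsWithin, hlt_three] with s hs0 hs3 t hmem
    have hnx := hin.2.2.2 _ hmem
    rw [hn, cK_neg_one] at hnx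
    linarith [mul_pos (Real.cosh_pos t) (sK_pos (Or.inr rfl) hs0 hs3)]

/- With `n` the inward normal at `p`, both `⟨y, p⟩` and `⟨n y, p⟩` would be at most `tan s` if the
geodesic lay in the plane `T_y S`; but one of them is bounded below on the compact surface. -/
theorem eventually_geod_notMem_tangentPlane {S : Set E4} (hS : IsCompactSurface 1 S)
    (hconv : StrictlyConvex 1 S) {p : E4} (hp : p ∈ S) :
    ∀ᶠ s in 𝓝[>] (0 : ℝ), ∀ y ∈ S, geod 1 (p, -inwardNormal 1 S p) s ∉ tangentPlane S y := by
  have hκ : (1 : ℝ) = 1 ∨ (1 : ℝ) = -1 := Or.inl rfl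
  have hin := fun {y} => isInwardNormal_inwardNormal hκ hS hconv (p := y)
  obtain ⟨ε, hε, hεS⟩ := hS.2.1.exists_forall_le' (a := 0)
    (f := fun y => max (bil 1 p y) (bil 1 p (inwardNormal 1 S y)))
    (ContinuousOn.sup (continuous_bil 1 p).continuousOn
      ((continuous_bil 1 p).comp_continuousOn (continuousOn_inwardNormal hκ hS hconv)))
    (fun y hy => by
      rcases eq_or_ne p y with rfl | hpy
      · exact lt_max_of_lt_left (by rw [(hS.1 hp).1]; exact one_pos)
      · rw [bil_comm 1 p (inwardNormal 1 S y)]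
        exact lt_max_of_lt_right (bil_inwardNormal_pos hκ hS hconv hy hp hpy))
  have hev : ∀ᶠ s in 𝓝 (0 : ℝ), Real.sin s < ε * Real.cos s :=
    (Real.continuous_sin.tendsto' 0 0 Real.sin_zero).eventually_lt
      ((Real.continuous_cos.const_mul ε).tendsto' 0 ε (by simp)) hε
  filter_upwards [hev.filter_mono nhdsWithin_le_nhds, self_mem_nhdsWithin,
    eventually_lt_nhdsWithin_Ioi (by norm_num : (0 : ℝ) < 3)] with s hs hs0 hs3 y hy hyT
  have hsin : 0 < Real.sin s := by simpa using sK_pos hκ hs0 hs3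
  obtain ⟨hxy, hxn⟩ := (mem_tangentPlane_iff hκ hS hconv hy).1 hyT
  have hcos : 0 < Real.cos s := (pos_iff_pos_of_mul_pos (hsin.trans hs)).1 hε
  have hyn := bil_one_le (hS.1 hy).1 (hin hp).2.1
  have hnn := bil_one_le (hin hy).2.1 (hin hp).2.1
  simp only [geod, cK_one, sK_one, bil_add_right, bil_smul_right, bil_neg_right,
    bil_comm 1 _ p] at hxy hxn
  rcases le_max_iff.1 (hεS y hy) with h | h <;> nlinarith

theorem exists_hasVelocity_neg_inwardNormal (hκ : κ = 1 ∨ κ = -1) (hS : IsCompactSurface κ S)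
    (hconv : StrictlyConvex κ S) (hu : u ∈ unitTangentSurface κ S) :
    ∃ c : ℝ → OrientedGeodesic κ, HasVelocity c 0 u (jacobi κ (-inwardNormal κ S u.1.1) 0) ∧
      ∀ᶠ s in 𝓝[>] (0 : ℝ), c s ∈ billiardTable κ S := by
  have F := isFrame_rotated hκ hS hconv hu
  have hmem : ∀ s, (jacobi κ u.1.1 (-inwardNormal κ S u.1.1) s, u.1.2) ∈ unitTangentBundle κ :=
    fun s => ⟨geod_mem_spaceForm hκ u.2.1 (by simp [F.pn]) (by simp [F.nn]) s,
      by simp [jacobi, geod, F.pv, F.nv], F.vv⟩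
  let φ : ℝ → unitTangentBundle κ := fun s => ⟨_, hmem s⟩
  have hφ0 : φ 0 = u := Subtype.ext (by simp [φ])
  have hA : HasDerivAt (fun s => (φ s).1.1) (-inwardNormal κ S u.1.1) 0 :=
    (hasDerivAt_jacobi hκ _ _ 0).congr_deriv (by simp)
  have hB : HasDerivAt (fun s => (φ s).1.2) 0 0 := hasDerivAt_const _ _
  refine ⟨fun s => toGeodesic (φ s), ⟨φ, Eventually.of_forall fun s =>
    ((contDiff_jacobi κ _ _).prodMk contDiff_const).contDiffAt, Eventually.of_forall fun _ => rfl,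
    hφ0, ?_⟩, ?_⟩
  · have hφv := normalPart_variationField hκ hA hB
    rw [hφ0] at hφv
    simpa [F.vn] using hφv.symm
  · have hgauss : ∀ᶠ s in 𝓝[>] (0 : ℝ), κ = 1 → ∀ y ∈ S, (φ s).1.1 ∉ tangentPlane S y := by
      rcases hκ with rfl | rfl
      · exact (eventually_geod_notMem_tangentPlane hS hconv hu.1).mono fun _ hs _ => hs
      · exact Eventually.of_forall fun _ h => absurd h (by norm_num)
    filter_upwards [eventually_forall_geod_notMem hκ hS hconv hu.1 F, hgauss] with s hmiss hs
    exact ⟨φ s, rfl, hmiss, fun h1 ⟨y, hy, hyT⟩ => hs h1 y hy (by simpa using hyT 0)⟩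

theorem exists_eq_jacobi_smul_of_orthogonal (hκ : κ = 1 ∨ κ = -1) (hS : IsCompactSurface κ S)
    (hconv : StrictlyConvex κ S) (hquad : QuadraticallyConvex κ S)
    (hu : u ∈ unitTangentSurface κ S) {ξ : ℝ → E4} (hξ : IsNormalJacobi κ u ξ)
    (hξM : ∀ K ∈ tangentSpaceM S u, gK u ξ K = 0) :
    ∃ a : ℝ, ξ = jacobi κ (a • inwardNormal κ S u.1.1) 0 := by
  have F := isFrame_rotated hκ hS hconv hu
  obtain ⟨A, hA, B, hB, rfl⟩ := hξ.exists_eq_jacobi hκ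
  have horth : ∀ A' ∈ normalSpace κ u, ∀ B' ∈ normalSpace κ u,
      bil κ (inwardNormal κ S u.1.1) A' = 0 → bil κ A A' + κ * bil κ B B' = 0 := by
    intro A' hA' B' hB' hnA'
    rw [← gK_jacobi hκ hB.1 hB'.1]
    exact hξM _ (jacobi_mem_tangentSpaceM hκ hS hconv hquad hu hA' hB' hnA')
  have h0 : (0 : E4) ∈ normalSpace κ u := ⟨bil_zero_right _ _, bil_zero_right _ _⟩
  have hn : inwardNormal κ S u.1.1 ∈ normalSpace κ u := ⟨F.pn, F.vn⟩
  have hw : (rotated S u).2 ∈ normalSpace κ u := ⟨F.pw, F.vw⟩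
  have hwA := horth _ hw 0 h0 F.nw
  have hwB := horth 0 h0 _ hw (bil_zero_right _ _)
  have hnB := horth 0 h0 _ hn (bil_zero_right _ _)
  simp only [bil_zero_right, mul_zero, add_zero, zero_add, mul_eq_zero, kappa_ne_zero hκ,
    false_or] at hwA hwB hnB
  refine ⟨bil κ (inwardNormal κ S u.1.1) A, (jacobi_inj hκ).2 ⟨?_, ?_⟩⟩
  · exact F.eq_smul hκ hA.1 hA.2 ((bil_comm _ _ _).trans hwA)
  · exact F.eq_zero hκ hB.1 ((bil_comm _ _ _).trans hnB) hB.2 ((bil_comm _ _ _).trans hwB)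

theorem isOutwardUnitNormal_iff (hκ : κ = 1 ∨ κ = -1) (hS : IsCompactSurface κ S)
    (hconv : StrictlyConvex κ S) (hquad : QuadraticallyConvex κ S)
    (hu : u ∈ unitTangentSurface κ S) {ξ : ℝ → E4} :
    IsOutwardUnitNormal S u ξ ↔ ξ = jacobi κ (-inwardNormal κ S u.1.1) 0 := by
  have F := isFrame_rotated hκ hS hconv hu
  constructor
  · rintro ⟨hξ, hunit, horth, c, hc, hc𝒰⟩
    obtain ⟨a, rfl⟩ := exists_eq_jacobi_smul_of_orthogonal hκ hS hconv hquad hu hξ horth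
    have ha : a * a = 1 := by
      simpa [gK_jacobi hκ (bil_zero_right _ _) (bil_zero_right _ _), F.nn] using hunit
    rcases mul_self_eq_one_iff.1 ha with rfl | rfl
    · rw [one_smul] at hc
      exact absurd hc𝒰 (not_eventually_mem_billiardTable hκ hS hconv hu hc)
    · rw [neg_one_smul]
  · rintro rfl
    refine ⟨isNormalJacobi_jacobi hκ ⟨by simp [F.pn], by simp [F.vn]⟩
      ⟨bil_zero_right _ _, bil_zero_right _ _⟩, ?_, fun K hK => ?_,
      exists_hasVelocity_neg_inwardNormal hκ hS hconv hu⟩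
    · simp [gK_jacobi hκ (bil_zero_right _ _) (bil_zero_right _ _), F.nn]
    · obtain ⟨hKJ, hnK⟩ := (mem_tangentSpaceM_iff hκ hS hconv hquad hu).1 hK
      obtain ⟨A, -, B, hB, rfl⟩ := hKJ.exists_eq_jacobi hκ
      rw [jacobi_zero] at hnK
      simp [gK_jacobi hκ (bil_zero_right _ _) hB.1, hnK]

end Outward

/-! ### Charts of the space of geodesics -/

section FrameCoordinates

variable {κ : ℝ} {p n v w : E4}

theorem IsFrame.reverse (F : IsFrame κ p n v w) : IsFrame κ p w v n :=
  ⟨F.pp, F.pw, F.pv, F.pn, F.ww, F.wv, F.wn, F.vv, F.vn, F.nn⟩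

theorem IsFrame.rotate (F : IsFrame κ p n v w) (hκ : κ = 1 ∨ κ = -1) (t : ℝ) :
    IsFrame κ (geod κ (p, w) t) n v (geodVel κ (p, w) t) := by
  have hk := kappa_sq hκ
  have hc := cK_sq_add hκ t
  constructor <;> simp only [geod, geodVel, bil_add_left, bil_add_right, bil_smul_left,
    bil_smul_right, F.pp, F.pn, F.pv, F.pw, F.nn, F.nv, F.nw, F.vv, F.vw, F.ww, F.np, F.vp, F.wp,
    F.wn, F.wv]
  · linear_combination κ * hc - sK κ t ^ 2 * hk
  · ring
  · ring
  · linear_combination -cK κ t * sK κ t * hk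
  · ring
  · ring
  · linear_combination hc + κ * sK κ t ^ 2 * hk

/-- The vector with coordinates `x` in the basis `(p, n, v, w)`. -/
def ofCoord (p n v w x : E4) : E4 := x 0 • p + x 1 • n + x 2 • v + x 3 • w

theorem IsFrame.bil_ofCoord (F : IsFrame κ p n v w) (x y : E4) :
    bil κ (ofCoord p n v w x) (ofCoord p n v w y) = bil κ x y := by
  simp only [ofCoord, bil_add_left, bil_add_right, bil_smul_left,
    bil_smul_right, F.pp, F.pn, F.pv, F.pw, F.nn, F.nv, F.nw, F.vv, F.vw, F.ww, F.np, F.vp, F.wp,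
    F.vn, F.wn, F.wv]
  simp only [bil]
  ring

theorem IsFrame.ofCoord_injective (F : IsFrame κ p n v w) (hκ : κ = 1 ∨ κ = -1) :
    Function.Injective (ofCoord p n v w) := by
  intro x y hxy
  have h (z : E4) : bil κ x z = bil κ y z := by rw [← F.bil_ofCoord, hxy, F.bil_ofCoord]
  funext i
  fin_cases i
  · simpa [bil, kappa_ne_zero hκ] using h ![1, 0, 0, 0]
  · simpa [bil] using h ![0, 1, 0, 0]
  · simpa [bil] using h ![0, 0, 1, 0]
  · simpa [bil] using h ![0, 0, 0, 1]

end FrameCoordinates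

/-- Foot points of the chart: starting on the geodesic `γ` through `p` with velocity `w` at time
`y 0`, move for the time `y 1` along the geodesic in the direction of `n`, which is parallel
along `γ`. -/
noncomputable def chartFoot (κ : ℝ) (p n w : E4) (y : Fin 4 → ℝ) : E4 :=
  geod κ (geod κ (p, w) (y 0), n) (y 1)

/-- The velocity of `chartFoot` in the variable `y 1`. -/
noncomputable def chartNormal (κ : ℝ) (p n w : E4) (y : Fin 4 → ℝ) : E4 :=
  geodVel κ (geod κ (p, w) (y 0), n) (y 1)

/-- The unit vector in the direction of the velocity of `chartFoot` in the variable `y 0`. -/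
noncomputable def chartTangent (κ : ℝ) (p w : E4) (y : Fin 4 → ℝ) : E4 := geodVel κ (p, w) (y 0)

/-- The vector with coordinates `x` in the frame `(chartFoot, chartNormal, v, chartTangent)`, which
moves with the foot point of the chart. -/
noncomputable def ofChartCoord (κ : ℝ) (p n v w : E4) (y : Fin 4 → ℝ) (x : E4) : E4 :=
  ofCoord (chartFoot κ p n w y) (chartNormal κ p n w y) v (chartTangent κ p w y) x

/-- Spherical coordinates around `v`, in the moving frame, on the unit sphere of directions. -/
noncomputable def dirCoord (y : Fin 4 → ℝ) : E4 :=
  ![0, Real.cos (y 3) * Real.sin (y 2), Real.cos (y 3) * Real.cos (y 2), Real.sin (y 3)]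

/-- Moving frame coordinates of the derivative of the foot point of the chart. -/
noncomputable def footVel (κ : ℝ) (y h : Fin 4 → ℝ) : E4 := ![0, h 1, 0, cK κ (y 1) * h 0]

/-- Moving frame coordinates of the derivative of the direction of the chart. -/
noncomputable def dirVel (κ : ℝ) (y h : Fin 4 → ℝ) : E4 :=
  ![-κ * (Real.cos (y 3) * Real.sin (y 2) * h 1 + Real.sin (y 3) * cK κ (y 1) * h 0),
    -(Real.sin (y 3) * Real.sin (y 2) * h 3) + Real.cos (y 3) * Real.cos (y 2) * h 2
      + κ * Real.sin (y 3) * sK κ (y 1) * h 0,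
    -(Real.sin (y 3) * Real.cos (y 2) * h 3) - Real.cos (y 3) * Real.sin (y 2) * h 2,
    Real.cos (y 3) * h 3 - κ * Real.cos (y 3) * Real.sin (y 2) * sK κ (y 1) * h 0]

section Chart

variable {κ : ℝ} {p n v w : E4}

theorem IsFrame.chart (F : IsFrame κ p n v w) (hκ : κ = 1 ∨ κ = -1) (y : Fin 4 → ℝ) :
    IsFrame κ (chartFoot κ p n w y) (chartNormal κ p n w y) v (chartTangent κ p w y) :=
  ((F.rotate hκ (y 0)).reverse.rotate hκ (y 1)).reverse

theorem bil_dirCoord_self (κ : ℝ) (y : Fin 4 → ℝ) : bil κ (dirCoord y) (dirCoord y) = 1 := by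
  simp only [bil, dirCoord, Matrix.cons_val]
  linear_combination Real.cos (y 3) ^ 2 * Real.sin_sq_add_cos_sq (y 2)
    + Real.sin_sq_add_cos_sq (y 3)

theorem bil_ofChartCoord (hκ : κ = 1 ∨ κ = -1) (F : IsFrame κ p n v w) (y : Fin 4 → ℝ)
    (x x' : E4) :
    bil κ (ofChartCoord κ p n v w y x) (ofChartCoord κ p n v w y x') = bil κ x x' :=
  (F.chart hκ y).bil_ofCoord x x'

theorem bil_chartFoot_ofChartCoord (hκ : κ = 1 ∨ κ = -1) (F : IsFrame κ p n v w) (y : Fin 4 → ℝ)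
    (x : E4) : bil κ (chartFoot κ p n w y) (ofChartCoord κ p n v w y x) = κ * x 0 := by
  have G := F.chart hκ y
  simp [ofChartCoord, ofCoord, G.pp, G.pn, G.pv, G.pw, mul_comm]

theorem bil_ofChartCoord_of_fixed (hκ : κ = 1 ∨ κ = -1) (F : IsFrame κ p n v w) (y : Fin 4 → ℝ)
    (x : E4) : bil κ v (ofChartCoord κ p n v w y x) = x 2 := by
  have G := F.chart hκ y
  simp [ofChartCoord, ofCoord, G.vp, G.vn, G.vv, G.vw]

/-- A chart of the space of geodesics around the geodesics with velocity `v` at the points of the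
geodesic `γ` through `p` with velocity `w`; its first coordinate is translation along `γ`. -/
noncomputable def chart (hκ : κ = 1 ∨ κ = -1) (hp : p ∈ spaceForm κ) (F : IsFrame κ p n v w)
    (y : Fin 4 → ℝ) : unitTangentBundle κ :=
  ⟨(chartFoot κ p n w y, ofChartCoord κ p n v w y (dirCoord y)),
    geod_mem_spaceForm hκ (geod_mem_spaceForm hκ hp F.pw F.ww (y 0)) (F.rotate hκ (y 0)).pn F.nn
      (y 1),
    by simp [bil_chartFoot_ofChartCoord hκ F, dirCoord],
    by simp only [bil_ofChartCoord hκ F, bil_dirCoord_self]⟩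

theorem contDiff_chart (hκ : κ = 1 ∨ κ = -1) (hp : p ∈ spaceForm κ) (F : IsFrame κ p n v w) :
    ContDiff ℝ ∞ (fun y => (chart hκ hp F y : E4 × E4)) := by
  have hy (i : Fin 4) : ContDiff ℝ ∞ (fun y : Fin 4 → ℝ => y i) := contDiff_apply ℝ ℝ i
  have hc (i : Fin 4) : ContDiff ℝ ∞ (fun y : Fin 4 → ℝ => cK κ (y i)) :=
    (contDiff_cK κ).comp (hy i)
  have hs (i : Fin 4) : ContDiff ℝ ∞ (fun y : Fin 4 → ℝ => sK κ (y i)) :=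
    (contDiff_sK κ).comp (hy i)
  simp only [chart, chartFoot, ofChartCoord, ofCoord, chartNormal, chartTangent, dirCoord, geod,
    geodVel, Matrix.cons_val]
  fun_prop

end Chart

section ChartDerivatives

variable {κ : ℝ} {p n v w : E4}

theorem hasDerivAt_comp_line {E : Type*} [NormedAddCommGroup E] [NormedSpace ℝ E] {g : ℝ → E}
    {g' : E} {y : Fin 4 → ℝ} {i : Fin 4} (hg : HasDerivAt g g' (y i)) (h : Fin 4 → ℝ) :
    HasDerivAt (fun s : ℝ => g ((y + s • h) i)) (h i • g') 0 := by
  have hline : HasDerivAt (fun s : ℝ => (y + s • h) i) (h i) 0 := by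
    simpa using ((hasDerivAt_id (0 : ℝ)).mul_const (h i)).const_add (y i)
  have hg0 : HasDerivAt g g' ((y + (0 : ℝ) • h) i) := by simpa using hg
  exact hg0.scomp (0 : ℝ) hline

theorem geod_eq_smul_chartFoot_sub (hκ : κ = 1 ∨ κ = -1) (y : Fin 4 → ℝ) :
    geod κ (p, w) (y 0) =
      cK κ (y 1) • chartFoot κ p n w y - sK κ (y 1) • chartNormal κ p n w y := by
  rw [chartFoot, chartNormal]
  generalize geod κ (p, w) (y 0) = x
  simp only [geod, geodVel]
  linear_combination (norm := module) -(cK_sq_add hκ (y 1) • x)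

theorem hasDerivAt_chartFoot (hκ : κ = 1 ∨ κ = -1) (y h : Fin 4 → ℝ) :
    HasDerivAt (fun s : ℝ => chartFoot κ p n w (y + s • h))
      (h 1 • chartNormal κ p n w y + (cK κ (y 1) * h 0) • chartTangent κ p w y) 0 := by
  have hP := hasDerivAt_comp_line (hasDerivAt_geod hκ (p, w) (y 0)) h
  have hc := hasDerivAt_comp_line (hasDerivAt_cK hκ (y 1)) h
  have hs := hasDerivAt_comp_line (hasDerivAt_sK hκ (y 1)) h
  refine ((hc.fun_smul hP).fun_add (hs.smul_const n)).congr_deriv ?_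
  simp only [zero_smul, add_zero, chartNormal, chartTangent, geodVel, smul_eq_mul]
  module

theorem hasDerivAt_chartNormal (hκ : κ = 1 ∨ κ = -1) (y h : Fin 4 → ℝ) :
    HasDerivAt (fun s : ℝ => chartNormal κ p n w (y + s • h))
      (-(κ * h 1) • chartFoot κ p n w y - (κ * sK κ (y 1) * h 0) • chartTangent κ p w y) 0 := by
  have hP := hasDerivAt_comp_line (hasDerivAt_geod hκ (p, w) (y 0)) h
  have hc := hasDerivAt_comp_line (hasDerivAt_cK hκ (y 1)) h
  have hs := hasDerivAt_comp_line (hasDerivAt_sK hκ (y 1)) h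
  refine (((hs.const_mul κ).fun_neg.fun_smul hP).fun_add (hc.smul_const n)).congr_deriv ?_
  simp only [zero_smul, add_zero, chartFoot, chartTangent, geod, geodVel, smul_eq_mul]
  module

theorem hasDerivAt_chartTangent (hκ : κ = 1 ∨ κ = -1) (y h : Fin 4 → ℝ) :
    HasDerivAt (fun s : ℝ => chartTangent κ p w (y + s • h))
      (-(κ * cK κ (y 1) * h 0) • chartFoot κ p n w y
        + (κ * sK κ (y 1) * h 0) • chartNormal κ p n w y) 0 := by
  refine (hasDerivAt_comp_line (hasDerivAt_geodVel hκ (p, w) (y 0)) h).congr_deriv ?_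
  rw [geod_eq_smul_chartFoot_sub (n := n) hκ]
  module

theorem hasDerivAt_fst_chart (hκ : κ = 1 ∨ κ = -1) (hp : p ∈ spaceForm κ)
    (F : IsFrame κ p n v w) (y h : Fin 4 → ℝ) :
    HasDerivAt (fun s : ℝ => (chart hκ hp F (y + s • h)).1.1)
      (ofChartCoord κ p n v w y (footVel κ y h)) 0 :=
  (hasDerivAt_chartFoot hκ y h).congr_deriv (by simp [ofChartCoord, ofCoord, footVel])

theorem hasDerivAt_snd_chart (hκ : κ = 1 ∨ κ = -1) (hp : p ∈ spaceForm κ)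
    (F : IsFrame κ p n v w) (y h : Fin 4 → ℝ) :
    HasDerivAt (fun s : ℝ => (chart hκ hp F (y + s • h)).1.2)
      (ofChartCoord κ p n v w y (dirVel κ y h)) 0 := by
  have hN := hasDerivAt_chartNormal (p := p) (n := n) (w := w) hκ y h
  have hT := hasDerivAt_chartTangent (p := p) (n := n) (w := w) hκ y h
  have hcos (i : Fin 4) := hasDerivAt_comp_line (Real.hasDerivAt_cos (y i)) h
  have hsin (i : Fin 4) := hasDerivAt_comp_line (Real.hasDerivAt_sin (y i)) h
  have hdir := ((((hcos 3).fun_mul (hsin 2)).fun_smul hN).fun_add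
    (((hcos 3).fun_mul (hcos 2)).smul_const v)).fun_add ((hsin 3).fun_smul hT)
  refine (hdir.congr_deriv ?_).congr_of_eventuallyEq (.of_forall fun s => ?_)
  · simp only [zero_smul, add_zero, ofChartCoord, ofCoord, dirVel, Matrix.cons_val, smul_eq_mul]
    module
  · simp only [chart, ofChartCoord, ofCoord, dirCoord, Matrix.cons_val, zero_smul, zero_add]

end ChartDerivatives

section ChartMetric

variable {κ : ℝ}

theorem paramDeriv_eq_jacobi (hκ : κ = 1 ∨ κ = -1) {φ : (Fin 4 → ℝ) → unitTangentBundle κ}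
    {y h : Fin 4 → ℝ} {A B : E4} (hA : HasDerivAt (fun s : ℝ => (φ (y + s • h)).1.1) A 0)
    (hB : HasDerivAt (fun s : ℝ => (φ (y + s • h)).1.2) B 0) :
    paramDeriv φ y h = jacobi κ (A - bil κ (φ y).1.2 A • (φ y).1.2)
      (B + (κ * bil κ (φ y).1.2 A) • (φ y).1.1) := by
  have hy : y + (0 : ℝ) • h = y := by simp
  have hpart := normalPart_variationField (φ := fun s : ℝ => φ (y + s • h)) hκ hA hB
  rwa [hy] at hpart

theorem gK_paramDeriv (hκ : κ = 1 ∨ κ = -1) {φ : (Fin 4 → ℝ) → unitTangentBundle κ}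
    {y h k : Fin 4 → ℝ} {A B A' B' : E4}
    (hA : HasDerivAt (fun s : ℝ => (φ (y + s • h)).1.1) A 0)
    (hB : HasDerivAt (fun s : ℝ => (φ (y + s • h)).1.2) B 0)
    (hA' : HasDerivAt (fun s : ℝ => (φ (y + s • k)).1.1) A' 0)
    (hB' : HasDerivAt (fun s : ℝ => (φ (y + s • k)).1.2) B' 0) :
    gK (φ y) (paramDeriv φ y h) (paramDeriv φ y k) =
      bil κ A A' + κ * bil κ B B' - 2 * (bil κ (φ y).1.2 A * bil κ (φ y).1.2 A') := by
  have hk := kappa_sq hκ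
  have hB0 := bil_fst_deriv_snd_add (φ := fun s : ℝ => φ (y + s • h)) hA hB
  have hB0' := bil_fst_deriv_snd_add (φ := fun s : ℝ => φ (y + s • k)) hA' hB'
  simp only [zero_smul, add_zero] at hB0 hB0'
  have hxx : bil κ (φ y).1.1 (φ y).1.1 = κ := (φ y).2.1.1
  have hdd : bil κ (φ y).1.2 (φ y).1.2 = 1 := (φ y).2.2.2
  have horth {A B : E4} (h : bil κ (φ y).1.1 B + bil κ (φ y).1.2 A = 0) :
      bil κ (φ y).1.1 (B + (κ * bil κ (φ y).1.2 A) • (φ y).1.1) = 0 := by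
    rw [bil_add_right, bil_smul_right, hxx]
    linear_combination h + bil κ (φ y).1.2 A * hk
  rw [paramDeriv_eq_jacobi hκ hA hB, paramDeriv_eq_jacobi hκ hA' hB',
    gK_jacobi hκ (horth hB0) (horth hB0'), bil_add_left, bil_smul_left, horth hB0']
  simp only [bil_add_right, bil_sub_left, bil_sub_right, bil_smul_left, bil_smul_right, hdd,
    bil_comm κ B (φ y).1.1, bil_comm κ A (φ y).1.2]
  linear_combination κ * κ * bil κ (φ y).1.2 A' * hB0
    - bil κ (φ y).1.2 A' * bil κ (φ y).1.2 A * hk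

/-- The metric `g_K` in the coordinates of `chart`, see `gK_chart`. -/
noncomputable def chartMetric (κ : ℝ) (y h k : Fin 4 → ℝ) : ℝ :=
  bil κ (footVel κ y h) (footVel κ y k) + κ * bil κ (dirVel κ y h) (dirVel κ y k)
    - 2 * (bil κ (dirCoord y) (footVel κ y h) * bil κ (dirCoord y) (footVel κ y k))

variable {p n v w : E4}

theorem gK_chart (hκ : κ = 1 ∨ κ = -1) (hp : p ∈ spaceForm κ) (F : IsFrame κ p n v w)
    (y h k : Fin 4 → ℝ) :
    gK (chart hκ hp F y) (paramDeriv (chart hκ hp F) y h) (paramDeriv (chart hκ hp F) y k) =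
      chartMetric κ y h k := by
  rw [gK_paramDeriv hκ (hasDerivAt_fst_chart hκ hp F y h) (hasDerivAt_snd_chart hκ hp F y h)
    (hasDerivAt_fst_chart hκ hp F y k) (hasDerivAt_snd_chart hκ hp F y k)]
  simp only [chart, bil_ofChartCoord hκ F, chartMetric]

theorem differentiable_chartMetric (κ : ℝ) (h k : Fin 4 → ℝ) :
    Differentiable ℝ (fun y => chartMetric κ y h k) := by
  have hc : Differentiable ℝ (fun y : Fin 4 → ℝ => cK κ (y 1)) :=
    ((contDiff_cK κ).differentiable (by simp)).comp (differentiable_apply 1)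
  have hs : Differentiable ℝ (fun y : Fin 4 → ℝ => sK κ (y 1)) :=
    ((contDiff_sK κ).differentiable (by simp)).comp (differentiable_apply 1)
  simp only [chartMetric, footVel, dirVel, dirCoord, bil, Matrix.cons_val]
  fun_prop

theorem chartMetric_add_single_zero (κ : ℝ) (y h k : Fin 4 → ℝ) (s : ℝ) :
    chartMetric κ (y + s • Pi.single 0 1) h k = chartMetric κ y h k := by
  simp [chartMetric, footVel, dirVel, dirCoord]

theorem chartMetric_single_zero (hκ : κ = 1 ∨ κ = -1) (y : Fin 4 → ℝ) :
    chartMetric κ y (Pi.single 0 1) (Pi.single 0 1) =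
      1 - Real.sin (y 3) ^ 2 + κ * sK κ (y 1) ^ 2 *
        (2 * Real.sin (y 3) ^ 2 + (Real.cos (y 3) * Real.sin (y 2)) ^ 2 - 1) := by
  have hk := kappa_sq hκ
  have hc := cK_sq_add hκ (y 1)
  simp only [chartMetric, footVel, dirVel, dirCoord, bil, Matrix.cons_val, Pi.single_apply,
    Fin.reduceEq, if_true, if_false]
  linear_combination (1 - Real.sin (y 3) ^ 2) * hc +
    ((κ * κ + 1) * (Real.sin (y 3) * cK κ (y 1)) ^ 2 + κ * sK κ (y 1) ^ 2 *
      (Real.sin (y 3) ^ 2 + (Real.cos (y 3) * Real.sin (y 2)) ^ 2)) * hk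

theorem hasDerivAt_chartMetric_axis (hκ : κ = 1 ∨ κ = -1) (t : ℝ) (h : Fin 4 → ℝ) :
    HasDerivAt (fun s : ℝ => chartMetric κ (Pi.single 0 t + s • h) (Pi.single 0 1) (Pi.single 0 1))
      0 0 := by
  simp only [chartMetric_single_zero hκ]
  have hs := hasDerivAt_comp_line (hasDerivAt_sK hκ ((Pi.single 0 t : Fin 4 → ℝ) 1)) h
  have hsin (i : Fin 4) :=
    hasDerivAt_comp_line (Real.hasDerivAt_sin ((Pi.single 0 t : Fin 4 → ℝ) i)) h
  have hcos := hasDerivAt_comp_line (Real.hasDerivAt_cos ((Pi.single 0 t : Fin 4 → ℝ) 3)) h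
  refine ((((hsin 3).fun_pow 2).const_sub 1).fun_add (((hs.fun_pow 2).const_mul κ).fun_mul
    ((((hsin 3).fun_pow 2).const_mul 2).fun_add ((hcos.fun_mul (hsin 2)).fun_pow 2)
      |>.sub_const 1))).congr_deriv ?_
  simp

theorem metricPartial_chart (hκ : κ = 1 ∨ κ = -1) (hp : p ∈ spaceForm κ)
    (F : IsFrame κ p n v w) (y : Fin 4 → ℝ) (m i j : Fin 4) :
    metricPartial (chart hκ hp F) y m i j = deriv (fun s : ℝ =>
      chartMetric κ (y + s • Pi.single m 1) (Pi.single i 1) (Pi.single j 1)) 0 := by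
  simp only [metricPartial, metricMatrix, Matrix.of_apply, gK_chart]
  exact ((differentiable_chartMetric κ _ _ y).lineDeriv_eq_fderiv).symm

theorem metricPartial_chart_zero (hκ : κ = 1 ∨ κ = -1) (hp : p ∈ spaceForm κ)
    (F : IsFrame κ p n v w) (y : Fin 4 → ℝ) (i j : Fin 4) :
    metricPartial (chart hκ hp F) y 0 i j = 0 := by
  simp only [metricPartial_chart, chartMetric_add_single_zero, deriv_const]

theorem metricPartial_chart_axis (hκ : κ = 1 ∨ κ = -1) (hp : p ∈ spaceForm κ)
    (F : IsFrame κ p n v w) (t : ℝ) (m : Fin 4) :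
    metricPartial (chart hκ hp F) (Pi.single 0 t) m 0 0 = 0 :=
  (metricPartial_chart hκ hp F _ m 0 0).trans (hasDerivAt_chartMetric_axis hκ t _).deriv

theorem christoffel_chart_axis (hκ : κ = 1 ∨ κ = -1) (hp : p ∈ spaceForm κ)
    (F : IsFrame κ p n v w) (t : ℝ) (k : Fin 4) :
    christoffel (chart hκ hp F) (Pi.single 0 t) k 0 0 = 0 := by
  simp [christoffel, metricPartial_chart_zero, metricPartial_chart_axis]

end ChartMetric

section ChartInjectivity

variable {κ : ℝ}

theorem exists_eq_geod_of_toGeodesic_eq (hκ : κ = 1 ∨ κ = -1) {q q' : unitTangentBundle κ}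
    (h : toGeodesic q = toGeodesic q') :
    ∃ τ, q'.1.1 = geod κ q τ ∧ q'.1.2 = geodVel κ q τ := by
  obtain ⟨τ, hτ⟩ := Quotient.exact h
  have hvel := hasDerivAt_geod hκ (q' : E4 × E4) 0
  rw [funext hτ] at hvel
  refine ⟨τ, by simpa using hτ 0, ?_⟩
  simpa using hvel.unique ((hasDerivAt_geod hκ (q : E4 × E4) (0 + τ)).comp_add_const 0 τ)

/-- Both unit vectors are positive crossings of the totally geodesic surface orthogonal to `v`, and
a geodesic crosses it positively only once up to the period. -/
theorem eq_of_toGeodesic_eq_of_bil (hκ : κ = 1 ∨ κ = -1) {q q' : unitTangentBundle κ} {v : E4}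
    (hq : bil κ v q.1.1 = 0) (hq' : bil κ v q'.1.1 = 0) (hpos : 0 < bil κ v q.1.2)
    (hpos' : 0 < bil κ v q'.1.2) (h : toGeodesic q = toGeodesic q') : q = q' := by
  obtain ⟨τ, hfoot, hdir⟩ := exists_eq_geod_of_toGeodesic_eq hκ h
  have hs : sK κ τ = 0 := by
    rw [hfoot, geod, bil_add_right, bil_smul_right, bil_smul_right, hq, mul_zero, zero_add] at hq'
    exact (mul_eq_zero.1 hq').resolve_right hpos.ne'
  have hc : cK κ τ = 1 := by
    have hsq := cK_sq_add hκ τ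
    rw [hdir, geodVel, bil_add_right, bil_smul_right, bil_smul_right, hq, mul_zero,
      zero_add] at hpos'
    have hcpos := pos_of_mul_pos_left hpos' hpos.le
    rw [hs] at hsq
    nlinarith
  refine Subtype.ext (Prod.ext ?_ ?_)
  · simp [hfoot, geod, hs, hc]
  · simp [hdir, geodVel, hs, hc]

theorem cK_pos (hκ : κ = 1 ∨ κ = -1) {r : ℝ} (hr : |r| < 1) : 0 < cK κ r := by
  rcases hκ with rfl | rfl
  · rw [cK_one]
    exact Real.cos_pos_of_le_one hr.le
  · rw [cK_neg_one]
    exact Real.cosh_pos r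

theorem sK_sub (hκ : κ = 1 ∨ κ = -1) (s t : ℝ) :
    sK κ (s - t) = sK κ s * cK κ t - cK κ s * sK κ t := by
  rcases hκ with rfl | rfl
  · simp only [sK_one, cK_one, Real.sin_sub]
  · simp only [sK_neg_one, cK_neg_one, Real.sinh_sub]

theorem eq_of_cK_eq_of_sK_eq (hκ : κ = 1 ∨ κ = -1) {s t : ℝ} (hc : cK κ s = cK κ t)
    (hs : sK κ s = sK κ t) (hst : |s - t| < 3) : s = t := by
  rw [abs_lt] at hst
  rcases lt_trichotomy s t with hlt | heq | hlt
  · have hpos := sK_pos hκ (sub_pos.2 hlt) (by linarith)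
    rw [sK_sub hκ, hc, hs] at hpos
    linarith
  · exact heq
  · have hpos := sK_pos hκ (sub_pos.2 hlt) hst.2
    rw [sK_sub hκ, hc, hs] at hpos
    linarith

theorem eq_of_sin_eq_sin {a b : ℝ} (ha : |a| < 1) (hb : |b| < 1)
    (h : Real.sin a = Real.sin b) : a = b := by
  rw [abs_lt] at ha hb
  have hπ := Real.pi_gt_three
  exact Real.injOn_sin ⟨by linarith, by linarith⟩ ⟨by linarith, by linarith⟩ h

variable {p n v w : E4}

/-- The domain of the chart around the point of its axis with parameter `t₀`. -/
def chartDomain (t₀ : ℝ) : Set (Fin 4 → ℝ) :=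
  {y | |y 0 - t₀| < 1 ∧ |y 1| < 1 ∧ |y 2| < 1 ∧ |y 3| < 1}

theorem isOpen_chartDomain (t₀ : ℝ) : IsOpen (chartDomain t₀) := by
  have hc (i : Fin 4) : Continuous (fun y : Fin 4 → ℝ => y i) := continuous_apply i
  exact (isOpen_lt ((hc 0).sub continuous_const).abs continuous_const).inter
    ((isOpen_lt (hc 1).abs continuous_const).inter
      ((isOpen_lt (hc 2).abs continuous_const).inter (isOpen_lt (hc 3).abs continuous_const)))

theorem chartFoot_inj (hκ : κ = 1 ∨ κ = -1) (F : IsFrame κ p n v w) {x y : Fin 4 → ℝ}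
    (h0 : |x 0 - y 0| < 3) (hx : |x 1| < 1) (hy : |y 1| < 1)
    (h : chartFoot κ p n w x = chartFoot κ p n w y) : x 0 = y 0 ∧ x 1 = y 1 := by
  have hs1 : sK κ (x 1) = sK κ (y 1) := by
    simpa [chartFoot, geod, F.np, F.nw, F.nn] using congrArg (bil κ n) h
  have hcx := cK_pos hκ hx
  have hcy := cK_pos hκ hy
  have hc1 : cK κ (x 1) = cK κ (y 1) := by
    have hsqx := cK_sq_add hκ (x 1)
    have hsqy := cK_sq_add hκ (y 1)
    rw [hs1] at hsqx
    nlinarith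
  have hc0 : cK κ (x 0) = cK κ (y 0) := by
    simpa [chartFoot, geod, F.pp, F.pw, F.pn, hc1, hcy.ne', kappa_ne_zero hκ]
      using congrArg (bil κ p) h
  have hs0 : sK κ (x 0) = sK κ (y 0) := by
    simpa [chartFoot, geod, F.wp, F.ww, F.wn, hc1, hcy.ne'] using congrArg (bil κ w) h
  refine ⟨eq_of_cK_eq_of_sK_eq hκ hc0 hs0 h0, eq_of_cK_eq_of_sK_eq hκ hc1 hs1 ?_⟩
  rw [abs_lt] at *
  constructor <;> linarith

theorem dirCoord_inj {x y : Fin 4 → ℝ} (hx2 : |x 2| < 1) (hy2 : |y 2| < 1) (hx3 : |x 3| < 1)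
    (hy3 : |y 3| < 1) (h : dirCoord x = dirCoord y) : x 2 = y 2 ∧ x 3 = y 3 := by
  have h3 : x 3 = y 3 := eq_of_sin_eq_sin hx3 hy3 (congrFun h 3)
  have h1 : Real.cos (x 3) * Real.sin (x 2) = Real.cos (y 3) * Real.sin (y 2) := congrFun h 1
  rw [h3] at h1
  exact ⟨eq_of_sin_eq_sin hx2 hy2 (mul_left_cancel₀ (Real.cos_pos_of_le_one hy3.le).ne' h1), h3⟩

theorem bil_snd_chart_pos (hκ : κ = 1 ∨ κ = -1) (hp : p ∈ spaceForm κ) (F : IsFrame κ p n v w)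
    {t₀ : ℝ} {y : Fin 4 → ℝ} (hy : y ∈ chartDomain t₀) :
    0 < bil κ v (chart hκ hp F y).1.2 := by
  rw [chart, bil_ofChartCoord_of_fixed hκ F]
  exact mul_pos (Real.cos_pos_of_le_one hy.2.2.2.le) (Real.cos_pos_of_le_one hy.2.2.1.le)

theorem injOn_toGeodesic_chart (hκ : κ = 1 ∨ κ = -1) (hp : p ∈ spaceForm κ)
    (F : IsFrame κ p n v w) (t₀ : ℝ) :
    InjOn (fun y => toGeodesic (chart hκ hp F y)) (chartDomain t₀) := by
  intro x hx y hy hxy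
  have hlift : chart hκ hp F x = chart hκ hp F y :=
    eq_of_toGeodesic_eq_of_bil hκ (F.chart hκ x).vp (F.chart hκ y).vp
      (bil_snd_chart_pos hκ hp F hx) (bil_snd_chart_pos hκ hp F hy) hxy
  have hdir := congrArg (fun q : unitTangentBundle κ => q.1.2) hlift
  obtain ⟨hx0, hx1, hx2, hx3⟩ := hx
  obtain ⟨hy0, hy1, hy2, hy3⟩ := hy
  have hxy0 : |x 0 - y 0| < 3 := by
    rw [abs_lt] at *
    constructor <;> linarith
  obtain ⟨h0, h1⟩ := chartFoot_inj hκ F hxy0 hx1 hy1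
    (congrArg (fun q : unitTangentBundle κ => q.1.1) hlift)
  simp only [chart, ofChartCoord, chartFoot, chartNormal, chartTangent, h0, h1] at hdir
  obtain ⟨h2, h3⟩ := dirCoord_inj hx2 hy2 hx3 hy3 ((F.chart hκ y).ofCoord_injective hκ hdir)
  funext i
  fin_cases i
  exacts [h0, h1, h2, h3]

theorem eq_zero_of_footVel_eq_zero (hκ : κ = 1 ∨ κ = -1) {t₀ : ℝ} {y h : Fin 4 → ℝ}
    (hy : y ∈ chartDomain t₀) (hfoot : footVel κ y h = 0) (hdir : dirVel κ y h = 0) : h = 0 := by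
  obtain ⟨-, hy1, hy2, hy3⟩ := hy
  have hc2 := (Real.cos_pos_of_le_one hy2.le).ne'
  have hc3 := (Real.cos_pos_of_le_one hy3.le).ne'
  have h1 : h 1 = 0 := congrFun hfoot 1
  have h0 : h 0 = 0 := (mul_eq_zero.1 (congrFun hfoot 3)).resolve_left (cK_pos hκ hy1).ne'
  have h3 : h 3 = 0 := by simpa [dirVel, h0, hc3] using congrFun hdir 3
  have h2 : h 2 = 0 := by simpa [dirVel, h0, h3, hc2, hc3] using congrFun hdir 1
  funext i
  fin_cases i
  exacts [h0, h1, h2, h3]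

theorem paramDeriv_chart_ne_zero (hκ : κ = 1 ∨ κ = -1) (hp : p ∈ spaceForm κ)
    (F : IsFrame κ p n v w) {t₀ : ℝ} {y : Fin 4 → ℝ} (hy : y ∈ chartDomain t₀) {h : Fin 4 → ℝ}
    (hh : h ≠ 0) : paramDeriv (chart hκ hp F) y h ≠ 0 := by
  intro hzero
  rw [paramDeriv_eq_jacobi hκ (hasDerivAt_fst_chart hκ hp F y h)
    (hasDerivAt_snd_chart hκ hp F y h)] at hzero
  have hjac : jacobi κ 0 0 = 0 := by funext r; simp [jacobi, geod]
  obtain ⟨hA, hB⟩ := (jacobi_inj hκ).1 (hzero.trans hjac.symm)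
  set A := ofChartCoord κ p n v w y (footVel κ y h)
  have hvA : bil κ v A = 0 := by simp [A, bil_ofChartCoord_of_fixed hκ F, footVel]
  have hm : bil κ (chart hκ hp F y).1.2 A = 0 := by
    have hv := congrArg (bil κ v) hA
    simpa [hvA, (bil_snd_chart_pos hκ hp F hy).ne'] using hv
  have hinj {x : E4} (hx : ofChartCoord κ p n v w y x = 0) : x = 0 :=
    (F.chart hκ y).ofCoord_injective hκ (hx.trans (by simp [ofCoord]))
  rw [hm] at hA hB
  refine hh (eq_zero_of_footVel_eq_zero hκ hy (hinj ?_) (hinj ?_))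
  · simpa using hA
  · simpa using hB

theorem isLocalParam_chart (hκ : κ = 1 ∨ κ = -1) (hp : p ∈ spaceForm κ)
    (F : IsFrame κ p n v w) (t₀ : ℝ) : IsLocalParam (chartDomain t₀) (chart hκ hp F) :=
  ⟨isOpen_chartDomain t₀, (contDiff_chart hκ hp F).contDiffOn, injOn_toGeodesic_chart hκ hp F t₀,
    fun _ hy _ hh => paramDeriv_chart_ne_zero hκ hp F hy hh⟩

end ChartInjectivity

section CoordinateLines

theorem isGeodesicGK_coordinate_line {κ : ℝ} {φ : (Fin 4 → ℝ) → unitTangentBundle κ} (i : Fin 4)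
    (hφ : ∀ t₀ : ℝ, ∃ Ω, IsLocalParam Ω φ ∧ Pi.single i t₀ ∈ Ω)
    (hΓ : ∀ t k, christoffel φ (Pi.single i t) k i i = 0) :
    IsGeodesicGK fun t => toGeodesic (φ (Pi.single i t)) := by
  have hline (t : ℝ) : HasDerivAt (fun t : ℝ => (Pi.single i t : Fin 4 → ℝ)) (Pi.single i 1) t :=
    (ContinuousLinearMap.single ℝ (fun _ : Fin 4 => ℝ) i).hasDerivAt
  have hsmooth : ContDiff ℝ ∞ (fun t : ℝ => (Pi.single i t : Fin 4 → ℝ)) :=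
    (ContinuousLinearMap.single ℝ (fun _ : Fin 4 => ℝ) i).contDiff
  have hderiv : deriv (fun t : ℝ => (Pi.single i t : Fin 4 → ℝ)) = fun _ => Pi.single i 1 :=
    funext fun t => (hline t).deriv
  intro t₀
  obtain ⟨Ω, hΩ, ht₀⟩ := hφ t₀
  refine ⟨Ω, φ, fun t => Pi.single i t, hΩ, ?_⟩
  filter_upwards [hsmooth.continuous.continuousAt.preimage_mem_nhds (hΩ.1.mem_nhds ht₀)] with t ht
  refine ⟨ht, hsmooth.contDiffAt, rfl, fun k => ?_⟩
  rw [hderiv, deriv_const]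
  simp [Pi.single_apply, hΓ]

theorem isGeodesicGK_chart_axis {κ : ℝ} (hκ : κ = 1 ∨ κ = -1) {p n v w : E4}
    (hp : p ∈ spaceForm κ) (F : IsFrame κ p n v w) :
    IsGeodesicGK fun t => toGeodesic (chart hκ hp F (Pi.single 0 t)) :=
  isGeodesicGK_coordinate_line 0
    (fun t₀ => ⟨chartDomain t₀, isLocalParam_chart hκ hp F t₀, by simp [chartDomain]⟩)
    (christoffel_chart_axis hκ hp F)

end CoordinateLines

/-! ### The outer billiard -/

theorem IsFrame.cross_eq_sub {κ : ℝ} (hκ : κ = 1 ∨ κ = -1) {p n v x : E4}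
    (F : IsFrame κ p n v (cross κ p n v)) (hpx : bil κ p x = 0) (hvx : bil κ v x = 0) :
    cross κ p v x = bil κ (cross κ p n v) x • n - bil κ n x • cross κ p n v := by
  have hw : cross κ p v (cross κ p n v) = n := by
    simp [cross_cross_of_orthogonal hκ F.pp F.pn F.pv, F.vv, F.nv]
  have hx := F.swap.eq_smul_add_smul hκ hpx hvx
  calc cross κ p v x
      = bil κ n x • cross κ p v n + bil κ (cross κ p n v) x • cross κ p v (cross κ p n v) := by
        rw [← cross_smul_right, ← cross_smul_right, ← cross_add_right, ← hx]
    _ = bil κ (cross κ p n v) x • n - bil κ n x • cross κ p n v := by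
        rw [hw, cross_swap κ p v n]
        module

section Billiard

variable {κ : ℝ} {S : Set E4} {u : unitTangentBundle κ}

theorem complexStructure_jacobi_neg_inwardNormal (hκ : κ = 1 ∨ κ = -1) (S : Set E4)
    (u : unitTangentBundle κ) :
    complexStructure u (jacobi κ (-inwardNormal κ S u.1.1) 0) = jacobi κ (rotated S u).2 0 := by
  have hzero : cross κ u.1.1 u.1.2 0 = 0 := by
    simpa using cross_smul_right κ 0 u.1.1 u.1.2 0
  rw [complexStructure_jacobi hκ, hzero, ← neg_one_smul ℝ, cross_smul_right, neg_one_smul,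
    ← cross_swap, rotated]

theorem transported_eq (hvw : bil κ u.1.2 (rotated S u).2 = 0) (t : ℝ) :
    transported S u t = (geod κ (rotated S u) t, u.1.2) := by
  rw [transported, parallelTransport, hvw, zero_smul, add_zero]

theorem transported_mem_unitTangentBundle
    (F : IsFrame κ u.1.1 (inwardNormal κ S u.1.1) u.1.2 (rotated S u).2)
    (hκ : κ = 1 ∨ κ = -1) (t : ℝ) :
    transported S u t ∈ unitTangentBundle κ := by
  rw [transported_eq F.vw]
  exact ⟨geod_mem_spaceForm hκ u.2.1 F.pw F.ww t, (F.rotate hκ t).pv, F.vv⟩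

theorem billiardF_eq (F : IsFrame κ u.1.1 (inwardNormal κ S u.1.1) u.1.2 (rotated S u).2)
    (hκ : κ = 1 ∨ κ = -1) (t : ℝ) :
    billiardF S u t = toGeodesic ⟨transported S u t, transported_mem_unitTangentBundle F hκ t⟩ :=
  dif_pos _

theorem isGeodesicGK_billiardF
    (F : IsFrame κ u.1.1 (inwardNormal κ S u.1.1) u.1.2 (rotated S u).2)
    (hκ : κ = 1 ∨ κ = -1) : IsGeodesicGK (billiardF S u) := by
  refine (funext fun t => ?_ : billiardF S u = _) ▸ isGeodesicGK_chart_axis hκ u.2.1 F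
  rw [billiardF_eq F hκ]
  refine congrArg toGeodesic (Subtype.ext ((transported_eq F.vw t).trans ?_))
  simp [chart, chartFoot, ofChartCoord, ofCoord, dirCoord, rotated]

theorem hasVelocity_billiardF
    (F : IsFrame κ u.1.1 (inwardNormal κ S u.1.1) u.1.2 (rotated S u).2)
    (hκ : κ = 1 ∨ κ = -1) :
    HasVelocity (billiardF S u) 0 u (jacobi κ (rotated S u).2 0) := by
  let φ (t : ℝ) : unitTangentBundle κ :=
    ⟨transported S u t, transported_mem_unitTangentBundle F hκ t⟩
  have hφ (t : ℝ) : (φ t : E4 × E4) = (geod κ (rotated S u) t, u.1.2) := transported_eq F.vw t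
  have hφ0 : φ 0 = u := Subtype.ext (by simp [hφ, rotated])
  have hfoot : HasDerivAt (fun s => (φ s).1.1) (rotated S u).2 0 := by
    simpa only [hφ, geodVel_zero] using hasDerivAt_geod hκ (rotated S u) 0
  have hdir : HasDerivAt (fun s => (φ s).1.2) 0 0 := by
    simpa only [hφ] using hasDerivAt_const (0 : ℝ) u.1.2
  refine ⟨φ, .of_forall fun s => ?_, .of_forall fun s => billiardF_eq F hκ s, hφ0, ?_⟩
  · simp only [hφ]
    exact ((contDiff_jacobi κ _ _).prodMk contDiff_const).contDiffAt
  · have hvel := normalPart_variationField hκ hfoot hdir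
    rw [hφ0] at hvel
    rw [hvel, F.vw]
    simp

theorem omegaK_jacobi (F : IsFrame κ u.1.1 (inwardNormal κ S u.1.1) u.1.2 (rotated S u).2)
    (hκ : κ = 1 ∨ κ = -1) {A B A' B' : E4} (hA : A ∈ normalSpace κ u)
    (hB : B ∈ normalSpace κ u) (hB' : B' ∈ normalSpace κ u) :
    omegaK u (jacobi κ A B) (jacobi κ A' B') =
      bil κ (rotated S u).2 A * bil κ (inwardNormal κ S u.1.1) A'
        - bil κ (inwardNormal κ S u.1.1) A * bil κ (rotated S u).2 A'
        + κ * (bil κ (rotated S u).2 B * bil κ (inwardNormal κ S u.1.1) B'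
          - bil κ (inwardNormal κ S u.1.1) B * bil κ (rotated S u).2 B') := by
  rw [omegaK, complexStructure_jacobi hκ,
    gK_jacobi hκ (bil_cross_self_left hκ u.1.1 u.1.2 B) hB'.1,
    IsFrame.cross_eq_sub hκ F hA.1 hA.2, IsFrame.cross_eq_sub hκ F hB.1 hB.2]
  simp only [bil_sub_left, bil_smul_left, rotated]

theorem characteristicLine_eq (hκ : κ = 1 ∨ κ = -1) (hS : IsCompactSurface κ S)
    (hconv : StrictlyConvex κ S) (hquad : QuadraticallyConvex κ S)
    (hu : u ∈ unitTangentSurface κ S) :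
    {X ∈ tangentSpaceM S u | ∀ Y ∈ tangentSpaceM S u, omegaK u X Y = 0} =
      {X | ∃ a : ℝ, X = a • jacobi κ (rotated S u).2 0} := by
  have F := isFrame_rotated hκ hS hconv hu
  have h0 : (0 : E4) ∈ normalSpace κ u := ⟨bil_zero_right _ _, bil_zero_right _ _⟩
  have hn : inwardNormal κ S u.1.1 ∈ normalSpace κ u := ⟨F.pn, F.vn⟩
  have hw : (rotated S u).2 ∈ normalSpace κ u := ⟨F.pw, F.vw⟩
  have hmem {A B : E4} := jacobi_mem_tangentSpaceM (A := A) (B := B) hκ hS hconv hquad hu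
  have hsmul (a : ℝ) : a • jacobi κ (rotated S u).2 0 = jacobi κ (a • (rotated S u).2) 0 := by
    funext r
    simp [jacobi, geod, smul_comm a]
  ext X
  constructor
  · rintro ⟨hX, hker⟩
    obtain ⟨hXJ, hnA⟩ := (mem_tangentSpaceM_iff hκ hS hconv hquad hu).1 hX
    obtain ⟨A, hA, B, hB, rfl⟩ := hXJ.exists_eq_jacobi hκ
    rw [jacobi_zero] at hnA
    have hwB : bil κ (rotated S u).2 B = 0 := by
      simpa [omegaK_jacobi F hκ hA hB hn, F.nn, F.wn, kappa_ne_zero hκ]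
        using hker _ (hmem h0 hn (bil_zero_right _ _))
    have hnB : bil κ (inwardNormal κ S u.1.1) B = 0 := by
      simpa [omegaK_jacobi F hκ hA hB hw, F.nw, F.ww, kappa_ne_zero hκ]
        using hker _ (hmem h0 hw (bil_zero_right _ _))
    refine ⟨bil κ (rotated S u).2 A, (hsmul _).symm ▸ (jacobi_inj hκ).2 ⟨?_, ?_⟩⟩
    · exact F.reverse.eq_smul hκ hA.1 hA.2 hnA
    · exact F.eq_zero hκ hB.1 hnB hB.2 hwB
  · rintro ⟨a, rfl⟩
    have haw := smul_mem_normalSpace a hw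
    rw [hsmul]
    refine ⟨hmem haw h0 (by simp [F.nw]), fun Y hY => ?_⟩
    obtain ⟨hYJ, hnA'⟩ := (mem_tangentSpaceM_iff hκ hS hconv hquad hu).1 hY
    obtain ⟨A', -, B', hB', rfl⟩ := hYJ.exists_eq_jacobi hκ
    rw [jacobi_zero] at hnA'
    simp [omegaK_jacobi F hκ haw h0 hB', hnA', F.nw]

end Billiard

end GeodesicBilliard

theorem mainTheorem3 (κ : ℝ) (hκ : κ = 1 ∨ κ = -1) (S : Set GeodesicBilliard.E4)
    (hS : GeodesicBilliard.IsCompactSurface κ S)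
    (hconv : GeodesicBilliard.StrictlyConvex κ S)
    (hquad : GeodesicBilliard.QuadraticallyConvex κ S) :
    ∃ N : GeodesicBilliard.unitTangentBundle κ → ℝ → GeodesicBilliard.E4,
      ∀ u ∈ GeodesicBilliard.unitTangentSurface κ S,
        (∀ ξ, GeodesicBilliard.IsOutwardUnitNormal S u ξ ↔ ξ = N u) ∧
        (∀ t, GeodesicBilliard.transported S u t ∈ GeodesicBilliard.unitTangentBundle κ) ∧
        GeodesicBilliard.IsGeodesicGK (GeodesicBilliard.billiardF S u) ∧
        GeodesicBilliard.HasVelocity (GeodesicBilliard.billiardF S u) 0 u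
          (GeodesicBilliard.complexStructure u (N u)) ∧
        {X ∈ GeodesicBilliard.tangentSpaceM S u |
            ∀ Y ∈ GeodesicBilliard.tangentSpaceM S u, GeodesicBilliard.omegaK u X Y = 0} =
          {X | ∃ a : ℝ, X = a • GeodesicBilliard.complexStructure u (N u)} := by
  refine ⟨fun u => GeodesicBilliard.jacobi κ (-GeodesicBilliard.inwardNormal κ S u.1.1) 0,
    fun u hu => ?_⟩
  have F := GeodesicBilliard.isFrame_rotated hκ hS hconv hu
  simp only [GeodesicBilliard.complexStructure_jacobi_neg_inwardNormal hκ]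
  exact ⟨fun ξ => GeodesicBilliard.isOutwardUnitNormal_iff hκ hS hconv hquad hu,
    GeodesicBilliard.transported_mem_unitTangentBundle F hκ,
    GeodesicBilliard.isGeodesicGK_billiardF F hκ,
    GeodesicBilliard.hasVelocity_billiardF F hκ,
    GeodesicBilliard.characteristicLine_eq hκ hS hconv hquad hu⟩
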